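/- **Conventions.** A \emph{display map category} $(\mathbb B,\mathcal D)$ is a category $\mathbb B$ with a class $\mathcal D$ of maps containing the identities, such that pullbacks of maps of $\mathcal D$ along arbitrary maps exist and are always in $\mathcal D$. For $I\in\mathbb B$, $\mathcal D/I$ is the full subcategory of $\mathbb B/I$ on the maps of $\mathcal D$, $\mathcal D_I$ is the class of maps of $\mathcal D/I$ whose underlying map is in $\mathcal D$, and ${}^\square\mathcal D_I$ is the class of maps of $\mathcal D/I$ with the left lifting property against $\mathcal D_I$. $(\mathbb B,\mathcal D)$ is \emph{well-rooted} if $\mathbb B$ has a terminal object $1$ and every $X\to1$ is in $\mathcal D$. It has \emph{$\Sigma$-types} if $\mathcal D$ is closed under composition; \emph{$\Pi$-types} if for all $f:B\to A$ and $g:C\to B$ in $\mathcal D$ there is a couniversal arrow from $f^*:\mathbb B/A\to\mathbb B/B$ to $g$ with domain in $\mathcal D$; \emph{identity types} if every pullback functor $h^*:\mathcal D/J\to\mathcal D/I$ maps ${}^\square\mathcal D_J$ into ${}^\square\mathcal D_I$ and every map of every $\mathcal D/I$ factors as a map of ${}^\square\mathcal D_I$ followed by a map of $\mathcal D_I$;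 \emph{finite sum types} if every $\mathcal D/I$ has finite coproducts and every $h^*$ preserves them. A \emph{universe} in $(\mathbb B,\mathcal D)$ is a map $u\in\mathcal D$ such that the class $\mathcal D_u$ of pullbacks of $u$ (the \emph{$u$-small} maps) is a class of display maps. It is closed under $\Sigma$-types, resp. $\Pi$-types, if $(\mathbb B,\mathcal D_u)$ has them; under identity types if every map of every $\mathcal D_u/I$ factors in $\mathcal D_u/I$ as a map of ${}^\square\mathcal D_I$ followed by a map of $(\mathcal D_u)_I$; under finite sums if $(\mathbb B,\mathcal D_u)$ has finite sum types and the inclusions $\mathcal D_u/I\to\mathcal D/I$ preserve them. A monad $T$ on a category with finite products and finite coproducts is \emph{additive} if $T0\cong1$ and the canonical maps $T(X+Y)\to TX\times TY$ are isomorphisms. A \emph{fibred monad} $M$ on $\mathsf{cod}:\mathcal D\to\mathbb B$ is a monad on the category $\mathcal D$ (maps: commutative squares) strictly over $\mathbb B$, with vertical unit and multiplication, preserving pullback squares; it restricts to a monad $M_I$ on each $\mathcal D/I$. **Theorem (Diller–Nahm model).** Let $(\mathbb B,\mathcal D)$ be a well-rooted display map category with $\Sigma$-, $\Pi$-, identity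 and finite sum types, and let $M$ be a fibred monad on $\mathsf{cod}:\mathcal D\to\mathbb B$ such that every $M_I$ is additive. Let $\mathsf{Dill}$ be the total category of the fibration opposite to the fibred Kleisli category of $M$: its fibre over $I$ is $\mathsf{Dill}(I)=\big((\mathcal D/I)_{M_I}\big)^{\mathsf{op}}$, its objects are the maps of $\mathcal D$, and a map from $g:B\to J$ to $f:A\to I$ is a pair $(h,\phi)$ with $h:J\to I$ in $\mathbb B$ and $\phi:h^*f\to M_J(g)$ in $\mathcal D/J$. Let $\mathcal G$ be the class of those $(h,\phi)$ with $h\in\mathcal D$ and whose vertical component $g\to h^*f$ in $\mathsf{Dill}(J)$, which is represented by $\phi$, is a product projection. Then $(\mathsf{Dill},\mathcal G)$ is a well-rooted display map category with $\Sigma$-, $\Pi$- and identity types. Moreover, let $u$ be a universe in $(\mathbb B,\mathcal D)$ closed under $\Sigma$-, $\Pi$-, identity and finite sum types. Then: (a) $(\mathsf{Dill},\mathcal G)$ has a universe closed under $\Sigma$-, $\Pi$- and identity types. (b) $(\mathsf{Dill},\mathcal G)$ has a universe whose small maps are precisely the $(h,\phi)$ such that $h$ is $u$-small and the vertical component $g\to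 h^*f$ is a product projection in $\mathsf{Dill}(J)$ with a $u$-small complement, i.e. it is the first projection of a product diagram of $h^*f$ and some $u$-small $x:X\to J$. This universe is closed under $\Sigma$- and identity types, and it is closed under $\Pi$-types if $M$ sends $u$-small maps to $u$-small maps. -/

import Mathlib

open CategoryTheory CategoryTheory.Limits

universe v u

namespace DillerNahm

/-! ## Display map categories -/

section DisplayMapCategories

variable {B : Type u} [Category.{v} B]

/-- `D` is a class of display maps: it contains the identities, the pullback of a display map along
an arbitrary map exists, and any pullback of a display map is a display map. -/
class IsDisplayMapClass (D : MorphismProperty B) : Prop extends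
  D.ContainsIdentities, D.HasPullbacks, D.IsStableUnderBaseChange

/-- `(B, D)` is well-rooted: `B` has a terminal object and all maps to it are display maps. -/
def IsWellRooted (D : MorphismProperty B) : Prop :=
  ∃ _ : HasTerminal B, ∀ X : B, D (terminal.from X)

/-- `(B, D)` has `Σ`-types: `D` is closed under composition. -/
abbrev HasSigmaTypes (D : MorphismProperty B) : Prop := D.IsStableUnderComposition

/-- The display slice `D/I`: the full subcategory of the slice `B/I` on the display maps. -/
abbrev Slice (D : MorphismProperty B) (I : B) := D.Over ⊤ I

/-- An object of `D/I`, seen as a display map to `I`. -/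
abbrev proj {D : MorphismProperty B} {I : B} (X : Slice D I) : X.left ⟶ I := X.hom

theorem left_proj {D : MorphismProperty B} {I : B} {X Y : Slice D I} (f : X ⟶ Y) :
    f.left ≫ proj Y = proj X :=
  MorphismProperty.Over.w f

theorem left_proj_id {D : MorphismProperty B} {I : B} {X Y : Slice D I} (f : X ⟶ Y) :
    f.left ≫ proj Y = proj X ≫ 𝟙 I :=
  (left_proj f).trans (Category.comp_id _).symm

/-- The class `D_I` of the maps of `D/I` whose underlying map is a display map. -/
def sliceDisplay (D : MorphismProperty B) (I : B) : MorphismProperty (Slice D I) :=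
  fun _ _ f => D f.left

/-- The reindexing functor `h^* : D/J ⥤ D/I` given by pullback along `h : I ⟶ J`. -/
noncomputable abbrev reindex (D : MorphismProperty B) [IsDisplayMapClass D] {I J : B} (h : I ⟶ J) :
    Slice D J ⥤ Slice D I :=
  MorphismProperty.Over.pullback D ⊤ h

theorem hasPullbacksAlong {D : MorphismProperty B} [IsDisplayMapClass D] {X Y : B} {f : X ⟶ Y}
    (hf : D f) : HasPullbacksAlong f := fun g =>
  haveI := MorphismProperty.hasPullback g hf
  hasPullback_symmetry f g

/-- `(B, D)` has `Π`-types: for all display maps `f : Y ⟶ X` and `g : Z ⟶ Y` there is a couniversal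
arrow from the pullback functor `f^* : B/X ⥤ B/Y` to `g` whose domain is in `D`. -/
def HasPiTypes (D : MorphismProperty B) [IsDisplayMapClass D] : Prop :=
  ∀ ⦃X Y Z : B⦄ (f : Y ⟶ X) (g : Z ⟶ Y) (hf : D f), D g →
    haveI : HasPullbacksAlong f := hasPullbacksAlong hf
    ∃ P : CostructuredArrow (Over.pullback f) (Over.mk g),
      D P.left.hom ∧ Nonempty (IsTerminal P)

/-- `(B, D)` has stable left classes: pullback along any `h : I ⟶ J` maps the left class of `D_J`
into the left class of `D_I`. -/
def HasStableLeftClasses (D : MorphismProperty B) [IsDisplayMapClass D] : Prop :=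
  ∀ ⦃I J : B⦄ (h : I ⟶ J) ⦃X Y : Slice D J⦄ (m : X ⟶ Y),
    (sliceDisplay D J).llp m → (sliceDisplay D I).llp ((reindex D h).map m)

/-- `(B, D)` has identity types: it has stable left classes, and in each `D/I` every map factors as
a left map of `D_I` followed by a map in `D_I`. -/
def HasIdentityTypes (D : MorphismProperty B) [IsDisplayMapClass D] : Prop :=
  HasStableLeftClasses D ∧
    ∀ I : B, (sliceDisplay D I).llp.HasFactorization (sliceDisplay D I)

/-- `(B, D)` has finite sum types: the fibration `cod : D ⟶ B` has fibred finite coproducts, i.e.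
each fibre `D/I` has finite coproducts and reindexing preserves them. -/
class HasFiniteSumTypes (D : MorphismProperty B) [IsDisplayMapClass D] : Prop where
  hasFiniteCoproducts : ∀ I : B, HasFiniteCoproducts (Slice D I)
  preserves : ∀ ⦃I J : B⦄ (h : I ⟶ J), PreservesFiniteCoproducts (reindex D h)

attribute [instance] HasFiniteSumTypes.hasFiniteCoproducts

/-- The class `D_u` of `u`-small maps: the pullbacks of `u`. -/
def smallMaps {T U : B} (u : T ⟶ U) : MorphismProperty B :=
  fun X Y f => ∃ (t : X ⟶ T) (s : Y ⟶ U), IsPullback t f u s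

/-- A universe in `(B, D)`: a display map `u` whose class of pullbacks is a class of display
maps. -/
structure Universe (D : MorphismProperty B) where
  /-- The domain of `u`. -/
  tot : B
  /-- The codomain of `u`. -/
  base : B
  /-- The universal small map. -/
  u : tot ⟶ base
  mem : D u
  isDisplayMapClass : IsDisplayMapClass (smallMaps u)

namespace Universe

variable {D : MorphismProperty B} (U : Universe D)

/-- The class of small maps of a universe. -/
def small : MorphismProperty B := smallMaps U.u

instance : IsDisplayMapClass U.small := U.isDisplayMapClass

theorem small_le [IsDisplayMapClass D] : U.small ≤ D := by
  rintro X Y f ⟨t, s, h⟩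
  exact MorphismProperty.of_isPullback h U.mem

/-- The inclusion of `D_u/I` in `D/I`. -/
abbrev inclusion [IsDisplayMapClass D] (I : B) : Slice U.small I ⥤ Slice D I :=
  MorphismProperty.Over.changeProp I U.small_le le_rfl

/-- The universe has (is closed under) `Σ`-types. -/
def ClosedUnderSigma : Prop := HasSigmaTypes U.small

/-- The universe has (is closed under) `Π`-types. -/
def ClosedUnderPi : Prop := HasPiTypes U.small

/-- The universe has (is closed under) identity types: every map of `D_u/I` factors in `D_u/I` as a
map in the left class of `D_I` followed by a map in `(D_u)_I`. -/
def ClosedUnderIdentity [IsDisplayMapClass D] : Prop :=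
  ∀ I : B, ((sliceDisplay D I).llp.inverseImage (U.inclusion I)).HasFactorization
    (sliceDisplay U.small I)

/-- The universe is closed under finite sums: `(B, D_u)` has finite sum types, which are preserved
by the inclusion into `(B, D)`. -/
def ClosedUnderFiniteSums [IsDisplayMapClass D] : Prop :=
  HasFiniteSumTypes U.small ∧ ∀ I : B, PreservesFiniteCoproducts (U.inclusion I)

end Universe

/-- If `(B, D)` has `Σ`-types then every `D/I` has finite products. -/
instance hasFiniteProducts_slice (D : MorphismProperty B) [IsDisplayMapClass D] [HasSigmaTypes D]
    (I : B) : HasFiniteProducts (Slice D I) := by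
  have : HasBinaryProducts (Slice D I) := by
    refine @hasBinaryProducts_of_hasLimit_pair _ _ ?_
    intro X Y
    have : HasPullback (proj X) (proj Y) := MorphismProperty.hasPullback (proj Y) X.prop
    have hp := IsPullback.of_hasPullback (proj X) (proj Y)
    let P : Slice D I := MorphismProperty.Over.mk ⊤ (pullback.fst (proj X) (proj Y) ≫ proj X)
      (D.comp_mem _ _ (MorphismProperty.of_isPullback hp.flip Y.prop) X.prop)
    let p : P ⟶ X := MorphismProperty.Over.homMk (pullback.fst (proj X) (proj Y)) rfl
    let q : P ⟶ Y := MorphismProperty.Over.homMk (pullback.snd (proj X) (proj Y)) hp.w.symm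
    have hw (s : BinaryFan X Y) : s.fst.left ≫ proj X = s.snd.left ≫ proj Y :=
      (left_proj s.fst).trans (left_proj s.snd).symm
    refine HasLimit.mk ⟨BinaryFan.mk p q, BinaryFan.isLimitMk (fun s =>
      MorphismProperty.Over.homMk (hp.lift s.fst.left s.snd.left (hw s))
        ((Category.assoc _ _ _).symm.trans ((congrArg (fun k => k ≫ proj X)
          (hp.lift_fst s.fst.left s.snd.left (hw s))).trans (left_proj s.fst))))
      (fun s => MorphismProperty.Over.Hom.ext (hp.lift_fst _ _ (hw s)))
      (fun s => MorphismProperty.Over.Hom.ext (hp.lift_snd _ _ (hw s)))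
      (fun s m h₁ h₂ => MorphismProperty.Over.Hom.ext (hp.hom_ext ?_ ?_))⟩
    · exact (congrArg (fun k => k.left) h₁).trans (hp.lift_fst _ _ (hw s)).symm
    · exact (congrArg (fun k => k.left) h₂).trans (hp.lift_snd _ _ (hw s)).symm
  exact hasFiniteProducts_of_has_binary_and_terminal

end DisplayMapCategories

/-! ## Additive monads -/

section Additive

variable {C : Type u} [Category.{v} C] [HasFiniteProducts C] [HasFiniteCoproducts C]

/-- The Kleisli zero map `X ⟶ T Y`, which is `X ⟶ 1 ≅ T 0 ⟶ T Y`. -/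
noncomputable def kleisliZero (T : Monad C) (h : IsTerminal (T.obj (⊥_ C))) (X Y : C) :
    X ⟶ T.obj Y :=
  h.from X ≫ T.map (initial.to Y)

/-- The canonical map `T (X + Y) ⟶ T X × T Y` available when `T 0` is terminal: its components are
the Kleisli extensions of `[η, 0] : X + Y ⟶ T X` and `[0, η] : X + Y ⟶ T Y`. -/
noncomputable def additiveComparison (T : Monad C) (h : IsTerminal (T.obj (⊥_ C))) (X Y : C) :
    T.obj (X ⨿ Y) ⟶ T.obj X ⨯ T.obj Y :=
  prod.lift
    (T.map (coprod.desc (T.η.app X) (kleisliZero T h Y X)) ≫ T.μ.app X)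
    (T.map (coprod.desc (kleisliZero T h X Y) (T.η.app Y)) ≫ T.μ.app Y)

/-- A monad is additive if `T 0 ≅ 1` and the canonical maps `T (X + Y) ⟶ T X × T Y` are
isomorphisms. -/
def IsAdditiveMonad (T : Monad C) : Prop :=
  ∃ h : IsTerminal (T.obj (⊥_ C)), ∀ X Y : C, IsIso (additiveComparison T h X Y)

end Additive

section ProductProjection

variable {C : Type u} [Category.{v} C]

/-- `f : Y ⟶ X` is a product projection with complement `Z`: it is the first projection of a product
diagram `X ⟵ Y ⟶ Z`. -/
def IsProductProjection {X Y : C} (f : Y ⟶ X) (Z : C) : Prop :=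
  ∃ g : Y ⟶ Z, Nonempty (IsLimit (BinaryFan.mk f g))

end ProductProjection

/-! ## Fibred monads -/

section FibredMonads

variable {B : Type u} [Category.{v} B]

/-- A fibred monad on the codomain fibration `cod : D ⟶ B`: a monad on the total category `D`, whose
objects are the display maps and whose maps are the commutative squares, which is strictly over `B`
(it sends a display map with codomain `I` to one with codomain `I`, and a square over `h` to a
square over `h`), whose unit and multiplication are vertical, and which preserves cartesian maps,
i.e. pullback squares. -/
structure FibredMonad (D : MorphismProperty B) where
  /-- The action on objects. -/
  obj {I : B} (X : Slice D I) : Slice D I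
  /-- The action on squares: `k` is the top map, and `h` the bottom map. -/
  map {I J : B} (h : I ⟶ J) {X : Slice D I} {Y : Slice D J} (k : X.left ⟶ Y.left)
    (w : k ≫ proj Y = proj X ≫ h) : (obj X).left ⟶ (obj Y).left
  map_proj {I J : B} (h : I ⟶ J) {X : Slice D I} {Y : Slice D J} (k : X.left ⟶ Y.left)
    (w : k ≫ proj Y = proj X ≫ h) : map h k w ≫ proj (obj Y) = proj (obj X) ≫ h
  map_id {I : B} (X : Slice D I) : map (𝟙 I) (𝟙 X.left) (by simp) = 𝟙 (obj X).left
  map_comp {I J K : B} (h : I ⟶ J) (h' : J ⟶ K) {X : Slice D I} {Y : Slice D J} {Z : Slice D K}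
    (k : X.left ⟶ Y.left) (w : k ≫ proj Y = proj X ≫ h)
    (k' : Y.left ⟶ Z.left) (w' : k' ≫ proj Z = proj Y ≫ h') :
    map (h ≫ h') (k ≫ k') (by rw [Category.assoc, w', reassoc_of% w]) = map h k w ≫ map h' k' w'
  /-- The unit, a map in `D/I`. -/
  unit {I : B} (X : Slice D I) : X ⟶ obj X
  /-- The multiplication, a map in `D/I`. -/
  mul {I : B} (X : Slice D I) : obj (obj X) ⟶ obj X
  unit_naturality {I J : B} (h : I ⟶ J) {X : Slice D I} {Y : Slice D J} (k : X.left ⟶ Y.left)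
    (w : k ≫ proj Y = proj X ≫ h) : k ≫ (unit Y).left = (unit X).left ≫ map h k w
  mul_naturality {I J : B} (h : I ⟶ J) {X : Slice D I} {Y : Slice D J} (k : X.left ⟶ Y.left)
    (w : k ≫ proj Y = proj X ≫ h) :
    map h (map h k w) (map_proj h k w) ≫ (mul Y).left = (mul X).left ≫ map h k w
  left_unit {I : B} (X : Slice D I) : unit (obj X) ≫ mul X = 𝟙 (obj X)
  right_unit {I : B} (X : Slice D I) :
    map (𝟙 I) (unit X).left (left_proj_id _) ≫ (mul X).left = 𝟙 (obj X).left
  assoc {I : B} (X : Slice D I) :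
    map (𝟙 I) (mul X).left (left_proj_id _) ≫ (mul X).left = (mul (obj X)).left ≫ (mul X).left
  map_isPullback {I J : B} (h : I ⟶ J) {X : Slice D I} {Y : Slice D J} (k : X.left ⟶ Y.left)
    (w : k ≫ proj Y = proj X ≫ h) (hk : IsPullback k (proj X) (proj Y) h) :
    IsPullback (map h k w) (proj (obj X)) (proj (obj Y)) h

namespace FibredMonad

variable {D : MorphismProperty B} (M : FibredMonad D)

theorem map_congr {I J : B} {h h' : I ⟶ J} (e : h = h') {X : Slice D I} {Y : Slice D J}
    {k k' : X.left ⟶ Y.left} (e' : k = k') (w : k ≫ proj Y = proj X ≫ h) :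
    M.map h k w = M.map h' k' (by rw [← e, ← e', w]) := by
  subst e e'
  rfl

/-- The action of `M` on a map of `D/I`. -/
def fibreMap {I : B} {X Y : Slice D I} (f : X ⟶ Y) : M.obj X ⟶ M.obj Y :=
  MorphismProperty.Over.homMk (M.map (𝟙 I) f.left (left_proj_id f))
    ((M.map_proj (𝟙 I) f.left (left_proj_id f)).trans (Category.comp_id _))

theorem fibreMap_left {I : B} {X Y : Slice D I} (f : X ⟶ Y) :
    (M.fibreMap f).left = M.map (𝟙 I) f.left (left_proj_id f) := rfl

/-- The monad `M_I` on the fibre `D/I`. -/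
def fibre (I : B) : Monad (Slice D I) where
  obj X := M.obj X
  map f := M.fibreMap f
  map_id X := MorphismProperty.Over.Hom.ext (M.map_id X)
  map_comp f g := MorphismProperty.Over.Hom.ext
    ((M.map_congr (Category.comp_id (𝟙 I)).symm rfl _).trans
      (M.map_comp (𝟙 I) (𝟙 I) f.left (left_proj_id f) g.left (left_proj_id g)))
  η :=
    { app := fun X => M.unit X
      naturality := fun _ _ f => MorphismProperty.Over.Hom.ext
        (M.unit_naturality (𝟙 I) f.left (left_proj_id f)) }
  μ :=
    { app := fun X => M.mul X
      naturality := fun _ _ f => MorphismProperty.Over.Hom.ext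
        (M.mul_naturality (𝟙 I) f.left (left_proj_id f)) }
  assoc X := MorphismProperty.Over.Hom.ext (M.assoc X)
  left_unit X := M.left_unit X
  right_unit X := MorphismProperty.Over.Hom.ext (M.right_unit X)

/-- The fibre category `Dill(I)`: the opposite of the Kleisli category of `M_I`. -/
abbrev DillFibre (I : B) := (Kleisli (M.fibre I))ᵒᵖ

/-- An object of `D/I` as an object of `Dill(I)`. -/
abbrev dillObj {I : B} (X : Slice D I) : M.DillFibre I := Opposite.op (Kleisli.mk (M.fibre I) X)

/-- A map `X ⟶ Y` of `Dill(I)` is given by a map `Y ⟶ M X` of `D/I`. -/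
def dillMk {I : B} {X Y : Slice D I} (φ : Y ⟶ M.obj X) : M.dillObj X ⟶ M.dillObj Y :=
  Quiver.Hom.op (Kleisli.Hom.mk φ : Kleisli.mk (M.fibre I) Y ⟶ Kleisli.mk (M.fibre I) X)

/-- The map `Y ⟶ M X` of `D/I` representing a map `X ⟶ Y` of `Dill(I)`. -/
def rep {I : B} {X Y : Slice D I} (φ : M.dillObj X ⟶ M.dillObj Y) : Y ⟶ M.obj X :=
  φ.unop.of

theorem dill_ext {I : B} {X Y : Slice D I} {φ ψ : M.dillObj X ⟶ M.dillObj Y}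
    (e : (M.rep φ).left = (M.rep ψ).left) : φ = ψ :=
  Quiver.Hom.unop_inj (Kleisli.hom_ext (MorphismProperty.Over.Hom.ext e))

theorem rep_comp_left {I : B} {X Y Z : Slice D I} (φ : M.dillObj X ⟶ M.dillObj Y)
    (ψ : M.dillObj Y ⟶ M.dillObj Z) :
    (M.rep (φ ≫ ψ)).left =
      (M.rep ψ).left ≫ M.map (𝟙 I) (M.rep φ).left (left_proj_id _) ≫ (M.mul X).left := rfl

theorem rep_dillMk {I : B} {X Y : Slice D I} (φ : Y ⟶ M.obj X) : M.rep (M.dillMk φ) = φ := rfl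

variable [IsDisplayMapClass D]

/-- The projection `h^* Y ⟶ Y`, a map over `h`. -/
noncomputable def pr {I J : B} (h : I ⟶ J) (Y : Slice D J) :
    ((reindex D h).obj Y).left ⟶ Y.left :=
  pullback.fst (proj Y) h

theorem isPullback_pr {I J : B} (h : I ⟶ J) (Y : Slice D J) :
    IsPullback (pr h Y) (proj ((reindex D h).obj Y)) (proj Y) h :=
  IsPullback.of_hasPullback (proj Y) h

theorem isPullback_map_pr {I J : B} (h : I ⟶ J) (Y : Slice D J) :
    IsPullback (M.map h (pr h Y) (isPullback_pr h Y).w) (proj (M.obj ((reindex D h).obj Y)))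
      (proj (M.obj Y)) h :=
  M.map_isPullback h (pr h Y) (isPullback_pr h Y).w (isPullback_pr h Y)

/-- A map `k : W ⟶ M Y` over `h : I ⟶ J` corresponds to a map `W ⟶ M (h^* Y)` of `D/I`, since `M`
preserves the pullback square of `h^* Y`. -/
noncomputable def transpose {I J : B} (h : I ⟶ J) {W : Slice D I} {Y : Slice D J}
    (k : W.left ⟶ (M.obj Y).left) (w : k ≫ proj (M.obj Y) = proj W ≫ h) :
    W ⟶ M.obj ((reindex D h).obj Y) :=
  MorphismProperty.Over.homMk ((M.isPullback_map_pr h Y).lift k (proj W) w)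
    ((M.isPullback_map_pr h Y).lift_snd _ _ _)

theorem transpose_left_map {I J : B} (h : I ⟶ J) {W : Slice D I} {Y : Slice D J}
    (k : W.left ⟶ (M.obj Y).left) (w : k ≫ proj (M.obj Y) = proj W ≫ h) :
    (M.transpose h k w).left ≫ M.map h (pr h Y) (isPullback_pr h Y).w = k :=
  (M.isPullback_map_pr h Y).lift_fst _ _ _

/-- The projection `(h ≫ k)^* Z ⟶ k^* Z`, a map over `h`. -/
noncomputable def prComp {I J K : B} (h : I ⟶ J) (k : J ⟶ K) (Z : Slice D K) :
    ((reindex D (h ≫ k)).obj Z).left ⟶ ((reindex D k).obj Z).left :=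
  (isPullback_pr k Z).lift (pr (h ≫ k) Z) (proj ((reindex D (h ≫ k)).obj Z) ≫ h)
    ((isPullback_pr (h ≫ k) Z).w.trans (Category.assoc _ _ _).symm)

theorem prComp_pr {I J K : B} (h : I ⟶ J) (k : J ⟶ K) (Z : Slice D K) :
    prComp h k Z ≫ pr k Z = pr (h ≫ k) Z :=
  (isPullback_pr k Z).lift_fst _ _ _

theorem prComp_proj {I J K : B} (h : I ⟶ J) (k : J ⟶ K) (Z : Slice D K) :
    prComp h k Z ≫ proj ((reindex D k).obj Z) = proj ((reindex D (h ≫ k)).obj Z) ≫ h :=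
  (isPullback_pr k Z).lift_snd _ _ _

/-- The reindexing of a map `φ : Y ⟶ k^* Z` of `Dill(J)` along `h : I ⟶ J`, a map
`h^* Y ⟶ h^* (k^* Z) ≅ (h ≫ k)^* Z` of `Dill(I)`. -/
noncomputable def reindexVert {I J K : B} (h : I ⟶ J) (k : J ⟶ K) {Y : Slice D J} {Z : Slice D K}
    (φ : M.dillObj Y ⟶ M.dillObj ((reindex D k).obj Z)) :
    M.dillObj ((reindex D h).obj Y) ⟶ M.dillObj ((reindex D (h ≫ k)).obj Z) :=
  M.dillMk (M.transpose h (prComp h k Z ≫ (M.rep φ).left)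
    ((Category.assoc _ _ _).trans
      ((congrArg (fun t => prComp h k Z ≫ t) (left_proj (M.rep φ))).trans (prComp_proj h k Z))))

theorem rep_reindexVert {I J K : B} (h : I ⟶ J) (k : J ⟶ K) {Y : Slice D J} {Z : Slice D K}
    (φ : M.dillObj Y ⟶ M.dillObj ((reindex D k).obj Z)) :
    (M.rep (M.reindexVert h k φ)).left ≫ M.map h (pr h Y) (isPullback_pr h Y).w =
      prComp h k Z ≫ (M.rep φ).left :=
  M.transpose_left_map h _ _

theorem transpose_hom_ext {I J : B} (h : I ⟶ J) {V : B} {Y : Slice D J}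
    {a b : V ⟶ (M.obj ((reindex D h).obj Y)).left}
    (e₁ : a ≫ M.map h (pr h Y) (isPullback_pr h Y).w = b ≫ M.map h (pr h Y) (isPullback_pr h Y).w)
    (e₂ : a ≫ proj (M.obj ((reindex D h).obj Y)) = b ≫ proj (M.obj ((reindex D h).obj Y))) :
    a = b :=
  (M.isPullback_map_pr h Y).hom_ext e₁ e₂

/-- The map `X ⟶ 1^* X` of `Dill(I)` represented by `1^* X ≅ X ⟶ M X`. -/
noncomputable def idVert {I : B} (X : Slice D I) :
    M.dillObj X ⟶ M.dillObj ((reindex D (𝟙 I)).obj X) :=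
  M.dillMk (MorphismProperty.Over.homMk (pr (𝟙 I) X ≫ (M.unit X).left)
    ((Category.assoc _ _ _).trans
      ((congrArg (fun t => pr (𝟙 I) X ≫ t) (left_proj (M.unit X))).trans
        ((isPullback_pr (𝟙 I) X).w.trans (Category.comp_id _)))))

theorem rep_idVert {I : B} (X : Slice D I) :
    (M.rep (M.idVert X)).left = pr (𝟙 I) X ≫ (M.unit X).left := rfl

theorem idVert_comp {I J : B} {X : Slice D I} {Y : Slice D J} (h : I ⟶ J)
    (φ : M.dillObj X ⟶ M.dillObj ((reindex D h).obj Y)) {V : B}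
    (a : V ⟶ ((reindex D (𝟙 I ≫ h)).obj Y).left) (b : V ⟶ ((reindex D h).obj Y).left)
    (h₁ : a ≫ pr (𝟙 I ≫ h) Y = b ≫ pr h Y)
    (h₂ : a ≫ proj ((reindex D (𝟙 I ≫ h)).obj Y) = b ≫ proj ((reindex D h).obj Y)) :
    a ≫ (M.rep (M.idVert X ≫ M.reindexVert (𝟙 I) h φ)).left = b ≫ (M.rep φ).left := by
  have e₁ : M.map (𝟙 I) (M.rep (M.idVert X)).left (left_proj_id _) ≫ (M.mul X).left =
      M.map (𝟙 I) (pr (𝟙 I) X) (isPullback_pr (𝟙 I) X).w := by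
    rw [M.map_congr (Category.comp_id (𝟙 I)).symm (M.rep_idVert X) (left_proj_id _),
      M.map_comp (𝟙 I) (𝟙 I) (pr (𝟙 I) X) (isPullback_pr (𝟙 I) X).w (M.unit X).left
        (left_proj_id (M.unit X)), Category.assoc, M.right_unit, Category.comp_id]
  have e₂ : a ≫ prComp (𝟙 I) h Y = b := by
    apply (isPullback_pr h Y).hom_ext
    · rw [Category.assoc, prComp_pr, h₁]
    · rw [Category.assoc, prComp_proj, Category.comp_id, h₂]
  rw [rep_comp_left, e₁, rep_reindexVert, ← e₂, Category.assoc]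

theorem comp_idVert {I J : B} {X : Slice D I} {Y : Slice D J} (h : I ⟶ J)
    (φ : M.dillObj X ⟶ M.dillObj ((reindex D h).obj Y)) {V : B}
    (a : V ⟶ ((reindex D (h ≫ 𝟙 J)).obj Y).left) (b : V ⟶ ((reindex D h).obj Y).left)
    (h₁ : a ≫ pr (h ≫ 𝟙 J) Y = b ≫ pr h Y)
    (h₂ : a ≫ proj ((reindex D (h ≫ 𝟙 J)).obj Y) = b ≫ proj ((reindex D h).obj Y)) :
    a ≫ (M.rep (φ ≫ M.reindexVert h (𝟙 J) (M.idVert Y))).left = b ≫ (M.rep φ).left := by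
  have e : a ≫ (M.rep (M.reindexVert h (𝟙 J) (M.idVert Y))).left =
      b ≫ (M.unit ((reindex D h).obj Y)).left := by
    apply M.transpose_hom_ext h
    · rw [Category.assoc, Category.assoc, rep_reindexVert, ← M.unit_naturality, rep_idVert,
        ← Category.assoc (prComp _ _ _), prComp_pr, ← Category.assoc, ← Category.assoc, h₁]
    · rw [Category.assoc, Category.assoc, left_proj, left_proj, h₂]
  have e' : (M.unit (M.obj X)).left ≫ (M.mul X).left = 𝟙 _ :=
    congrArg (fun t => t.left) (M.left_unit X)
  rw [rep_comp_left, ← Category.assoc, e, Category.assoc, ← Category.assoc (M.unit _).left,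
    ← M.unit_naturality, Category.assoc, e', Category.comp_id]

theorem comp_assoc_vert {I J K L : B} {X : Slice D I} {Y : Slice D J} {Z : Slice D K}
    {W : Slice D L} (h : I ⟶ J) (k : J ⟶ K) (l : K ⟶ L)
    (φ : M.dillObj X ⟶ M.dillObj ((reindex D h).obj Y))
    (ψ : M.dillObj Y ⟶ M.dillObj ((reindex D k).obj Z))
    (χ : M.dillObj Z ⟶ M.dillObj ((reindex D l).obj W)) {V : B}
    (a : V ⟶ ((reindex D ((h ≫ k) ≫ l)).obj W).left)
    (b : V ⟶ ((reindex D (h ≫ k ≫ l)).obj W).left)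
    (h₁ : a ≫ pr ((h ≫ k) ≫ l) W = b ≫ pr (h ≫ k ≫ l) W)
    (h₂ : a ≫ proj ((reindex D ((h ≫ k) ≫ l)).obj W) =
      b ≫ proj ((reindex D (h ≫ k ≫ l)).obj W)) :
    a ≫ (M.rep ((φ ≫ M.reindexVert h k ψ) ≫ M.reindexVert (h ≫ k) l χ)).left =
      b ≫ (M.rep (φ ≫ M.reindexVert h (k ≫ l) (ψ ≫ M.reindexVert k l χ))).left := by
  have e₀ : a ≫ prComp (h ≫ k) l W = (b ≫ prComp h (k ≫ l) W) ≫ prComp k l W := by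
    apply (isPullback_pr l W).hom_ext
    · simp only [Category.assoc, prComp_pr, h₁]
    · simp only [Category.assoc, prComp_proj]
      rw [← Category.assoc a, h₂, Category.assoc, ← Category.assoc (prComp h (k ≫ l) W),
        prComp_proj, Category.assoc]
  obtain ⟨t, ht⟩ : ∃ t : V ⟶ (M.obj ((reindex D (h ≫ k)).obj Z)).left,
      t = a ≫ (M.rep (M.reindexVert (h ≫ k) l χ)).left := ⟨_, rfl⟩
  have t₁ : t ≫ M.map (h ≫ k) (pr (h ≫ k) Z) (isPullback_pr (h ≫ k) Z).w =
      (b ≫ prComp h (k ≫ l) W) ≫ prComp k l W ≫ (M.rep χ).left := by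
    rw [ht]
    exact (Category.assoc _ _ _).trans ((congrArg (fun s => a ≫ s) (M.rep_reindexVert (h ≫ k) l χ)).trans
      ((Category.assoc _ _ _).symm.trans
        ((congrArg (fun s => s ≫ (M.rep χ).left) e₀).trans (Category.assoc _ _ _))))
  have t₂ : t ≫ proj (M.obj ((reindex D (h ≫ k)).obj Z)) =
      b ≫ proj ((reindex D (h ≫ k ≫ l)).obj W) := by
    rw [ht]
    exact (Category.assoc _ _ _).trans ((congrArg (fun s => a ≫ s) (left_proj _)).trans h₂)
  have e₁ : t ≫ M.map h (prComp h k Z) (prComp_proj h k Z) =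
      (b ≫ prComp h (k ≫ l) W) ≫ (M.rep (M.reindexVert k l χ)).left := by
    apply M.transpose_hom_ext k
    · rw [Category.assoc, Category.assoc, rep_reindexVert, ← t₁,
        ← M.map_comp h k (prComp h k Z) (prComp_proj h k Z) (pr k Z) (isPullback_pr k Z).w,
        M.map_congr rfl (prComp_pr h k Z)]
    · rw [Category.assoc, Category.assoc, M.map_proj, left_proj, Category.assoc, prComp_proj,
        ← Category.assoc, t₂, Category.assoc]
  have e₂ : t ≫ M.map (𝟙 I) (M.rep (M.reindexVert h k ψ)).left (left_proj_id _) ≫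
        (M.mul ((reindex D h).obj Y)).left =
      b ≫ (M.rep (M.reindexVert h (k ≫ l) (ψ ≫ M.reindexVert k l χ))).left := by
    apply M.transpose_hom_ext h
    · rw [Category.assoc, Category.assoc, Category.assoc, rep_reindexVert, ← M.mul_naturality,
        ← Category.assoc (M.map (𝟙 I) _ _),
        ← M.map_comp (𝟙 I) h _ (left_proj_id (M.rep (M.reindexVert h k ψ))) _
          (M.map_proj h (pr h Y) (isPullback_pr h Y).w),
        M.map_congr ((Category.id_comp h).trans (Category.comp_id h).symm)
          (M.rep_reindexVert h k ψ),
        M.map_comp h (𝟙 J) (prComp h k Z) (prComp_proj h k Z) (M.rep ψ).left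
          (left_proj_id (M.rep ψ)), rep_comp_left, Category.assoc, ← Category.assoc t, e₁]
      simp only [Category.assoc]
    · rw [Category.assoc, Category.assoc, Category.assoc, left_proj, left_proj, M.map_proj,
        Category.comp_id, t₂]
  rw [Category.assoc φ, M.rep_comp_left φ, M.rep_comp_left φ,
    M.rep_comp_left (M.reindexVert h k ψ)]
  have := congrArg (fun s => s ≫ M.map (𝟙 I) (M.rep φ).left (left_proj_id _) ≫ (M.mul X).left) e₂
  simpa only [ht, Category.assoc] using this

end FibredMonad

end FibredMonads

/-! ## The Diller-Nahm model -/

section Dill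

variable {B : Type u} [Category.{v} B] {D : MorphismProperty B}

/-- The objects of `Dill`: the display maps `A ⟶ I`. -/
structure Dill (M : FibredMonad D) where
  /-- The object `I`. -/
  base : B
  /-- The display map to `I`. -/
  fam : Slice D base

variable [IsDisplayMapClass D] (M : FibredMonad D)

namespace Dill

variable {M}

/-- A map `X ⟶ Y` of `Dill`, the total category of the fibration with fibres
`Dill(I) = (Kleisli M_I)ᵒᵖ`: a map `h` of `B` together with a map `X ⟶ h^* Y` in the fibre, i.e. a
map `h^* Y ⟶ M X` over the base of `X`. -/
@[ext]
structure Hom (X Y : Dill M) where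
  /-- The map of `B` underneath. -/
  base : X.base ⟶ Y.base
  /-- The vertical component. -/
  vert : M.dillObj X.fam ⟶ M.dillObj ((reindex D base).obj Y.fam)

theorem Hom.ext' {X Y : Dill M} {f g : Hom X Y} (e : f.base = g.base)
    (e' : ∀ (W : B) (a : W ⟶ ((reindex D f.base).obj Y.fam).left)
      (b : W ⟶ ((reindex D g.base).obj Y.fam).left),
      a ≫ FibredMonad.pr f.base Y.fam = b ≫ FibredMonad.pr g.base Y.fam →
      a ≫ proj _ = b ≫ proj _ → a ≫ (M.rep f.vert).left = b ≫ (M.rep g.vert).left) : f = g := by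
  obtain ⟨f, φ⟩ := f
  obtain ⟨g, γ⟩ := g
  dsimp only at e
  subst e
  congr 1
  apply M.dill_ext
  simpa using e' _ (𝟙 _) (𝟙 _) rfl rfl

noncomputable instance : Category (Dill M) where
  Hom := Hom
  id X := { base := 𝟙 X.base, vert := M.idVert X.fam }
  comp f g :=
    { base := f.base ≫ g.base
      vert := f.vert ≫ M.reindexVert f.base g.base g.vert }
  id_comp f := Hom.ext' (Category.id_comp _) fun _ => M.idVert_comp f.base f.vert
  comp_id f := Hom.ext' (Category.comp_id _) fun _ => M.comp_idVert f.base f.vert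
  assoc f g k := Hom.ext' (Category.assoc _ _ _) fun _ =>
    M.comp_assoc_vert f.base g.base k.base f.vert g.vert k.vert

variable (M)

/-- The class `G` of display maps of `Dill`: the base map is a display map, and the vertical
component is a product projection in the fibre `Dill(I)`. -/
def display : MorphismProperty (Dill M) := fun _ _ f =>
  D (Hom.base f) ∧ ∃ C, IsProductProjection (Hom.vert f) C

/-- The maps of `G` built from `S`-maps, for a class `S` of display maps of `B`: the base map is in
`S`, and the vertical component is a product projection with a complement `Z ⟶ I` in `S`. -/
def displayOf (S : MorphismProperty B) : MorphismProperty (Dill M) := fun X _ f =>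
  S (Hom.base f) ∧
    ∃ Z : Slice D X.base, S (proj Z) ∧ IsProductProjection (Hom.vert f) (M.dillObj Z)

end Dill

end Dill

end DillerNahm

set_option linter.unusedSectionVars false

namespace DillerNahm

/-! ### Display map categories in general: lifting, `Π`-types and factorizations in intrinsic form.
-/

section General

variable {C : Type u} [Category.{v} C]

/-! A product in the fibre `Dill(I)` is a coproduct of `D/I`, and finite sum types make these
coproducts stable under reindexing. Hence "the vertical component of `f : X ⟶ Y` is a product
projection" can be said inside `Dill`: there is a vertical map `c` from `X` to a family `C` such
that a map `Z ⟶ X` is the same as a map to `Y` and a map to `C` with compatible base maps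
(`IsComplement`, `isProductProjection_iff`). Pulling back reindexes the complement `C`, and
composing adds complements, which gives the display map structure and `Σ`-types.

Additivity is used in two ways. Since `M 0 = 1`, the initial family over `I` is a zero object: maps
into it and out of it are determined by their base maps. Hence the projection to `B` preserves
pullbacks (`isPullback_bs`). Since `M (X + Y) = M X × M Y`, the product of two families is also a
coproduct, so maps out of it split into two components (`IsComplement.exists_biproduct`).

Identity types. Let `m : X ⟶ Y` be a map over `A`, where `X ⟶ A` has complement `G`. Factor its base
map as a left map `r` followed by a display map `p`; lifting gives a retraction `ρ` of `r`. The
middle object is `p^* Y + ρ^* G`, and the first factor is cartesian over `r` on complements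
(`IsAnodyne`). Such maps are left: on bases because `r` is, and on families because vertical data
extend along a cartesian map over a left map. The latter holds since `M` preserves pullbacks and
`Π`-types make left maps stable under pullback along display maps. The condition is stable under
base change, and every left map is a retract of the first factor of its factorization, so left
classes are stable.

`Π`-types. Let `f : X ⟶ Y` and `g : Z ⟶ X` have complements `X₀` and `Z₀`. The pullback of `L ⟶ Y`
along `f` is a biproduct of reindexings of `L` and of `X₀`. A map from it to `Z` over `X` therefore
consists of a base map to that of `Z`, a map from the reindexed `X₀` to `Z₀`, and a map from the
reindexed `L` to `Z₀`. The first two do not involve the family of `L`, and are represented in `B` by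
`R = Π_{Z₀} M X₀` over the base of `Z`. The third is a map from `L` into the family `Σ_q` of the
reindexed `Z₀`. So the `Π`-type has as base the `Π`-type of `R` along the base of `f`, and that
family as complement (`exists_isPi_of_isRepresenting`).

Universes. For (a), take small base maps with initial complement, that is, cartesian maps; `R` is
then trivial and no condition on `M` is needed. For (b), the base of the universe classifies a small
map together with a small family on its total object; it is a `Π`-type along `u`. -/

theorem exists_isPullback_right {D : MorphismProperty C} [IsDisplayMapClass D] {X Y Z : C}
    {f : X ⟶ Z} (hf : D f) (g : Y ⟶ Z) :
    ∃ (P : C) (a : P ⟶ X) (b : P ⟶ Y), IsPullback a b f g ∧ D b := by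
  have : HasPullback f g := MorphismProperty.hasPullback g hf
  exact ⟨_, _, _, IsPullback.of_hasPullback f g,
    MorphismProperty.of_isPullback (IsPullback.of_hasPullback f g) hf⟩

/-! ### Left maps -/

/-- A map has the left lifting property against display maps as soon as it does so against the
squares whose bottom map is an identity. -/
def LeftMap (D : MorphismProperty C) {X Y : C} (f : X ⟶ Y) : Prop :=
  ∀ ⦃E : C⦄ (e : E ⟶ Y), D e → ∀ s : X ⟶ E, s ≫ e = f → ∃ t : Y ⟶ E, t ≫ e = 𝟙 Y ∧ f ≫ t = s

section

variable {D : MorphismProperty C} [IsDisplayMapClass D]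

/-- Pulling the display map back along `y` turns a general square into one whose bottom map is an
identity. -/
theorem LeftMap.exists_lift {X Y : C} {f : X ⟶ Y} (hf : LeftMap D f) {E F : C} {e : E ⟶ F}
    (he : D e) (s : X ⟶ E) (y : Y ⟶ F) (w : s ≫ e = f ≫ y) :
    ∃ t : Y ⟶ E, t ≫ e = y ∧ f ≫ t = s := by
  obtain ⟨P, a, b, h, hb⟩ := exists_isPullback_right he y
  obtain ⟨t, ht, ht'⟩ := hf b hb (h.lift s f w) (h.lift_snd _ _ _)
  refine ⟨t ≫ a, ?_, ?_⟩
  · rw [Category.assoc, h.w, reassoc_of% ht]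
  · rw [reassoc_of% ht', h.lift_fst]

/-- By `Σ`-types a display map into `Y` is itself a map of `D/I`, so lifting in the slice can be
tested on squares over `𝟙 Y`. In particular the left class does not depend on `I`. -/
theorem llp_iff_leftMap [HasSigmaTypes D] {I : C} {X Y : Slice D I} (m : X ⟶ Y) :
    (sliceDisplay D I).llp m ↔ LeftMap D m.left := by
  constructor
  · intro h E e he s hs
    let E' : Slice D I := MorphismProperty.Over.mk ⊤ (e ≫ proj Y) (D.comp_mem _ _ he Y.prop)
    let e' : E' ⟶ Y := MorphismProperty.Over.homMk e rfl
    let s' : X ⟶ E' := MorphismProperty.Over.homMk s (by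
      change s ≫ e ≫ proj Y = proj X
      rw [reassoc_of% hs, left_proj])
    have := h e' he
    have sq : CommSq s' m e' (𝟙 Y) := ⟨MorphismProperty.Over.Hom.ext (by
      change s ≫ e = m.left ≫ 𝟙 _
      rw [hs, Category.comp_id])⟩
    exact ⟨sq.lift.left, congrArg (fun k => k.left) sq.fac_right,
      congrArg (fun k => k.left) sq.fac_left⟩
  · intro h E F e he
    refine ⟨fun {s y} sq => ?_⟩
    obtain ⟨t, ht, ht'⟩ := h.exists_lift (e := e.left) he s.left y.left
      (congrArg (fun k => k.left) sq.w)
    exact ⟨⟨⟨MorphismProperty.Over.homMk t (by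
      change t ≫ proj E = proj Y
      rw [← left_proj e, reassoc_of% ht, left_proj]),
      MorphismProperty.Over.Hom.ext ht', MorphismProperty.Over.Hom.ext ht⟩⟩⟩

theorem LeftMap.of_iso {X X' Y Y' : C} {f : X ⟶ Y} (hf : LeftMap D f) {f' : X' ⟶ Y'}
    (i : X' ≅ X) (j : Y' ≅ Y) (w : f' ≫ j.hom = i.hom ≫ f) : LeftMap D f' := by
  intro E e he s hs
  obtain ⟨t, ht, ht'⟩ := hf.exists_lift he (i.inv ≫ s) j.inv (by
    rw [Category.assoc, hs, Iso.inv_comp_eq, ← Category.assoc, ← w, Category.assoc,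
      Iso.hom_inv_id, Category.comp_id])
  refine ⟨j.hom ≫ t, by rw [Category.assoc, ht, Iso.hom_inv_id], ?_⟩
  rw [← Category.assoc, w, Category.assoc, ht', Iso.hom_inv_id_assoc]

/-- Two pullbacks of the same map are isomorphic, so stability for the chosen reindexing functor
gives it for arbitrary pullback squares. -/
theorem HasStableLeftClasses.leftMap_slice [HasSigmaTypes D] (H : HasStableLeftClasses D)
    {I J X' Y' : C} (h : I ⟶ J) {X Y : Slice D J} {m : X ⟶ Y} (hm : LeftMap D m.left)
    {x' : X' ⟶ I} {y' : Y' ⟶ I} {a : X' ⟶ X.left} {b : Y' ⟶ Y.left}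
    (sx : IsPullback a x' (proj X) h) (sy : IsPullback b y' (proj Y) h) {m' : X' ⟶ Y'}
    (w₁ : m' ≫ y' = x') (w₂ : m' ≫ b = a ≫ m.left) : LeftMap D m' := by
  have hl := (llp_iff_leftMap _).1 (H h m ((llp_iff_leftMap m).2 hm))
  have sx₀ := FibredMonad.isPullback_pr h X
  have sy₀ := FibredMonad.isPullback_pr h Y
  refine hl.of_iso (sx.isoIsPullback _ _ sx₀) (sy.isoIsPullback _ _ sy₀) ?_
  have e₁ : ((reindex D h).map m).left ≫ FibredMonad.pr h Y = FibredMonad.pr h X ≫ m.left :=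
    pullback.lift_fst _ _ _
  have e₂ : ((reindex D h).map m).left ≫ proj ((reindex D h).obj Y) =
      proj ((reindex D h).obj X) :=
    pullback.lift_snd _ _ _
  apply sy₀.hom_ext
  · rw [Category.assoc, Category.assoc, e₁, IsPullback.isoIsPullback_hom_fst, w₂,
      IsPullback.isoIsPullback_hom_fst_assoc]
  · rw [Category.assoc, Category.assoc, e₂, IsPullback.isoIsPullback_hom_snd, w₁,
      IsPullback.isoIsPullback_hom_snd]

/-- Under stable left classes, the pullback of a left map between display maps over `J` is a left
map. -/
theorem HasStableLeftClasses.leftMap [HasSigmaTypes D] (H : HasStableLeftClasses D)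
    {I J X Y X' Y' : C} (h : I ⟶ J) {x : X ⟶ J} {y : Y ⟶ J} (hx : D x) (hy : D y)
    {x' : X' ⟶ I} {y' : Y' ⟶ I} {a : X' ⟶ X} {b : Y' ⟶ Y} (sx : IsPullback a x' x h)
    (sy : IsPullback b y' y h) {m : X ⟶ Y} (hm : LeftMap D m) (w : m ≫ y = x) {m' : X' ⟶ Y'}
    (w₁ : m' ≫ y' = x') (w₂ : m' ≫ b = a ≫ m) : LeftMap D m' :=
  H.leftMap_slice h (X := MorphismProperty.Over.mk ⊤ x hx) (Y := MorphismProperty.Over.mk ⊤ y hy)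
    (m := MorphismProperty.Over.homMk m w) hm sx sy w₁ w₂

end

/-! ### `Π`-types -/

/-- The intrinsic form of a couniversal arrow from `f^*` to `g`. -/
structure IsPi {X Y Z P Q : C} (f : Y ⟶ X) (g : Z ⟶ Y) (p : P ⟶ X) (a : Q ⟶ P) (b : Q ⟶ Y)
    (ev : Q ⟶ Z) : Prop where
  sq : IsPullback a b p f
  w : ev ≫ g = b
  univ : ∀ ⦃L Q' : C⦄ (l : L ⟶ X) (a' : Q' ⟶ L) (b' : Q' ⟶ Y), IsPullback a' b' l f →
    ∀ e : Q' ⟶ Z, e ≫ g = b' →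
      ∃! k : L ⟶ P, k ≫ p = l ∧ ∀ j : Q' ⟶ Q, j ≫ a = a' ≫ k → j ≫ b = b' → j ≫ ev = e

/-- The comparison `j` exists and is unique, so quantifying over all `j` expresses the functorial
action of `f^*` without reference to chosen pullbacks. -/
theorem overPullback_map_comp_eq_iff {X Y : C} (f : Y ⟶ X) [HasPullbacksAlong f] {A P : Over X}
    {G : Over Y} (k : A ⟶ P) (φ : (Over.pullback f).obj P ⟶ G) (ψ : (Over.pullback f).obj A ⟶ G)
    (φ₀ : pullback P.hom f ⟶ G.left) (ψ₀ : pullback A.hom f ⟶ G.left) (hφ : φ.left = φ₀)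
    (hψ : ψ.left = ψ₀) :
    (Over.pullback f).map k ≫ φ = ψ ↔ ∀ j : pullback A.hom f ⟶ pullback P.hom f,
      j ≫ pullback.fst P.hom f = pullback.fst A.hom f ≫ k.left →
      j ≫ pullback.snd P.hom f = pullback.snd A.hom f → j ≫ φ₀ = ψ₀ := by
  obtain ⟨q, hq⟩ : ∃ q : pullback A.hom f ⟶ pullback P.hom f,
    q = ((Over.pullback f).map k).left := ⟨_, rfl⟩
  have e₁ : q ≫ pullback.fst P.hom f = pullback.fst A.hom f ≫ k.left := by
    rw [hq]
    exact pullback.lift_fst _ _ _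
  have e₂ : q ≫ pullback.snd P.hom f = pullback.snd A.hom f := by
    rw [hq]
    exact pullback.lift_snd _ _ _
  have e₃ : ((Over.pullback f).map k ≫ φ).left = q ≫ φ₀ := by rw [← hφ, hq]; rfl
  constructor
  · rintro rfl j h₁ h₂
    have : j = q := pullback.hom_ext (h₁.trans e₁.symm) (h₂.trans e₂.symm)
    rw [this, ← e₃, hψ]
  · intro h
    apply Over.OverMorphism.ext
    rw [e₃, hψ]
    exact h q e₁ e₂

/-- The couniversal property speaks of chosen pullbacks; conjugating with the isomorphism to the
chosen one extends it to any pullback square `sq`. -/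
theorem HasPiTypes.exists_isPi {D : MorphismProperty C} [IsDisplayMapClass D] (H : HasPiTypes D)
    {X Y Z : C} {f : Y ⟶ X} {g : Z ⟶ Y} (hf : D f) (hg : D g) :
    ∃ (P Q : C) (p : P ⟶ X) (a : Q ⟶ P) (b : Q ⟶ Y) (ev : Q ⟶ Z), D p ∧ IsPi f g p a b ev := by
  have : HasPullbacksAlong f := hasPullbacksAlong hf
  obtain ⟨P, hP, ⟨tP⟩⟩ := H f g hf hg
  obtain ⟨ev, hev⟩ : ∃ ev : pullback P.left.hom f ⟶ Z, P.hom.left = ev := ⟨_, rfl⟩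
  have hw : ev ≫ g = pullback.snd P.left.hom f := by
    rw [← hev]
    exact Over.w P.hom
  refine ⟨P.left.left, _, P.left.hom, pullback.fst _ f, pullback.snd _ f, ev, hP,
    IsPullback.of_hasPullback _ _, hw, ?_⟩
  intro L Q' l a' b' sq e he
  have i₁ : sq.isoPullback.inv ≫ a' = pullback.fst l f := sq.isoPullback_inv_fst
  have i₂ : sq.isoPullback.inv ≫ b' = pullback.snd l f := sq.isoPullback_inv_snd
  let A : CostructuredArrow (Over.pullback f) (Over.mk g) :=
    CostructuredArrow.mk (Y := Over.mk l) (Over.homMk (sq.isoPullback.inv ≫ e) (by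
      change (_ ≫ e) ≫ g = pullback.snd l f
      rw [Category.assoc, he, i₂]) : (Over.pullback f).obj (Over.mk l) ⟶ Over.mk g)
  have key (k : A.left ⟶ P.left) := overPullback_map_comp_eq_iff f k P.hom A.hom ev
    (sq.isoPullback.inv ≫ e) hev rfl
  refine ⟨(tP.from A).left.left, ⟨Over.w (tP.from A).left, ?_⟩, ?_⟩
  · intro j h₁ h₂
    have h₃ := (key _).1 (CostructuredArrow.w (tP.from A)) (sq.isoPullback.inv ≫ j)
      ((Category.assoc _ _ _).trans (by rw [h₁, reassoc_of% i₁]; rfl))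
      ((Category.assoc _ _ _).trans (by rw [h₂, i₂]; rfl))
    rw [Category.assoc] at h₃
    exact (cancel_epi sq.isoPullback.inv).1 h₃
  · rintro k ⟨h₁, h₂⟩
    let k' : A ⟶ P := CostructuredArrow.homMk (Over.homMk k h₁) ((key _).2 (fun j h₃ h₄ => by
      have h₅ := h₂ (sq.isoPullback.hom ≫ j)
        (by rw [Category.assoc, h₃]; exact sq.isoPullback_hom_fst_assoc _)
        (by rw [Category.assoc, h₄]; exact sq.isoPullback_hom_snd)
      rw [← h₅]
      simp))
    exact congrArg (fun t => t.left.left) (tP.hom_ext k' (tP.from A))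

theorem HasPiTypes.of_exists_isPi {D : MorphismProperty C} [IsDisplayMapClass D]
    (H : ∀ ⦃X Y Z : C⦄ (f : Y ⟶ X) (g : Z ⟶ Y), D f → D g →
      ∃ (P Q : C) (p : P ⟶ X) (a : Q ⟶ P) (b : Q ⟶ Y) (ev : Q ⟶ Z), D p ∧ IsPi f g p a b ev) :
    HasPiTypes D := by
  intro X Y Z f g hf hg
  have : HasPullbacksAlong f := hasPullbacksAlong hf
  obtain ⟨P, Q, p, a, b, ev, hp, h⟩ := H f g hf hg
  obtain ⟨i, i₁, i₂⟩ : ∃ i : pullback p f ⟶ Q, i ≫ a = pullback.fst p f ∧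
      i ≫ b = pullback.snd p f :=
    ⟨h.sq.lift _ _ pullback.condition, h.sq.lift_fst _ _ _, h.sq.lift_snd _ _ _⟩
  have hw : (i ≫ ev) ≫ g = pullback.snd p f := by rw [Category.assoc, h.w, i₂]
  let P₀ : CostructuredArrow (Over.pullback f) (Over.mk g) :=
    CostructuredArrow.mk (Y := Over.mk p) (Over.homMk (i ≫ ev) hw :
      (Over.pullback f).obj (Over.mk p) ⟶ Over.mk g)
  refine ⟨P₀, hp, ⟨?_⟩⟩
  have univ (A : CostructuredArrow (Over.pullback f) (Over.mk g)) : ∃! k : A ⟶ P₀, True := by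
    obtain ⟨e, he⟩ : ∃ e : pullback A.left.hom f ⟶ Z, A.hom.left = e := ⟨_, rfl⟩
    have key (k : A.left ⟶ P₀.left) := overPullback_map_comp_eq_iff f k P₀.hom A.hom (i ≫ ev)
      e rfl he
    obtain ⟨k, ⟨hk₁, hk₂⟩, hk₃⟩ := h.univ A.left.hom (pullback.fst _ f) (pullback.snd _ f)
      (IsPullback.of_hasPullback _ _) e (by rw [← he]; exact Over.w A.hom)
    refine ⟨CostructuredArrow.homMk (Over.homMk k hk₁) ((key _).2 fun j h₁ h₂ => ?_), trivial,
      fun m _ => ?_⟩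
    · rw [← Category.assoc]
      apply hk₂
      · rw [Category.assoc, i₁]
        exact h₁
      · rw [Category.assoc, i₂]
        exact h₂
    · apply CostructuredArrow.hom_ext
      apply Over.OverMorphism.ext
      refine hk₃ m.left.left ⟨Over.w m.left, fun j h₁ h₂ => ?_⟩
      have w : (pullback.fst A.left.hom f ≫ m.left.left) ≫ p = pullback.snd A.left.hom f ≫ f := by
        rw [← pullback.condition, Category.assoc]
        exact congrArg _ (Over.w m.left)
      have h₃ := (key m.left).1 (CostructuredArrow.w m) (pullback.lift _ _ w)
        (pullback.lift_fst _ _ _) (pullback.lift_snd _ _ _)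
      rw [← h₃, ← Category.assoc]
      congr 1
      apply h.sq.hom_ext
      · rw [h₁, Category.assoc, i₁]
        exact (pullback.lift_fst _ _ _).symm
      · rw [h₂, Category.assoc, i₂]
        exact (pullback.lift_snd _ _ _).symm
  exact IsTerminal.ofUniqueHom (fun A => (univ A).choose)
    (fun A m => (univ A).unique trivial trivial)

/-- In the presence of `Π`-types, left maps are stable under pullback along display maps. -/
theorem LeftMap.of_isPullback {D : MorphismProperty C} [IsDisplayMapClass D] (H : HasPiTypes D)
    {X Y V X' : C} {f : X ⟶ Y} (hf : LeftMap D f) {v : V ⟶ Y} (hv : D v) {a : X' ⟶ X}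
    {b : X' ⟶ V} (sq : IsPullback a b f v) : LeftMap D b := by
  intro E e he s hs
  -- Transpose along `v^* ⊣ Π_v`: the problem of finding a section of `e` becomes that of finding a
  -- section of the display map `p`, against which `f` lifts.
  obtain ⟨P, Q, p, q₁, q₂, ev, hp, h⟩ := H.exists_isPi hv he
  obtain ⟨k, ⟨hk₁, hk₂⟩, -⟩ := h.univ f a b sq s hs
  obtain ⟨t, ht, ht'⟩ := hf p hp k hk₁
  have w : (v ≫ t) ≫ p = 𝟙 V ≫ v := by rw [Category.assoc, ht, Category.comp_id, Category.id_comp]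
  refine ⟨h.sq.lift (v ≫ t) (𝟙 V) w ≫ ev, ?_, ?_⟩
  · rw [Category.assoc, h.w, h.sq.lift_snd]
  · rw [← Category.assoc]
    apply hk₂
    · rw [Category.assoc, h.sq.lift_fst, ← sq.w_assoc, ht']
    · rw [Category.assoc, h.sq.lift_snd, Category.comp_id]

/-! ### Identity types -/

section

variable {D : MorphismProperty C} [IsDisplayMapClass D]

theorem HasIdentityTypes.exists_factorization [HasSigmaTypes D] (H : HasIdentityTypes D)
    {I X Y : C} {x : X ⟶ I} {y : Y ⟶ I} (hx : D x) (hy : D y) (m : X ⟶ Y) (w : m ≫ y = x) :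
    ∃ (R : C) (r : X ⟶ R) (p : R ⟶ Y), LeftMap D r ∧ D p ∧ r ≫ p = m := by
  let X₀ : Slice D I := MorphismProperty.Over.mk ⊤ x hx
  let Y₀ : Slice D I := MorphismProperty.Over.mk ⊤ y hy
  let m₀ : X₀ ⟶ Y₀ := MorphismProperty.Over.homMk m w
  obtain ⟨F⟩ := (H.2 I).nonempty_mapFactorizationData m₀
  exact ⟨F.Z.left, F.i.left, F.p.left, (llp_iff_leftMap _).1 F.hi, F.hp,
    congrArg (fun t => t.left) F.fac⟩

theorem Universe.ClosedUnderIdentity.exists_factorization [HasSigmaTypes D] {U : Universe D}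
    (H : U.ClosedUnderIdentity) {I X Y : C} {x : X ⟶ I} {y : Y ⟶ I} (hx : U.small x)
    (hy : U.small y) (m : X ⟶ Y) (w : m ≫ y = x) :
    ∃ (R : C) (r : X ⟶ R) (p : R ⟶ Y), LeftMap D r ∧ U.small p ∧ r ≫ p = m := by
  let X₀ : Slice U.small I := MorphismProperty.Over.mk ⊤ x hx
  let Y₀ : Slice U.small I := MorphismProperty.Over.mk ⊤ y hy
  let m₀ : X₀ ⟶ Y₀ := MorphismProperty.Over.homMk m w
  obtain ⟨F⟩ := (H I).nonempty_mapFactorizationData m₀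
  exact ⟨F.Z.left, F.i.left, F.p.left, (llp_iff_leftMap _).1 F.hi, F.hp,
    congrArg (fun t => t.left) F.fac⟩

theorem hasFactorization_of_exists [HasSigmaTypes D]
    (H : ∀ {I X Y : C} {x : X ⟶ I} {y : Y ⟶ I}, D x → D y → ∀ m : X ⟶ Y, m ≫ y = x →
      ∃ (R : C) (r : X ⟶ R) (p : R ⟶ Y), LeftMap D r ∧ D p ∧ r ≫ p = m) (I : C) :
    (sliceDisplay D I).llp.HasFactorization (sliceDisplay D I) where
  nonempty_mapFactorizationData {X Y} m := by
    obtain ⟨R, r, p, hr, hp, e⟩ := H X.prop Y.prop m.left (left_proj m)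
    exact ⟨{
      Z := MorphismProperty.Over.mk ⊤ (p ≫ proj Y) (D.comp_mem _ _ hp Y.prop)
      i := MorphismProperty.Over.homMk r (by
        change r ≫ p ≫ proj Y = proj X
        rw [reassoc_of% e, left_proj])
      p := MorphismProperty.Over.homMk p rfl
      fac := MorphismProperty.Over.Hom.ext e
      hi := (llp_iff_leftMap _).2 hr
      hp := hp }⟩

theorem Universe.closedUnderIdentity_of_exists [HasSigmaTypes D] {U : Universe D}
    (hU : U.ClosedUnderSigma)
    (H : ∀ {I X Y : C} {x : X ⟶ I} {y : Y ⟶ I}, U.small x → U.small y → ∀ m : X ⟶ Y, m ≫ y = x →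
      ∃ (R : C) (r : X ⟶ R) (p : R ⟶ Y), LeftMap D r ∧ U.small p ∧ r ≫ p = m) :
    U.ClosedUnderIdentity := fun I =>
  { nonempty_mapFactorizationData := fun {X Y} m => by
      have : HasSigmaTypes U.small := hU
      obtain ⟨R, r, p, hr, hp, e⟩ := H X.prop Y.prop m.left (left_proj m)
      exact ⟨{
        Z := MorphismProperty.Over.mk ⊤ (p ≫ proj Y) (U.small.comp_mem _ _ hp Y.prop)
        i := MorphismProperty.Over.homMk r (by
          change r ≫ p ≫ proj Y = proj X
          rw [reassoc_of% e, left_proj])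
        p := MorphismProperty.Over.homMk p rfl
        fac := MorphismProperty.Over.Hom.ext e
        hi := (llp_iff_leftMap _).2 hr
        hp := hp }⟩ }

/-- The section `t` exhibits `m` as a retract of `n` under `X`. This diagram pulls back along `h`,
so `m'` is a retract of the pullback `n'` and inherits its lifting property. -/
theorem leftMap_of_retract {I J X Y R X' Y' : C} {h : I ⟶ J} {y : Y ⟶ J} {m : X ⟶ Y}
    {n : X ⟶ R} {d : R ⟶ Y} (hd : D d) (e : n ≫ d = m) {t : Y ⟶ R}
    (ht : t ≫ d = 𝟙 Y) (ht' : m ≫ t = n) {x' : X' ⟶ I} {y' : Y' ⟶ I} {a : X' ⟶ X} {b : Y' ⟶ Y}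
    (sy : IsPullback b y' y h) {m' : X' ⟶ Y'} (m₁ : m' ≫ b = a ≫ m)
    (m₂ : m' ≫ y' = x')
    (H : ∀ {R' : C} {z' : R' ⟶ I} {c : R' ⟶ R}, IsPullback c z' (d ≫ y) h →
      ∀ n' : X' ⟶ R', n' ≫ z' = x' → n' ≫ c = a ≫ n → LeftMap D n') : LeftMap D m' := by
  obtain ⟨R', c, d', sd, hd'⟩ := exists_isPullback_right hd b
  have sR := sd.paste_vert sy
  obtain ⟨n', hn₁, hn₂⟩ : ∃ n' : X' ⟶ R', n' ≫ c = a ≫ n ∧ n' ≫ d' = m' :=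
    ⟨sd.lift _ _ (by rw [Category.assoc, e, m₁]), sd.lift_fst _ _ _, sd.lift_snd _ _ _⟩
  obtain ⟨t', ht₁, ht₂⟩ : ∃ t' : Y' ⟶ R', t' ≫ c = b ≫ t ∧ t' ≫ d' = 𝟙 Y' :=
    ⟨sd.lift (b ≫ t) (𝟙 Y') (by rw [Category.assoc, ht, Category.comp_id, Category.id_comp]),
      sd.lift_fst _ _ _, sd.lift_snd _ _ _⟩
  have ht₃ : m' ≫ t' = n' := by
    apply sd.hom_ext
    · rw [Category.assoc, ht₁, reassoc_of% m₁, ht', hn₁]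
    · rw [Category.assoc, ht₂, Category.comp_id, hn₂]
  have hl : LeftMap D n' := H sR n' (by rw [reassoc_of% hn₂, m₂]) hn₁
  intro E ε he s hs
  obtain ⟨u, hu₁, hu₂⟩ := hl.exists_lift he s d' (by rw [hs, hn₂])
  exact ⟨t' ≫ u, by rw [Category.assoc, hu₁, ht₂], by rw [reassoc_of% ht₃, hu₂]⟩

/-- If every map factors as a left map followed by a display map, in such a way that the pullbacks
of the left map are left maps, then the left classes are stable. -/
theorem hasStableLeftClasses_of_exists [HasSigmaTypes D]
    (H : ∀ {J X Y : C} {x : X ⟶ J} {y : Y ⟶ J}, D x → D y → ∀ m : X ⟶ Y, m ≫ y = x →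
      ∃ (R : C) (n : X ⟶ R) (d : R ⟶ Y), D d ∧ n ≫ d = m ∧
        ∀ {I X' R' : C} (h : I ⟶ J) {x' : X' ⟶ I} {z' : R' ⟶ I} {a : X' ⟶ X} {b : R' ⟶ R},
          IsPullback a x' x h → IsPullback b z' (d ≫ y) h → ∀ n' : X' ⟶ R', n' ≫ z' = x' →
            n' ≫ b = a ≫ n → LeftMap D n') :
    HasStableLeftClasses D := by
  intro I J h X Y m hm
  rw [llp_iff_leftMap] at hm ⊢
  obtain ⟨R, n, d, hd, e, hn⟩ := H X.prop Y.prop m.left (left_proj m)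
  -- A left map lifts against the second factor of its own factorization, and so is a retract of the
  -- first.
  obtain ⟨t, ht, ht'⟩ := hm d hd n e
  have sx := FibredMonad.isPullback_pr h X
  have sy := FibredMonad.isPullback_pr h Y
  have m₁ : ((reindex D h).map m).left ≫ FibredMonad.pr h Y = FibredMonad.pr h X ≫ m.left :=
    pullback.lift_fst _ _ _
  have m₂ : ((reindex D h).map m).left ≫ proj ((reindex D h).obj Y) =
      proj ((reindex D h).obj X) := pullback.lift_snd _ _ _
  exact leftMap_of_retract hd e ht ht' sy m₁ m₂ (fun s n' => hn h sx s n')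

end

end General

namespace Dill

variable {B : Type u} [Category.{v} B] {D : MorphismProperty B} {M : FibredMonad D}

/-! ### Generalised elements of maps of `Dill` -/

/-- The total object of the family of `X`. -/
abbrev el (X : Dill M) : B := X.fam.left

/-- The display map of `X`. -/
abbrev pj (X : Dill M) : X.el ⟶ X.base := proj X.fam

/-- The total object of `M X`. -/
abbrev mel (X : Dill M) : B := (M.obj X.fam).left

/-- The display map of `M X`. -/
abbrev mpj (X : Dill M) : X.mel ⟶ X.base := proj (M.obj X.fam)

/-- The unit of `M` at `X`. -/
abbrev eta (X : Dill M) : X.el ⟶ X.mel := (M.unit X.fam).left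

theorem isPullback_id (X : Dill M) : IsPullback (𝟙 X.el) X.pj X.pj (𝟙 X.base) :=
  IsPullback.of_horiz_isIso ⟨by simp⟩

theorem eta_mpj (X : Dill M) : X.eta ≫ X.mpj = X.pj := left_proj _

variable [IsDisplayMapClass D]

/-- The map of `B` underneath a map of `Dill`. -/
def bs {X Y : Dill M} (f : X ⟶ Y) : X.base ⟶ Y.base := Hom.base f

@[simp]
theorem bs_id (X : Dill M) : bs (𝟙 X) = 𝟙 X.base := rfl

@[simp]
theorem bs_comp {X Y Z : Dill M} (f : X ⟶ Y) (g : Y ⟶ Z) : bs (f ≫ g) = bs f ≫ bs g := rfl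

/-- The map `h^* Y ⟶ M X` representing `f : X ⟶ Y`. -/
noncomputable def repr {X Y : Dill M} (f : X ⟶ Y) :
    (reindex D (bs f)).obj Y.fam ⟶ M.obj X.fam :=
  M.rep (Hom.vert f)

/-- The action of a map `f : X ⟶ Y` of `Dill` over `h` on generalised elements of `Y`. -/
noncomputable def elt {X Y : Dill M} (f : X ⟶ Y) {h : X.base ⟶ Y.base} (hf : bs f = h) {W : B}
    (a : W ⟶ X.base) (y : W ⟶ Y.el) (w : a ≫ h = y ≫ Y.pj) : W ⟶ X.mel :=
  (FibredMonad.isPullback_pr (bs f) Y.fam).lift y a (by rw [hf, w]) ≫ (repr f).left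

/-- The action of a map `f : X ⟶ Y` of `Dill` over `h` on generalised elements of `M Y`. -/
noncomputable def act {X Y : Dill M} (f : X ⟶ Y) {h : X.base ⟶ Y.base} (hf : bs f = h) {W : B}
    (a : W ⟶ X.base) (m : W ⟶ Y.mel) (w : a ≫ h = m ≫ Y.mpj) : W ⟶ X.mel :=
  (M.isPullback_map_pr (bs f) Y.fam).lift m a (by rw [hf, w]) ≫
    M.map (𝟙 _) (repr f).left (left_proj_id _) ≫ (M.mul X.fam).left

section

variable {X Y Z : Dill M} (f : X ⟶ Y) {h : X.base ⟶ Y.base} (hf : bs f = h) {V W : B}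

theorem elt_mpj (a : W ⟶ X.base) (y : W ⟶ Y.el) (w : a ≫ h = y ≫ Y.pj) :
    elt f hf a y w ≫ X.mpj = a := by
  rw [elt, Category.assoc, left_proj, IsPullback.lift_snd]

theorem act_mpj (a : W ⟶ X.base) (m : W ⟶ Y.mel) (w : a ≫ h = m ≫ Y.mpj) :
    act f hf a m w ≫ X.mpj = a := by
  rw [act, Category.assoc, Category.assoc, left_proj, M.map_proj, Category.comp_id,
    IsPullback.lift_snd]

theorem comp_elt (v : V ⟶ W) (a : W ⟶ X.base) (y : W ⟶ Y.el) (w : a ≫ h = y ≫ Y.pj) :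
    v ≫ elt f hf a y w = elt f hf (v ≫ a) (v ≫ y) (by rw [Category.assoc, w, Category.assoc]) := by
  rw [elt, elt, ← Category.assoc]
  congr 1
  apply (FibredMonad.isPullback_pr (bs f) Y.fam).hom_ext
  · rw [Category.assoc, IsPullback.lift_fst, IsPullback.lift_fst]
  · rw [Category.assoc, IsPullback.lift_snd, IsPullback.lift_snd]

theorem elt_congr {f g : X ⟶ Y} (e : f = g) {h h' : X.base ⟶ Y.base} (hf : bs f = h)
    (hg : bs g = h') {a a' : W ⟶ X.base} (ea : a = a') {y y' : W ⟶ Y.el} (ey : y = y')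
    (w : a ≫ h = y ≫ Y.pj) (w' : a' ≫ h' = y' ≫ Y.pj) :
    elt f hf a y w = elt g hg a' y' w' := by
  subst e ea ey hf hg
  rfl

theorem act_congr {f g : X ⟶ Y} (e : f = g) {h h' : X.base ⟶ Y.base} (hf : bs f = h)
    (hg : bs g = h') {a a' : W ⟶ X.base} (ea : a = a') {y y' : W ⟶ Y.mel} (ey : y = y')
    (w : a ≫ h = y ≫ Y.mpj) (w' : a' ≫ h' = y' ≫ Y.mpj) :
    act f hf a y w = act g hg a' y' w' := by
  subst e ea ey hf hg
  rfl

/-- On pure elements the Kleisli extension is the original map: naturality of the unit and the left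
unit law. -/
theorem act_eta (a : W ⟶ X.base) (y : W ⟶ Y.el) (w : a ≫ h = y ≫ Y.pj) (w' : a ≫ h = _) :
    act f hf a (y ≫ Y.eta) w' = elt f hf a y w := by
  subst hf
  have e : (M.isPullback_map_pr (bs f) Y.fam).lift (y ≫ Y.eta) a w'.symm =
      (FibredMonad.isPullback_pr (bs f) Y.fam).lift y a w.symm ≫ (M.unit _).left := by
    apply M.transpose_hom_ext (bs f)
    · rw [IsPullback.lift_fst, Category.assoc, ← M.unit_naturality, IsPullback.lift_fst_assoc]
    · rw [IsPullback.lift_snd, Category.assoc, left_proj, IsPullback.lift_snd]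
  have e' : (M.unit (M.obj X.fam)).left ≫ (M.mul X.fam).left = 𝟙 _ :=
    congrArg (fun t => t.left) (M.left_unit X.fam)
  have e'' := M.unit_naturality (𝟙 _) _ (left_proj_id (repr f))
  rw [act, e, elt, Category.assoc, ← reassoc_of% e'', e', Category.comp_id]

/-- This is Kleisli composition: `g` sends `z` to an element of `M Y`, to which the Kleisli
extension of `f` applies. It reduces later equations in `Dill` to equations between generalised
elements. -/
theorem elt_comp (g : Y ⟶ Z) {k : Y.base ⟶ Z.base} (hg : bs g = k) {l : X.base ⟶ Z.base}
    (hl : bs (f ≫ g) = l) (a : W ⟶ X.base) (z : W ⟶ Z.el) (w : a ≫ l = z ≫ Z.pj)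
    (w' : (a ≫ h) ≫ k = z ≫ Z.pj) :
    elt (f ≫ g) hl a z w = act f hf a (elt g hg (a ≫ h) z w') (elt_mpj _ _ _ _ _).symm := by
  subst hf hg
  have w₀ : z ≫ proj Z.fam = a ≫ bs f ≫ bs g := by rw [← Category.assoc, w']
  have e : (FibredMonad.isPullback_pr (bs f ≫ bs g) Z.fam).lift z a w₀ ≫
        (M.rep (M.reindexVert (bs f) (bs g) (Hom.vert g))).left =
      (M.isPullback_map_pr (bs f) Y.fam).lift
        (elt g rfl (a ≫ bs f) z w') a (elt_mpj _ _ _ _ _) := by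
    apply M.transpose_hom_ext (bs f)
    · rw [IsPullback.lift_fst, Category.assoc]
      refine (congrArg (fun t => _ ≫ t) (M.rep_reindexVert (bs f) (bs g) (Hom.vert g))).trans ?_
      rw [← Category.assoc]
      refine congrArg (fun t => t ≫ (M.rep (Hom.vert g)).left) ?_
      apply (FibredMonad.isPullback_pr (bs g) Z.fam).hom_ext
      · rw [IsPullback.lift_fst, Category.assoc, FibredMonad.prComp_pr, IsPullback.lift_fst]
      · rw [IsPullback.lift_snd, Category.assoc, FibredMonad.prComp_proj,
          IsPullback.lift_snd_assoc]
    · rw [IsPullback.lift_snd, Category.assoc, left_proj, IsPullback.lift_snd]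
  rw [act, ← e, Category.assoc]
  rfl

theorem elt_id {h : X.base ⟶ X.base} (hf : bs (𝟙 X) = h) (a : W ⟶ X.base) (y : W ⟶ X.el)
    (w : a ≫ h = y ≫ X.pj) : elt (𝟙 X) hf a y w = y ≫ X.eta := by
  subst hf
  have := (FibredMonad.isPullback_pr (𝟙 X.base) X.fam).lift_fst y a w.symm
  change (FibredMonad.isPullback_pr (𝟙 X.base) X.fam).lift y a w.symm ≫
    FibredMonad.pr (𝟙 X.base) X.fam ≫ X.eta = y ≫ X.eta
  rw [reassoc_of% this]

theorem hom_ext {f g : X ⟶ Y} {h : X.base ⟶ Y.base} (hf : bs f = h) (hg : bs g = h)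
    (H : ∀ (W : B) (a : W ⟶ X.base) (y : W ⟶ Y.el) (w : a ≫ h = y ≫ Y.pj),
      elt f hf a y w = elt g hg a y w) : f = g := by
  subst hf
  refine Hom.ext' hg.symm fun W (a : W ⟶ ((reindex D (bs f)).obj Y.fam).left)
    (b : W ⟶ ((reindex D (bs g)).obj Y.fam).left)
    (h₁ : a ≫ FibredMonad.pr (bs f) Y.fam = b ≫ FibredMonad.pr (bs g) Y.fam)
    (h₂ : a ≫ proj ((reindex D (bs f)).obj Y.fam) = b ≫ proj ((reindex D (bs g)).obj Y.fam)) => ?_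
  have wa := (FibredMonad.isPullback_pr (bs f) Y.fam).w
  have wb := (FibredMonad.isPullback_pr (bs g) Y.fam).w
  have ha : a = (FibredMonad.isPullback_pr (bs f) Y.fam).lift (a ≫ FibredMonad.pr (bs f) Y.fam)
      (a ≫ proj ((reindex D (bs f)).obj Y.fam)) (by rw [Category.assoc, wa, Category.assoc]) := by
    apply (FibredMonad.isPullback_pr (bs f) Y.fam).hom_ext
    · rw [IsPullback.lift_fst]
    · rw [IsPullback.lift_snd]
  have hb : b = (FibredMonad.isPullback_pr (bs g) Y.fam).lift (b ≫ FibredMonad.pr (bs g) Y.fam)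
      (b ≫ proj ((reindex D (bs g)).obj Y.fam)) (by rw [Category.assoc, wb, Category.assoc]) := by
    apply (FibredMonad.isPullback_pr (bs g) Y.fam).hom_ext
    · rw [IsPullback.lift_fst]
    · rw [IsPullback.lift_snd]
  have key := H W (a ≫ proj ((reindex D (bs f)).obj Y.fam)) (a ≫ FibredMonad.pr (bs f) Y.fam)
    (by rw [Category.assoc, Category.assoc, wa])
  rw [elt_congr (f := g) rfl hg rfl h₂ h₁ _ (by rw [Category.assoc, Category.assoc, wb])] at key
  rw [elt, elt] at key
  exact (congrArg (fun t => t ≫ (repr f).left) ha).trans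
    (key.trans (congrArg (fun t => t ≫ (repr g).left) hb).symm)

/-- Two maps of `Dill` agree if they agree on a universal element. -/
theorem hom_ext_univ {f g : X ⟶ Y} {h : X.base ⟶ Y.base} (hf : bs f = h) (hg : bs g = h) {W : B}
    {p : W ⟶ Y.el} {q : W ⟶ X.base} (sq : IsPullback p q Y.pj h)
    (H : elt f hf q p sq.w.symm = elt g hg q p sq.w.symm) : f = g := by
  refine hom_ext hf hg fun V a y w => ?_
  have := congrArg (fun t => sq.lift y a w.symm ≫ t) H
  simpa only [comp_elt, sq.lift_fst, sq.lift_snd] using this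

end

/-- The map of `Dill` over `h` given by a map `φ : V ⟶ M X`, where `V` is a pullback of `Y`
along `h`. -/
noncomputable def mkHom {X Y : Dill M} (h : X.base ⟶ Y.base) {V : Slice D X.base}
    {p : V.left ⟶ Y.el} (sq : IsPullback p (proj V) Y.pj h) (φ : V ⟶ M.obj X.fam) : X ⟶ Y where
  base := h
  vert := M.dillMk (MorphismProperty.Over.homMk
    (sq.lift (FibredMonad.pr h Y.fam) (proj _) (FibredMonad.isPullback_pr h Y.fam).w ≫ φ.left)
    ((Category.assoc _ _ _).trans
      ((congrArg (fun t => _ ≫ t) (left_proj φ)).trans (sq.lift_snd _ _ _))))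

section

variable {X Y : Dill M} (h : X.base ⟶ Y.base) {V : Slice D X.base}
    {p : V.left ⟶ Y.el} (sq : IsPullback p (proj V) Y.pj h) (φ : V ⟶ M.obj X.fam) {W : B}

@[simp]
theorem bs_mkHom : bs (mkHom h sq φ) = h := rfl

theorem elt_mkHom {h' : X.base ⟶ Y.base} (hf : bs (mkHom h sq φ) = h')
    (a : W ⟶ X.base) (y : W ⟶ Y.el) (w : a ≫ h' = y ≫ Y.pj) (w' : y ≫ Y.pj = a ≫ h) :
    elt (mkHom h sq φ) hf a y w = sq.lift y a w' ≫ φ.left := by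
  change (FibredMonad.isPullback_pr h Y.fam).lift y a w' ≫
    sq.lift (FibredMonad.pr h Y.fam) (proj _) (FibredMonad.isPullback_pr h Y.fam).w ≫ φ.left = _
  rw [← Category.assoc]
  congr 1
  apply sq.hom_ext
  · rw [Category.assoc, sq.lift_fst, sq.lift_fst, IsPullback.lift_fst]
  · rw [Category.assoc, sq.lift_snd, sq.lift_snd, IsPullback.lift_snd]

theorem elt_mkHom_univ (hf : bs (mkHom h sq φ) = h) :
    elt (mkHom h sq φ) hf (proj V) p sq.w.symm = φ.left := by
  have e : sq.lift p (proj V) sq.w = 𝟙 _ := sq.hom_ext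
    ((sq.lift_fst _ _ _).trans (Category.id_comp _).symm)
    ((sq.lift_snd _ _ _).trans (Category.id_comp _).symm)
  rw [elt_mkHom _ _ _ _ _ _ _ sq.w, e, Category.id_comp]

/-- The action is defined through the chosen reindexing; any pullback `V` of `Y` computes it,
because `M` preserves the pullback square. -/
theorem act_mkHom {h' : X.base ⟶ Y.base} (hf : bs (mkHom h sq φ) = h')
    (a : W ⟶ X.base) (m : W ⟶ Y.mel) (w : a ≫ h' = m ≫ Y.mpj) (w' : m ≫ Y.mpj = a ≫ h) :
    act (mkHom h sq φ) hf a m w = (M.map_isPullback h p sq.w sq).lift m a w' ≫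
      M.map (𝟙 _) φ.left (left_proj_id _) ≫ (M.mul X.fam).left := by
  obtain ⟨c, hc⟩ : ∃ c, c = sq.lift (FibredMonad.pr h Y.fam) (proj _)
    (FibredMonad.isPullback_pr h Y.fam).w := ⟨_, rfl⟩
  have hc₁ : c ≫ p = FibredMonad.pr h Y.fam := by rw [hc, sq.lift_fst]
  have hc₂ : c ≫ proj V = proj ((reindex D h).obj Y.fam) ≫ 𝟙 _ := by
    rw [hc, sq.lift_snd, Category.comp_id]
  have hcφ : (c ≫ φ.left) ≫ X.mpj = proj ((reindex D h).obj Y.fam) ≫ 𝟙 _ := by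
    rw [Category.assoc, left_proj, hc₂]
  have e : act (mkHom h sq φ) hf a m w = (M.isPullback_map_pr h Y.fam).lift m a w' ≫
      M.map (𝟙 _) (c ≫ φ.left) hcφ ≫ (M.mul X.fam).left := by
    subst hc
    rfl
  rw [e, M.map_congr (Category.comp_id (𝟙 X.base)).symm rfl hcφ,
    M.map_comp (𝟙 X.base) (𝟙 X.base) c hc₂ φ.left (left_proj_id _), Category.assoc,
    ← Category.assoc]
  congr 1
  apply (M.map_isPullback h p sq.w sq).hom_ext
  · rw [Category.assoc, ← M.map_comp, M.map_congr (Category.id_comp h) hc₁, IsPullback.lift_fst,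
      IsPullback.lift_fst]
  · rw [Category.assoc, M.map_proj, Category.comp_id, IsPullback.lift_snd, IsPullback.lift_snd]

end

/-! ### Cartesian maps -/

/-- The map of `Dill` given by a pullback square of `B`. -/
noncomputable def cartSq {X Y : Dill M} (h : X.base ⟶ Y.base) (k : X.el ⟶ Y.el)
    (sq : IsPullback k X.pj Y.pj h) : X ⟶ Y :=
  mkHom h sq (M.unit X.fam)

section

variable {X Y : Dill M} (h : X.base ⟶ Y.base) (k : X.el ⟶ Y.el) (sq : IsPullback k X.pj Y.pj h)
  {W : B}

@[simp]
theorem bs_cartSq : bs (cartSq h k sq) = h := rfl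

theorem elt_cartSq {h' : X.base ⟶ Y.base} (hf : bs (cartSq h k sq) = h')
    (a : W ⟶ X.base) (y : W ⟶ Y.el) (w : a ≫ h' = y ≫ Y.pj) (w' : y ≫ Y.pj = a ≫ h) :
    elt (cartSq h k sq) hf a y w = sq.lift y a w' ≫ X.eta :=
  elt_mkHom _ _ _ _ _ _ _ _

/-- The action of a cartesian map is a section of the projection `M X ⟶ M Y`; together with its base
component this determines it, since `M` preserves the square. -/
theorem act_cartSq {h' : X.base ⟶ Y.base} (hf : bs (cartSq h k sq) = h')
    (a : W ⟶ X.base) (m : W ⟶ Y.mel) (w : a ≫ h' = m ≫ Y.mpj) :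
    act (cartSq h k sq) hf a m w ≫ M.map h k sq.w = m := by
  have w' : m ≫ Y.mpj = a ≫ h := by rw [← w, ← hf, bs_cartSq]
  have e : act (cartSq h k sq) hf a m w = _ := act_mkHom h sq (M.unit X.fam) hf a m w w'
  rw [e, M.right_unit, Category.comp_id, IsPullback.lift_fst]

end

/-- Cartesian maps of `Dill`. -/
def IsCart {X Y : Dill M} (f : X ⟶ Y) : Prop :=
  ∀ ⦃Z : Dill M⦄ (g : Z ⟶ Y) (k : Z.base ⟶ X.base), k ≫ bs f = bs g →
    ∃! l : Z ⟶ X, bs l = k ∧ l ≫ f = g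

/-- Composition with a cartesian map on elements. -/
theorem elt_comp_cartSq {X Y Z : Dill M} (h : X.base ⟶ Y.base) (k : X.el ⟶ Y.el)
    (sq : IsPullback k X.pj Y.pj h) (f : Z ⟶ X) {l : Z.base ⟶ X.base} (hf : bs f = l)
    {l' : Z.base ⟶ Y.base} (hl' : bs (f ≫ cartSq h k sq) = l') {W : B} (a : W ⟶ Z.base)
    (x : W ⟶ X.el) (y : W ⟶ Y.el) (hy : x ≫ k = y) (w : a ≫ l = x ≫ X.pj)
    (w' : a ≫ l' = y ≫ Y.pj) :
    elt (f ≫ cartSq h k sq) hl' a y w' = elt f hf a x w := by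
  subst hy
  have w₁ : (x ≫ k) ≫ Y.pj = (a ≫ l) ≫ h := by rw [w, Category.assoc, Category.assoc, sq.w]
  have e : sq.lift (x ≫ k) (a ≫ l) w₁ = x := by
    apply sq.hom_ext
    · rw [sq.lift_fst]
    · rw [sq.lift_snd, w]
  rw [elt_comp f hf _ (bs_cartSq h k sq) hl' _ _ _ w₁.symm]
  have w₂ : a ≫ l = (x ≫ X.eta) ≫ X.mpj := by rw [Category.assoc, eta_mpj, w]
  refine (act_congr rfl hf hf rfl ?_ _ w₂).trans (act_eta f hf a x w w₂)
  rw [elt_cartSq _ _ _ _ _ _ _ w₁, e]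

/-- By pasting, the pullback of `X` along `l` is also the pullback of `Y` along `l ≫ h`, and
composing with the cartesian map leaves the representing map unchanged. So maps to `X` over `l` and
maps to `Y` over `l ≫ h` have the same representatives. -/
theorem isCart_cartSq {X Y : Dill M} (h : X.base ⟶ Y.base) (k : X.el ⟶ Y.el)
    (sq : IsPullback k X.pj Y.pj h) : IsCart (cartSq h k sq) := by
  intro Z g l hl
  rw [bs_cartSq] at hl
  have sl := FibredMonad.isPullback_pr l X.fam
  have sl' := sl.paste_horiz sq
  have w₀ : proj ((reindex D l).obj X.fam) ≫ l ≫ h = (FibredMonad.pr l X.fam ≫ k) ≫ Y.pj := by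
    rw [sl'.w]
  have w₁ : elt g hl.symm (proj _) (FibredMonad.pr l X.fam ≫ k) w₀ ≫ Z.mpj =
    proj ((reindex D l).obj X.fam) := elt_mpj _ _ _ _ _
  let φ : (reindex D l).obj X.fam ⟶ M.obj Z.fam := MorphismProperty.Over.homMk _ w₁
  have hφ : φ.left = elt g hl.symm (proj _) (FibredMonad.pr l X.fam ≫ k) w₀ := rfl
  have key (f : Z ⟶ X) (hf : bs f = l) : f ≫ cartSq h k sq = g ↔
      elt f hf (proj ((reindex D l).obj X.fam)) (FibredMonad.pr l X.fam) sl.w.symm = φ.left := by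
    have hf' : bs (f ≫ cartSq h k sq) = l ≫ h := by rw [bs_comp, hf, bs_cartSq]
    rw [hφ, ← elt_comp_cartSq h k sq f hf hf' _ _ _ rfl _ w₀]
    constructor
    · intro e
      exact elt_congr e _ _ rfl rfl _ _
    · intro e
      exact hom_ext_univ hf' hl.symm sl' e
  refine ⟨mkHom l sl φ, ⟨rfl, (key _ (bs_mkHom l sl φ)).2 (elt_mkHom_univ _ _ _ _)⟩, ?_⟩
  rintro f ⟨hf, hf'⟩
  refine hom_ext_univ hf (bs_mkHom l sl φ) sl ?_
  rw [(key f hf).1 hf', elt_mkHom_univ]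

/-- The chosen cartesian lift of `h`. -/
noncomputable def cart (Y : Dill M) {J : B} (h : J ⟶ Y.base) :
    (⟨J, (reindex D h).obj Y.fam⟩ : Dill M) ⟶ Y :=
  cartSq h (FibredMonad.pr h Y.fam) (FibredMonad.isPullback_pr h Y.fam)

@[simp]
theorem bs_cart (Y : Dill M) {J : B} (h : J ⟶ Y.base) : bs (cart Y h) = h := rfl

theorem isCart_cart (Y : Dill M) {J : B} (h : J ⟶ Y.base) : IsCart (cart Y h) :=
  isCart_cartSq _ _ _

theorem IsCart.hom_ext {X Y : Dill M} {f : X ⟶ Y} (hf : IsCart f) {Z : Dill M} {g h : Z ⟶ X}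
    (e : bs g = bs h) (e' : g ≫ f = h ≫ f) : g = h :=
  (hf (g ≫ f) (bs g) rfl).unique ⟨rfl, rfl⟩ ⟨e.symm, e'.symm⟩

theorem IsCart.exists_lift {X Y : Dill M} {f : X ⟶ Y} (hf : IsCart f) {Z : Dill M} (g : Z ⟶ Y)
    (k : Z.base ⟶ X.base) (w : k ≫ bs f = bs g) : ∃ l : Z ⟶ X, bs l = k ∧ l ≫ f = g :=
  (hf g k w).exists

theorem IsCart.comp {X Y Z : Dill M} {f : X ⟶ Y} {g : Y ⟶ Z} (hf : IsCart f) (hg : IsCart g) :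
    IsCart (f ≫ g) := by
  intro W h k hk
  rw [bs_comp, ← Category.assoc] at hk
  obtain ⟨l, hl, rfl⟩ := hg.exists_lift h _ hk
  obtain ⟨l', hl', rfl⟩ := hf.exists_lift l k hl.symm
  refine ⟨l', ⟨hl', Category.assoc _ _ _ |>.symm⟩, ?_⟩
  rintro m ⟨hm, hm'⟩
  refine hf.hom_ext (hm.trans hl'.symm) (hg.hom_ext ?_ ?_)
  · rw [bs_comp, bs_comp, hm, hl']
  · rw [Category.assoc, hm', Category.assoc]

theorem IsCart.of_comp {X Y Z : Dill M} {f : X ⟶ Y} {g : Y ⟶ Z} (hg : IsCart g)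
    (h : IsCart (f ≫ g)) : IsCart f := by
  intro W m k hk
  obtain ⟨l, hl, hl'⟩ := h.exists_lift (m ≫ g) k (by rw [bs_comp, bs_comp, ← hk, Category.assoc])
  refine ⟨l, ⟨hl, hg.hom_ext (by rw [bs_comp, hl, hk]) (by rw [Category.assoc, hl'])⟩, ?_⟩
  rintro m' ⟨h₁, h₂⟩
  exact h.hom_ext (h₁.trans hl.symm) (by rw [← Category.assoc, h₂, hl'])

/-- Two cartesian maps over the same map are isomorphic. -/
theorem IsCart.exists_iso {X X' Y : Dill M} {f : X ⟶ Y} {f' : X' ⟶ Y} (hf : IsCart f)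
    (hf' : IsCart f') (k : X.base ≅ X'.base) (w : k.hom ≫ bs f' = bs f) :
    ∃ i : X ≅ X', bs i.hom = k.hom ∧ i.hom ≫ f' = f := by
  obtain ⟨i, hi, hi'⟩ := hf'.exists_lift f k.hom w
  obtain ⟨j, hj, hj'⟩ := hf.exists_lift f' k.inv (by rw [← w, Iso.inv_hom_id_assoc])
  refine ⟨⟨i, j, hf.hom_ext ?_ ?_, hf'.hom_ext ?_ ?_⟩, hi, hi'⟩
  · rw [bs_comp, hi, hj, Iso.hom_inv_id, bs_id]
  · rw [Category.assoc, hj', hi', Category.id_comp]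
  · rw [bs_comp, hi, hj, Iso.inv_hom_id, bs_id]
  · rw [Category.assoc, hi', hj', Category.id_comp]

end Dill

namespace Dill

variable {B : Type u} [Category.{v} B] {D : MorphismProperty B} {M : FibredMonad D}
variable [IsDisplayMapClass D]

/-! ### Vertical maps -/

/-- The map of `Dill` over an identity given by a map `Y ⟶ M X` of a slice. -/
noncomputable def vh {I : B} {X Y : Slice D I} (φ : Y ⟶ M.obj X) :
    (⟨I, X⟩ : Dill M) ⟶ ⟨I, Y⟩ :=
  mkHom (X := ⟨I, X⟩) (Y := ⟨I, Y⟩) (𝟙 I) (isPullback_id (M := M) ⟨I, Y⟩) φ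

section

variable {I : B} {X Y : Slice D I} (φ : Y ⟶ M.obj X) {W : B}

@[simp]
theorem bs_vh : bs (vh φ) = 𝟙 I := rfl

theorem elt_vh {h : I ⟶ I} (hf : bs (vh φ) = h) (a : W ⟶ I) (y : W ⟶ Y.left)
    (w : a ≫ h = y ≫ proj Y) : elt (vh φ) hf a y w = y ≫ φ.left := by
  have w' : y ≫ proj Y = a ≫ 𝟙 I := by rw [← w, ← hf, bs_vh]
  have e : elt (vh φ) hf a y w = _ :=
    elt_mkHom (X := ⟨I, X⟩) (Y := ⟨I, Y⟩) (𝟙 I) (isPullback_id (M := M) ⟨I, Y⟩) φ hf a y w w'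
  have e' := (isPullback_id (M := M) ⟨I, Y⟩).lift_fst y a w'
  rw [Category.comp_id] at e'
  rw [e, e']

theorem act_vh {h : I ⟶ I} (hf : bs (vh φ) = h) (a : W ⟶ I) (m : W ⟶ (M.obj Y).left)
    (w : a ≫ h = m ≫ proj (M.obj Y)) :
    act (vh φ) hf a m w = m ≫ M.map (𝟙 _) φ.left (left_proj_id _) ≫ (M.mul X).left := by
  have w' : m ≫ proj (M.obj Y) = a ≫ 𝟙 I := by rw [← w, ← hf, bs_vh]
  have sq := isPullback_id (M := M) ⟨I, Y⟩
  have e : act (vh φ) hf a m w = _ :=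
    act_mkHom (X := ⟨I, X⟩) (Y := ⟨I, Y⟩) (𝟙 I) sq φ hf a m w w'
  have e' := (M.map_isPullback (𝟙 I) (𝟙 Y.left) sq.w sq).lift_fst m a w'
  have e'' : (M.map_isPullback (𝟙 I) (𝟙 Y.left) sq.w sq).lift m a w' = m :=
    (Category.comp_id _).symm.trans ((congrArg (fun t => _ ≫ t) (M.map_id Y).symm).trans e')
  rw [e, e'']

theorem vh_injective {φ ψ : Y ⟶ M.obj X} (e : vh φ = vh ψ) : φ = ψ := by
  have w : proj Y ≫ 𝟙 I = 𝟙 Y.left ≫ proj Y := by simp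
  have := elt_congr e (bs_vh φ) (bs_vh ψ) rfl rfl w w
  rw [elt_vh, elt_vh, Category.id_comp, Category.id_comp] at this
  exact MorphismProperty.Over.Hom.ext this

theorem exists_eq_vh (f : (⟨I, X⟩ : Dill M) ⟶ ⟨I, Y⟩) (hf : bs f = 𝟙 I) :
    ∃ φ : Y ⟶ M.obj X, f = vh φ := by
  have w : proj Y ≫ 𝟙 I = 𝟙 Y.left ≫ proj Y := by simp
  let φ : Y ⟶ M.obj X :=
    MorphismProperty.Over.homMk (elt f hf (proj Y) (𝟙 Y.left) w) (elt_mpj _ _ _ _ _)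
  have e : elt (vh φ) (bs_vh φ) (proj Y) (𝟙 Y.left) w = elt f hf (proj Y) (𝟙 Y.left) w :=
    (elt_vh φ _ _ _ _).trans (Category.id_comp _)
  exact ⟨φ, hom_ext_univ hf (bs_vh φ) (isPullback_id (M := M) ⟨I, Y⟩) e.symm⟩

theorem vh_rep_comp {Z : Slice D I} (α : M.dillObj X ⟶ M.dillObj Y)
    (β : M.dillObj Y ⟶ M.dillObj Z) : vh (M.rep (α ≫ β)) = vh (M.rep α) ≫ vh (M.rep β) := by
  refine hom_ext (bs_vh _) (by simp : _ = 𝟙 I) fun W a z w => ?_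
  rw [elt_vh, elt_comp _ (bs_vh _) _ (bs_vh _) _ _ _ _ (by rw [Category.assoc]; simpa using w),
    act_vh, elt_vh, M.rep_comp_left, Category.assoc]

end

theorem vh_unit {I : B} (X : Slice D I) : vh (M.unit X) = 𝟙 (⟨I, X⟩ : Dill M) := by
  refine hom_ext (bs_vh _) (bs_id _) fun W a z w => ?_
  rw [elt_vh]
  exact (elt_id (X := ⟨I, X⟩) _ a z w).symm

theorem elt_vh_comp {I : B} {X Y : Slice D I} (φ : Y ⟶ M.obj X) {Z : Dill M}
    (u : (⟨I, Y⟩ : Dill M) ⟶ Z) {h : I ⟶ Z.base} (hu : bs u = h) {h' : I ⟶ Z.base}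
    (hu' : bs (vh φ ≫ u) = h') {W : B} (a : W ⟶ I) (z : W ⟶ Z.el) (w : a ≫ h' = z ≫ Z.pj)
    (w' : a ≫ h = z ≫ Z.pj) :
    elt (vh φ ≫ u) hu' a z w =
      elt u hu a z w' ≫ M.map (𝟙 _) φ.left (left_proj_id _) ≫ (M.mul X).left := by
  have w₁ : (a ≫ 𝟙 I) ≫ h = z ≫ Z.pj := by rw [Category.comp_id, w']
  rw [elt_comp _ (bs_vh _) _ hu _ _ _ _ w₁, act_vh]
  congr 1
  exact elt_congr rfl _ _ (Category.comp_id _) rfl _ _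

theorem vh_comp_vh_unit {I : B} {X Y Z : Slice D I} (φ : Y ⟶ M.obj X) (i : Z ⟶ Y) :
    vh φ ≫ vh (i ≫ M.unit Y) = vh (i ≫ φ) := by
  have e' : (M.unit (M.obj X)).left ≫ (M.mul X).left = 𝟙 _ :=
    congrArg (fun t => t.left) (M.left_unit X)
  have e'' := M.unit_naturality (𝟙 _) _ (left_proj_id φ)
  refine hom_ext (h := 𝟙 I) (by simp) (bs_vh _) fun W a z w => ?_
  rw [elt_vh_comp φ _ (bs_vh _) _ _ _ _ w, elt_vh, elt_vh]
  change (z ≫ i.left ≫ (M.unit Y).left) ≫ _ = z ≫ i.left ≫ φ.left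
  rw [Category.assoc, Category.assoc, ← reassoc_of% e'', e', Category.comp_id]

/-- The vertical-cartesian factorization of a map of `Dill`. -/
theorem vh_repr_comp_cart {X Y : Dill M} (f : X ⟶ Y) : vh (repr f) ≫ cart Y (bs f) = f := by
  have sq := FibredMonad.isPullback_pr (bs f) Y.fam
  have hb : bs (vh (repr f) ≫ cart Y (bs f)) = bs f := by rw [bs_comp]; exact Category.id_comp _
  refine hom_ext_univ hb rfl sq ?_
  have e := elt_comp_cartSq (X := ⟨X.base, (reindex D (bs f)).obj Y.fam⟩) (bs (X := X) f)
    (FibredMonad.pr (bs f) Y.fam) sq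
    (vh (repr f)) (bs_vh (repr f)) hb (proj _) (𝟙 _) (FibredMonad.pr (bs f) Y.fam)
    (Category.id_comp _) ((Category.comp_id _).trans (Category.id_comp _).symm) sq.w.symm
  refine e.trans ?_
  have e' : sq.lift _ _ sq.w = 𝟙 _ := sq.hom_ext
    ((sq.lift_fst _ _ _).trans (Category.id_comp _).symm)
    ((sq.lift_snd _ _ _).trans (Category.id_comp _).symm)
  rw [elt_vh, elt, e']

/-! ### Complements -/

/-- The map `f : X ⟶ Y` exhibits `X` as a product of `Y` and `C` relative to the bases. -/
structure IsComplement {X Y : Dill M} {C : Slice D X.base} (f : X ⟶ Y)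
    (c : X ⟶ (⟨X.base, C⟩ : Dill M)) : Prop where
  bs_eq : bs c = 𝟙 X.base
  univ : ∀ ⦃Z : Dill M⦄ (a : Z ⟶ Y) (b : Z ⟶ (⟨X.base, C⟩ : Dill M)),
    bs a = bs b ≫ bs (X := X) f →
    ∃! l : Z ⟶ X, l ≫ f = a ∧ l ≫ c = b

namespace IsComplement

variable {X Y : Dill M} {C : Slice D X.base} {f : X ⟶ Y} {c : X ⟶ (⟨X.base, C⟩ : Dill M)}

theorem exists_lift (H : IsComplement f c) {Z : Dill M} (a : Z ⟶ Y)
    (b : Z ⟶ (⟨X.base, C⟩ : Dill M)) (w : bs a = bs b ≫ bs (X := X) f) :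
    ∃ l : Z ⟶ X, l ≫ f = a ∧ l ≫ c = b ∧ bs l = bs b := by
  obtain ⟨l, h₁, h₂⟩ := (H.univ a b w).exists
  refine ⟨l, h₁, h₂, ?_⟩
  rw [← h₂, bs_comp, H.bs_eq]
  exact (Category.comp_id _).symm

theorem hom_ext (H : IsComplement f c) {Z : Dill M} {g h : Z ⟶ X} (e₁ : g ≫ f = h ≫ f)
    (e₂ : g ≫ c = h ≫ c) : g = h := by
  refine (H.univ (g ≫ f) (g ≫ c) ?_).unique ⟨rfl, rfl⟩ ⟨e₁.symm, e₂.symm⟩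
  rw [bs_comp, bs_comp, H.bs_eq]
  exact congrArg (fun t => t ≫ bs f) (Category.comp_id _).symm

theorem of_iso (H : IsComplement f c) {X' : Slice D X.base} {f' : ⟨X.base, X'⟩ ⟶ Y}
    {c' : ⟨X.base, X'⟩ ⟶ (⟨X.base, C⟩ : Dill M)} (i : (⟨X.base, X'⟩ : Dill M) ≅ X)
    (hi : i.hom ≫ f = f') (hi' : i.hom ≫ c = c') (hb : bs i.hom = 𝟙 X.base) :
    IsComplement f' c' where
  bs_eq := by
    rw [← hi', bs_comp, hb, H.bs_eq]
    exact Category.comp_id _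
  univ Z a b w := by
    have w' : bs a = bs b ≫ bs (X := X) f := by
      rw [w, ← hi, bs_comp, hb]
      exact congrArg (fun t => bs b ≫ t) (Category.id_comp _)
    obtain ⟨l, h₁, h₂, -⟩ := H.exists_lift a b w'
    refine ⟨l ≫ i.inv, ⟨?_, ?_⟩, ?_⟩
    · rw [← hi, Category.assoc, Iso.inv_hom_id_assoc, h₁]
    · rw [← hi', Category.assoc, Iso.inv_hom_id_assoc, h₂]
    · rintro m ⟨h₃, h₄⟩
      rw [Iso.eq_comp_inv]
      refine H.hom_ext ?_ ?_
      · rw [Category.assoc, hi, h₁, h₃]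
      · rw [Category.assoc, hi', h₂, h₄]

/-- A square of complemented maps is a pullback if it is one on bases and the induced map of
complements is cartesian. -/
theorem isPullback (H : IsComplement f c) {X' Y' : Dill M} {C' : Slice D X'.base} {f' : X' ⟶ Y'}
    {c' : X' ⟶ (⟨X'.base, C'⟩ : Dill M)} (H' : IsComplement f' c') {α : X ⟶ X'} {β : Y ⟶ Y'}
    {γ : (⟨X.base, C⟩ : Dill M) ⟶ ⟨X'.base, C'⟩} (w : α ≫ f' = f ≫ β) (w' : α ≫ c' = c ≫ γ)
    (hb : IsPullback (bs α) (bs f) (bs f') (bs β)) (hγ : IsCart γ) : IsPullback α f f' β := by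
  have eγ : bs γ = bs α := by
    have := congrArg bs w'
    rw [bs_comp, bs_comp, H.bs_eq, H'.bs_eq] at this
    exact (Category.id_comp _).symm.trans (this.symm.trans (Category.comp_id _))
  have key (Z : Dill M) (u : Z ⟶ X') (v : Z ⟶ Y) (e : u ≫ f' = v ≫ β) :
      ∃! l : Z ⟶ X, l ≫ α = u ∧ l ≫ f = v := by
    have eb : bs u ≫ bs f' = bs v ≫ bs β := congrArg bs e
    -- The pullback of bases gives the base map of the lift; cartesianness of `γ` then gives its
    -- complement component, while its other component is `v`.
    obtain ⟨b, hb₁, hb₂⟩ := hγ.exists_lift (u ≫ c') (hb.lift _ _ eb) (by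
      rw [eγ, bs_comp, H'.bs_eq]
      exact (hb.lift_fst _ _ _).trans (Category.comp_id _).symm)
    obtain ⟨l, h₁, h₂, -⟩ := H.exists_lift v b (by rw [hb₁, hb.lift_snd])
    refine ⟨l, ⟨?_, h₁⟩, ?_⟩
    · refine H'.hom_ext ?_ ?_
      · rw [Category.assoc, w, reassoc_of% h₁, e]
      · rw [Category.assoc, w', reassoc_of% h₂, hb₂]
    · rintro m ⟨h₃, h₄⟩
      refine H.hom_ext (h₄.trans h₁.symm) (hγ.hom_ext ?_ ?_)
      · rw [h₂, hb₁, bs_comp, H.bs_eq]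
        refine (Category.comp_id _).trans (hb.hom_ext ?_ ?_)
        · rw [hb.lift_fst, ← h₃]
          rfl
        · rw [hb.lift_snd, ← h₄]
          rfl
      · rw [Category.assoc, ← w', reassoc_of% h₃, h₂, hb₂]
  exact ⟨⟨w⟩, ⟨PullbackCone.IsLimit.mk w (fun s => (key s.pt s.fst s.snd s.condition).choose)
    (fun s => (key s.pt s.fst s.snd s.condition).choose_spec.1.1)
    (fun s => (key s.pt s.fst s.snd s.condition).choose_spec.1.2)
    (fun s m h₁ h₂ => (key s.pt s.fst s.snd s.condition).choose_spec.2 m ⟨h₁, h₂⟩)⟩⟩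

/-- A complement of a pullback. -/
theorem of_isPullback (H : IsComplement f c) {X' Y' : Dill M} {f' : X' ⟶ Y'} {α : X' ⟶ X}
    {β : Y' ⟶ Y} (sq : IsPullback α f' f β) (hb : IsPullback (bs α) (bs f') (bs f) (bs β))
    {C' : Slice D X'.base} {c' : X' ⟶ (⟨X'.base, C'⟩ : Dill M)} (hc' : bs c' = 𝟙 X'.base)
    {γ : (⟨X'.base, C'⟩ : Dill M) ⟶ ⟨X.base, C⟩} (hγ : IsCart γ) (eγ : bs γ = bs α)
    (w : c' ≫ γ = α ≫ c) : IsComplement f' c' where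
  bs_eq := hc'
  univ Z a b e := by
    obtain ⟨l, h₁, h₂, h₃⟩ := H.exists_lift (a ≫ β) (b ≫ γ) (by
      rw [bs_comp, bs_comp, e, eγ, Category.assoc]
      exact (congrArg (fun t => bs b ≫ t) hb.w.symm).trans (Category.assoc _ _ _).symm)
    refine ⟨sq.lift l a h₁, ⟨sq.lift_snd _ _ _, hγ.hom_ext ?_ ?_⟩, ?_⟩
    · refine (congrArg (fun t => bs (sq.lift l a h₁) ≫ t) hc').trans ?_
      refine (Category.comp_id _).trans (hb.hom_ext ?_ ?_)
      · refine (congrArg bs (sq.lift_fst l a h₁)).trans ?_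
        rw [h₃, bs_comp, eγ]
      · exact (congrArg bs (sq.lift_snd l a h₁)).trans e
    · rw [Category.assoc, w, sq.lift_fst_assoc, h₂]
    · rintro m ⟨h₄, h₅⟩
      refine sq.hom_ext ?_ ?_
      · rw [sq.lift_fst]
        refine H.hom_ext ?_ ?_
        · rw [h₁, Category.assoc, sq.w, reassoc_of% h₄]
        · rw [h₂, Category.assoc, ← w, reassoc_of% h₅]
      · rw [sq.lift_snd, h₄]

end IsComplement

/-! ### Initial families and products of families, from finite sum types. -/

section Sums

variable [HasFiniteSumTypes D]

/-- The zero object of `Dill` over `I`. -/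
noncomputable abbrev zero (M : FibredMonad D) (I : B) : Dill M := ⟨I, ⊥_ (Slice D I)⟩

/-- Maps into an initial family are determined by their base map. -/
theorem existsUnique_to_isInitial (X : Dill M) {I : B} {Z : Slice D I}
    (hZ : Nonempty (IsInitial Z)) (h : X.base ⟶ I) :
    ∃! f : X ⟶ (⟨I, Z⟩ : Dill M), bs f = h := by
  have := HasFiniteSumTypes.preserves (D := D) h
  obtain ⟨hZ⟩ := hZ
  have t : IsInitial ((reindex D h).obj Z) := IsInitial.isInitialObj (reindex D h) _ hZ
  have sq := FibredMonad.isPullback_pr h Z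
  refine ⟨mkHom (Y := ⟨I, Z⟩) h sq (t.to (M.obj X.fam)), rfl, fun f hf => ?_⟩
  refine hom_ext_univ (Y := ⟨I, Z⟩) hf (bs_mkHom (Y := ⟨I, Z⟩) _ _ _) sq ?_
  rw [elt_mkHom_univ (Y := ⟨I, Z⟩)]
  let φ : (reindex D h).obj Z ⟶ M.obj X.fam :=
    MorphismProperty.Over.homMk (elt f hf _ _ sq.w.symm) (elt_mpj _ _ _ _ _)
  exact congrArg (fun k => k.left) (t.hom_ext φ (t.to _))

theorem existsUnique_to_zero (X : Dill M) {I : B} (h : X.base ⟶ I) :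
    ∃! f : X ⟶ zero M I, bs f = h :=
  existsUnique_to_isInitial X ⟨initialIsInitial⟩ h

/-- The product of two families in `Dill`. -/
theorem exists_isComplement_coprod {I : B} (X Y : Slice D I) :
    ∃ (p : (⟨I, X ⨿ Y⟩ : Dill M) ⟶ ⟨I, X⟩) (q : (⟨I, X ⨿ Y⟩ : Dill M) ⟶ ⟨I, Y⟩),
      p = vh (coprod.inl ≫ M.unit _) ∧ q = vh (coprod.inr ≫ M.unit _) ∧ IsComplement p q := by
  refine ⟨_, _, rfl, rfl, bs_vh _, fun Z a b e => ?_⟩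
  obtain ⟨h, hb⟩ : ∃ h : Z.base ⟶ I, bs b = h := ⟨_, rfl⟩
  have ha : bs a = h := by
    rw [e, hb]
    exact Category.comp_id _
  have := HasFiniteSumTypes.preserves (D := D) h
  -- Because `h^*` preserves the coproduct, the universal property holds for `Z` over an arbitrary
  -- base map `h`, not only inside the fibre over `I`.
  have t := isColimitOfHasBinaryCoproductOfPreservesColimit (reindex D h) X Y
  have sX := FibredMonad.isPullback_pr h X
  have sY := FibredMonad.isPullback_pr h Y
  have sq := FibredMonad.isPullback_pr h (X ⨿ Y)
  let φa : (reindex D h).obj X ⟶ M.obj Z.fam :=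
    MorphismProperty.Over.homMk (elt a ha _ _ sX.w.symm) (elt_mpj _ _ _ _ _)
  let φb : (reindex D h).obj Y ⟶ M.obj Z.fam :=
    MorphismProperty.Over.homMk (elt b hb _ _ sY.w.symm) (elt_mpj _ _ _ _ _)
  have e₁ : ((reindex D h).map (coprod.inl : X ⟶ X ⨿ Y)).left ≫ FibredMonad.pr h (X ⨿ Y) =
      FibredMonad.pr h X ≫ (coprod.inl : X ⟶ X ⨿ Y).left := pullback.lift_fst _ _ _
  have e₂ : ((reindex D h).map (coprod.inr : Y ⟶ X ⨿ Y)).left ≫ FibredMonad.pr h (X ⨿ Y) =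
      FibredMonad.pr h Y ≫ (coprod.inr : Y ⟶ X ⨿ Y).left := pullback.lift_fst _ _ _
  -- Composing with the vertical map of a coproduct injection `i` restricts the representing map
  -- along `h^* i`.
  have key {P : Slice D I} (i : P ⟶ X ⨿ Y) (c : Z ⟶ (⟨I, P⟩ : Dill M)) (hc : bs c = h)
      (l : Z ⟶ (⟨I, X ⨿ Y⟩ : Dill M)) (hl : bs l = h) (ei : ((reindex D h).map i).left ≫
        FibredMonad.pr h (X ⨿ Y) = FibredMonad.pr h P ≫ i.left) :
      l ≫ vh (i ≫ M.unit _) = c ↔ ((reindex D h).map i).left ≫ elt l hl _ _ sq.w.symm =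
        elt c hc _ _ (FibredMonad.isPullback_pr h P).w.symm := by
    have hl' : bs (l ≫ vh (i ≫ M.unit _)) = h := by
      rw [bs_comp, hl]
      exact Category.comp_id _
    have sP := FibredMonad.isPullback_pr h P
    have w₁ : proj ((reindex D h).obj P) ≫ h = (FibredMonad.pr h P ≫ i.left) ≫ proj (X ⨿ Y) := by
      rw [Category.assoc, left_proj, sP.w]
    have e₃ : elt (l ≫ vh (i ≫ M.unit _)) hl' _ _ sP.w.symm =
        ((reindex D h).map i).left ≫ elt l hl _ _ sq.w.symm := by
      rw [elt_comp l hl _ (bs_vh _) hl' _ _ _ ((Category.comp_id _).trans sP.w.symm),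
        comp_elt, elt_congr rfl hl hl (left_proj _) ei _ w₁, ← act_eta l hl _ _ w₁ (by
          rw [Category.assoc, eta_mpj, w₁])]
      refine act_congr rfl _ _ rfl ?_ _ _
      rw [elt_vh, Category.assoc]
      rfl
    rw [← e₃]
    exact ⟨fun e => elt_congr e _ _ rfl rfl _ _, fun e => hom_ext_univ hl' hc sP e⟩
  obtain ⟨(ψ : (reindex D h).obj (X ⨿ Y) ⟶ M.obj Z.fam), h₁, h₂⟩ := BinaryCofan.IsColimit.desc' t φa φb
  refine ⟨mkHom (Y := ⟨I, X ⨿ Y⟩) h sq ψ, ⟨?_, ?_⟩, ?_⟩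
  · refine (key coprod.inl a ha _ (bs_mkHom (Y := ⟨I, X ⨿ Y⟩) h sq ψ) e₁).2 ?_
    rw [elt_mkHom_univ (Y := ⟨I, X ⨿ Y⟩)]
    exact congrArg (fun k => k.left) h₁
  · refine (key coprod.inr b hb _ (bs_mkHom (Y := ⟨I, X ⨿ Y⟩) h sq ψ) e₂).2 ?_
    rw [elt_mkHom_univ (Y := ⟨I, X ⨿ Y⟩)]
    exact congrArg (fun k => k.left) h₂
  · rintro l ⟨hl₁, hl₂⟩
    have hl : bs l = h := by
      rw [← hb, ← hl₂]
      exact (Category.comp_id _).symm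
    refine hom_ext_univ hl (bs_mkHom (Y := ⟨I, X ⨿ Y⟩) h sq ψ) sq ?_
    rw [elt_mkHom_univ (Y := ⟨I, X ⨿ Y⟩)]
    let χ : (reindex D h).obj (X ⨿ Y) ⟶ M.obj Z.fam :=
      MorphismProperty.Over.homMk (elt l hl _ _ sq.w.symm) (elt_mpj _ _ _ _ _)
    refine congrArg (fun k => k.left) (BinaryCofan.IsColimit.hom_ext t (f := χ) (g := ψ) ?_ ?_)
    · refine Eq.trans ?_ h₁.symm
      exact MorphismProperty.Over.Hom.ext ((key coprod.inl a ha l hl e₁).1 hl₁)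
    · refine Eq.trans ?_ h₂.symm
      exact MorphismProperty.Over.Hom.ext ((key coprod.inr b hb l hl e₂).1 hl₂)

/-- Cartesianness turns maps to `Y` over a base map through `h` into maps to `h^* Y`, so a product
over `J` becomes a relative product over `Y`. -/
theorem IsComplement.comp_cart {Y : Dill M} {J : B} {h : J ⟶ Y.base} {X C : Slice D J}
    {p : (⟨J, X⟩ : Dill M) ⟶ ⟨J, (reindex D h).obj Y.fam⟩} {q : (⟨J, X⟩ : Dill M) ⟶ ⟨J, C⟩}
    (H : IsComplement p q) (hp : bs p = 𝟙 J) : IsComplement (p ≫ cart Y h) q := by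
  have hb : bs (p ≫ cart Y h) = h := by
    rw [bs_comp, hp]
    exact Category.id_comp _
  refine ⟨H.bs_eq, fun Z a b e => ?_⟩
  rw [hb] at e
  obtain ⟨a', ha', rfl⟩ := (isCart_cart Y h).exists_lift a
    (bs (Y := ⟨J, C⟩) b) e.symm
  obtain ⟨l, h₁, h₂, h₃⟩ := H.exists_lift a' b (by rw [ha', hp]; exact (Category.comp_id _).symm)
  refine ⟨l, ⟨by rw [← h₁, Category.assoc], h₂⟩, ?_⟩
  rintro m ⟨h₄, h₅⟩
  refine H.hom_ext ((isCart_cart Y h).hom_ext ?_ ?_) (h₅.trans h₂.symm)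
  · have : bs m = bs l := by
      rw [h₃, ← h₅]
      refine Eq.trans ?_ (congrArg (fun t => bs m ≫ t) H.bs_eq.symm)
      exact (Category.comp_id _).symm
    rw [bs_comp, bs_comp, this]
  · rw [Category.assoc, h₄, h₁]

/-- Complemented maps with given base map and complement exist. -/
theorem exists_isComplement (Y : Dill M) {J : B} (h : J ⟶ Y.base) (C : Slice D J) :
    ∃ (f : (⟨J, (reindex D h).obj Y.fam ⨿ C⟩ : Dill M) ⟶ Y) (c : _ ⟶ (⟨J, C⟩ : Dill M)),
      bs f = h ∧ IsComplement f c := by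
  obtain ⟨p, q, hp, -, H⟩ := exists_isComplement_coprod (M := M) ((reindex D h).obj Y.fam) C
  have hp' : bs p = 𝟙 J := by rw [hp]; rfl
  refine ⟨p ≫ cart Y h, q, ?_, H.comp_cart hp'⟩
  rw [bs_comp, hp']
  exact Category.id_comp _

end Sums

end Dill

namespace Dill

variable {B : Type u} [Category.{v} B] {D : MorphismProperty B} {M : FibredMonad D}
variable [IsDisplayMapClass D] [HasFiniteSumTypes D] [HasSigmaTypes D]

/-! ### Additivity -/

theorem isTerminal_obj_initial (hM : ∀ I : B, IsAdditiveMonad (M.fibre I)) (I : B) : Nonempty (IsTerminal (M.obj (⊥_ (Slice D I)))) :=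
  ⟨(hM I).choose⟩

theorem isIso_proj_obj_initial (hM : ∀ I : B, IsAdditiveMonad (M.fibre I)) (I : B) : IsIso (proj (M.obj (⊥_ (Slice D I)))) := by
  obtain ⟨t⟩ := isTerminal_obj_initial hM I
  let T : Slice D I := MorphismProperty.Over.mk ⊤ (𝟙 I) (D.id_mem I)
  let q : M.obj (⊥_ (Slice D I)) ⟶ T :=
    MorphismProperty.Over.homMk (proj (M.obj (⊥_ (Slice D I)))) (Category.comp_id _)
  refine ⟨(t.from T).left, ?_, left_proj (t.from T)⟩
  exact congrArg (fun k => k.left) (t.hom_ext (q ≫ t.from T) (𝟙 _))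

/-- A representing map lands in `M 0`, whose projection to `I` is invertible. Together with
`existsUnique_to_zero`, this makes `zero` both left and right adjoint to the projection to `B`. -/
theorem existsUnique_from_zero (hM : ∀ I : B, IsAdditiveMonad (M.fibre I)) {I : B} (Y : Dill M) (h : I ⟶ Y.base) :
    ∃! f : zero M I ⟶ Y, bs f = h := by
  obtain ⟨t⟩ := isTerminal_obj_initial hM I
  have := isIso_proj_obj_initial hM I
  have sq := FibredMonad.isPullback_pr h Y.fam
  refine ⟨mkHom (X := zero M I) h sq (t.from _), rfl, fun f hf => ?_⟩
  refine hom_ext hf (bs_mkHom _ _ _) fun W a y w => ?_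
  rw [← cancel_mono (proj (M.obj (⊥_ (Slice D I))))]
  exact (elt_mpj _ _ _ _ _).trans (elt_mpj _ _ _ _ _).symm

/-- A map of `Dill` is zero if it factors through a zero object. -/
def IsZeroMap {X Y : Dill M} (f : X ⟶ Y) : Prop :=
  ∃ (I : B) (a : X ⟶ zero M I) (b : zero M I ⟶ Y), f = a ≫ b

theorem IsZeroMap.comp {X Y Z : Dill M} {f : X ⟶ Y} (hf : IsZeroMap f) (g : Y ⟶ Z) :
    IsZeroMap (f ≫ g) := by
  obtain ⟨I, a, b, rfl⟩ := hf
  exact ⟨I, a, b ≫ g, Category.assoc _ _ _⟩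

theorem IsZeroMap.comp_left {X Y Z : Dill M} {g : Y ⟶ Z} (hg : IsZeroMap g) (f : X ⟶ Y) :
    IsZeroMap (f ≫ g) := by
  obtain ⟨I, a, b, rfl⟩ := hg
  exact ⟨I, f ≫ a, b, (Category.assoc _ _ _).symm⟩

/-- A zero map can be rerouted through the zero object over the base of `X`, by a map over the
identity; both halves are then determined by their base maps. -/
theorem IsZeroMap.ext (hM : ∀ I : B, IsAdditiveMonad (M.fibre I)) {X Y : Dill M} {f g : X ⟶ Y} (hf : IsZeroMap f) (hg : IsZeroMap g)
    (e : bs f = bs g) : f = g := by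
  have key {f : X ⟶ Y} (hf : IsZeroMap f) : ∃ (a : X ⟶ zero M X.base) (b : zero M X.base ⟶ Y),
      f = a ≫ b ∧ bs a = 𝟙 _ := by
    obtain ⟨I, a, b, rfl⟩ := hf
    obtain ⟨a₀, ha₀, -⟩ := existsUnique_to_zero X (𝟙 X.base)
    obtain ⟨c, hc, -⟩ := existsUnique_from_zero hM (zero M I) (bs a)
    refine ⟨a₀, c ≫ b, ?_, ha₀⟩
    rw [← Category.assoc]
    congr 1
    refine (existsUnique_to_zero X (bs a)).unique rfl ?_
    rw [bs_comp, ha₀, hc]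
    exact Category.id_comp _
  obtain ⟨a, b, rfl, ha⟩ := key hf
  obtain ⟨a', b', rfl, ha'⟩ := key hg
  have ea : a = a' := (existsUnique_to_zero X (𝟙 X.base)).unique ha ha'
  subst ea
  have eb : bs b = bs b' := by
    rw [bs_comp, bs_comp, ha] at e
    exact (Category.id_comp _).symm.trans (e.trans (Category.id_comp _))
  rw [(existsUnique_from_zero hM Y (bs b)).unique rfl eb.symm]

/-- The projection of `Dill` to the base preserves pullbacks. -/
theorem isPullback_bs (hM : ∀ I : B, IsAdditiveMonad (M.fibre I)) {X X' Y Y' : Dill M} {α : X' ⟶ X} {f' : X' ⟶ Y'} {f : X ⟶ Y} {β : Y' ⟶ Y}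
    (sq : IsPullback α f' f β) : IsPullback (bs α) (bs f') (bs f) (bs β) := by
  have w : bs α ≫ bs f = bs f' ≫ bs β := congrArg bs sq.w
  have key (W : B) (x : W ⟶ X.base) (y : W ⟶ Y'.base) (e : x ≫ bs f = y ≫ bs β) :
      ∃! l : W ⟶ X'.base, l ≫ bs α = x ∧ l ≫ bs f' = y := by
    -- Maps out of `W` in `B` are maps out of the zero object over `W` in `Dill`, so the universal
    -- property of `sq` is tested on zero objects.
    obtain ⟨fx, hx, hx'⟩ := existsUnique_from_zero hM X x
    obtain ⟨fy, hy, hy'⟩ := existsUnique_from_zero hM Y' y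
    have e' : fx ≫ f = fy ≫ β := by
      refine (existsUnique_from_zero hM Y (x ≫ bs f)).unique ?_ ?_
      · rw [bs_comp, hx]
      · rw [bs_comp, hy, e]
    refine ⟨bs (sq.lift fx fy e'), ⟨?_, ?_⟩, ?_⟩
    · exact (congrArg bs (sq.lift_fst fx fy e')).trans hx
    · exact (congrArg bs (sq.lift_snd fx fy e')).trans hy
    · rintro m ⟨h₁, h₂⟩
      obtain ⟨g, hg, -⟩ := existsUnique_from_zero hM X' m
      rw [← hg]
      refine congrArg bs (sq.hom_ext ?_ ?_)
      · rw [sq.lift_fst]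
        exact hx' _ (by rw [← h₁, ← hg]; rfl)
      · rw [sq.lift_snd]
        exact hy' _ (by rw [← h₂, ← hg]; rfl)
  exact ⟨⟨w⟩, ⟨PullbackCone.IsLimit.mk w (fun s => (key s.pt s.fst s.snd s.condition).choose)
    (fun s => (key s.pt s.fst s.snd s.condition).choose_spec.1.1)
    (fun s => (key s.pt s.fst s.snd s.condition).choose_spec.1.2)
    (fun s m h₁ h₂ => (key s.pt s.fst s.snd s.condition).choose_spec.2 m ⟨h₁, h₂⟩)⟩⟩

/-- By `Σ`-types the pullback over `I` of two display maps is an object of `D/I`, hence their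
product there. The product form of additivity thus becomes a pullback square in `B`. -/
theorem isPullback_of_isIso_prodLift {I : B} {T X Y : Slice D I} (p : T ⟶ X) (q : T ⟶ Y)
    [IsIso (prod.lift p q)] : IsPullback p.left q.left (proj X) (proj Y) := by
  have w : p.left ≫ proj X = q.left ≫ proj Y := (left_proj p).trans (left_proj q).symm
  obtain ⟨P, a, b, sq, hb⟩ := exists_isPullback_right X.prop (proj Y)
  let P' : Slice D I := MorphismProperty.Over.mk ⊤ (b ≫ proj Y) (D.comp_mem _ _ hb Y.prop)
  let a' : P' ⟶ X := MorphismProperty.Over.homMk a sq.w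
  let b' : P' ⟶ Y := MorphismProperty.Over.homMk b rfl
  let s : P' ⟶ T := prod.lift a' b' ≫ inv (prod.lift p q)
  have e₀ : s ≫ prod.lift p q = prod.lift a' b' :=
    (Category.assoc _ _ _).trans
      ((congrArg (fun t => prod.lift a' b' ≫ t) (IsIso.inv_hom_id _)).trans (Category.comp_id _))
  have s₁ : s ≫ p = a' :=
    (congrArg (fun t => s ≫ t) (prod.lift_fst p q).symm).trans ((Category.assoc _ _ _).symm.trans
      ((congrArg (fun t => t ≫ prod.fst) e₀).trans (prod.lift_fst _ _)))
  have s₂ : s ≫ q = b' :=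
    (congrArg (fun t => s ≫ t) (prod.lift_snd p q).symm).trans ((Category.assoc _ _ _).symm.trans
      ((congrArg (fun t => t ≫ prod.snd) e₀).trans (prod.lift_snd _ _)))
  have t₁ : s.left ≫ p.left = a := congrArg (fun k => k.left) s₁
  have t₂ : s.left ≫ q.left = b := congrArg (fun k => k.left) s₂
  have hw : sq.lift p.left q.left w ≫ b ≫ proj Y = proj T := by
    rw [sq.lift_snd_assoc, left_proj]
  let r : T ⟶ P' := MorphismProperty.Over.homMk (sq.lift p.left q.left w) hw
  have r₁ : r ≫ a' = p := MorphismProperty.Over.Hom.ext (sq.lift_fst _ _ _)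
  have r₂ : r ≫ b' = q := MorphismProperty.Over.Hom.ext (sq.lift_snd _ _ _)
  have e₁ : r ≫ s = 𝟙 T := by
    rw [← cancel_mono (prod.lift p q)]
    have : (r ≫ s) ≫ prod.lift p q = r ≫ prod.lift a' b' :=
      (Category.assoc _ _ _).trans (congrArg (fun t => r ≫ t) e₀)
    refine this.trans (Eq.trans ?_ (Category.id_comp _).symm)
    refine (prod.comp_lift _ _ _).trans ?_
    rw [r₁, r₂]
  have e₁' : sq.lift p.left q.left w ≫ s.left = 𝟙 T.left := congrArg (fun k => k.left) e₁
  have e₂ : s.left ≫ sq.lift p.left q.left w = 𝟙 P := by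
    apply sq.hom_ext
    · rw [Category.assoc, sq.lift_fst, t₁]
      exact (Category.id_comp _).symm
    · rw [Category.assoc, sq.lift_snd, t₂]
      exact (Category.id_comp _).symm
  refine sq.of_iso ⟨s.left, sq.lift p.left q.left w, e₂, e₁'⟩ (Iso.refl _) (Iso.refl _)
    (Iso.refl _) ?_ ?_ ?_ ?_
  · exact (Category.comp_id _).trans t₁.symm
  · exact (Category.comp_id _).trans t₂.symm
  · exact (Category.comp_id _).trans (Category.id_comp _).symm
  · exact (Category.comp_id _).trans (Category.id_comp _).symm

/-- By additivity, the product of two families over `I` is also a coproduct. -/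
theorem exists_biproduct_coprod (hM : ∀ I : B, IsAdditiveMonad (M.fibre I)) {I : B}
    (X Y : Slice D I) :
    ∃ (i : (⟨I, X⟩ : Dill M) ⟶ ⟨I, X ⨿ Y⟩) (j : (⟨I, Y⟩ : Dill M) ⟶ ⟨I, X ⨿ Y⟩),
      i ≫ vh (coprod.inl ≫ M.unit _) = 𝟙 _ ∧ IsZeroMap (i ≫ vh (coprod.inr ≫ M.unit _)) ∧
      IsZeroMap (j ≫ vh (coprod.inl ≫ M.unit _)) ∧ j ≫ vh (coprod.inr ≫ M.unit _) = 𝟙 _ ∧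
      bs i = 𝟙 I ∧ bs j = 𝟙 I ∧
      ∀ ⦃Z : Dill M⦄ (a : (⟨I, X⟩ : Dill M) ⟶ Z) (b : (⟨I, Y⟩ : Dill M) ⟶ Z), bs a = bs b →
        ∃! l : (⟨I, X ⨿ Y⟩ : Dill M) ⟶ Z, i ≫ l = a ∧ j ≫ l = b := by
  obtain ⟨t, ht⟩ := hM I
  -- The Kleisli zero map is a composite through the object `0`, so it is a zero map of `Dill`.
  have hz (X Y : Slice D I) : IsZeroMap (vh (kleisliZero (M.fibre I) t X Y)) := by
    refine ⟨I, vh (initial.to (M.obj Y)), vh (t.from X), ?_⟩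
    have e : M.fibreMap (initial.to (M.obj Y)) ≫ M.mul Y = M.fibreMap (initial.to Y) := by
      have e₁ : initial.to (M.obj Y) = initial.to Y ≫ M.unit Y := Subsingleton.elim _ _
      rw [e₁]
      refine (congrArg (fun s => s ≫ M.mul Y)
        ((M.fibre I).map_comp (initial.to Y) (M.unit Y))).trans ?_
      refine (Category.assoc _ _ _).trans ((congrArg (fun s => M.fibreMap (initial.to Y) ≫ s)
        ((M.fibre I).right_unit Y)).trans (Category.comp_id _))
    have e₂ := vh_rep_comp (M.dillMk (initial.to (M.obj Y))) (M.dillMk (t.from X))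
    refine Eq.trans ?_ e₂
    refine congrArg vh ?_
    exact congrArg (fun s => t.from X ≫ s) e.symm
  let kz₁ : Y ⟶ M.obj X := kleisliZero (M.fibre I) t Y X
  let kz₂ : X ⟶ M.obj Y := kleisliZero (M.fibre I) t X Y
  refine ⟨vh (coprod.desc (M.unit X) kz₁), vh (coprod.desc kz₂ (M.unit Y)), ?_, ?_, ?_, ?_,
    bs_vh _, bs_vh _, fun Z a b e => ?_⟩
  · rw [vh_comp_vh_unit, coprod.inl_desc, vh_unit]
  · rw [vh_comp_vh_unit, coprod.inr_desc]
    exact hz _ _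
  · rw [vh_comp_vh_unit, coprod.inl_desc]
    exact hz _ _
  · rw [vh_comp_vh_unit, coprod.inr_desc, vh_unit]
  obtain ⟨h, hb⟩ : ∃ h : I ⟶ Z.base, bs b = h := ⟨_, rfl⟩
  have ha : bs a = h := e.trans hb
  -- Precomposing with a vertical map postcomposes the representing map with a Kleisli extension.
  have key {X Y : Slice D I} (φ : Y ⟶ M.obj X) (l : (⟨I, Y⟩ : Dill M) ⟶ Z) (hl : bs l = h)
      (a : (⟨I, X⟩ : Dill M) ⟶ Z) (ha : bs a = h) :
      vh φ ≫ l = a ↔ elt l hl _ _ (FibredMonad.isPullback_pr h Z.fam).w.symm ≫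
        (M.fibreMap φ ≫ M.mul X).left = elt a ha _ _ (FibredMonad.isPullback_pr h Z.fam).w.symm := by
    have hl' : bs (vh φ ≫ l) = h := by
      rw [bs_comp, hl]
      exact Category.id_comp _
    have := elt_vh_comp φ l hl hl' _ _ (FibredMonad.isPullback_pr h Z.fam).w.symm
      (FibredMonad.isPullback_pr h Z.fam).w.symm
    constructor
    · intro e
      exact this.symm.trans (elt_congr e _ _ rfl rfl _ _)
    · intro e
      exact hom_ext_univ hl' ha (FibredMonad.isPullback_pr h Z.fam) (this.trans e)
  let p : M.obj (X ⨿ Y) ⟶ M.obj X := M.fibreMap (coprod.desc (M.unit X) kz₁) ≫ M.mul X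
  let q : M.obj (X ⨿ Y) ⟶ M.obj Y := M.fibreMap (coprod.desc kz₂ (M.unit Y)) ≫ M.mul Y
  -- The Kleisli extensions `p` and `q` of `[η, 0]` and `[0, η]` are the components of the additive
  -- comparison. Hence a map to `M (X + Y)` is a pair of maps to `M X` and `M Y`.
  have : IsIso (prod.lift p q) := ht X Y
  have sq := isPullback_of_isIso_prodLift p q
  have sZ := FibredMonad.isPullback_pr h Z.fam
  have w : elt a ha _ _ sZ.w.symm ≫ proj (M.obj X) = elt b hb _ _ sZ.w.symm ≫ proj (M.obj Y) :=
    (elt_mpj a ha _ _ sZ.w.symm).trans (elt_mpj b hb _ _ sZ.w.symm).symm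
  let ψ : (reindex D h).obj Z.fam ⟶ M.obj (X ⨿ Y) := MorphismProperty.Over.homMk
    (sq.lift (elt a ha _ _ sZ.w.symm) (elt b hb _ _ sZ.w.symm) w) 
      ((congrArg (fun s => _ ≫ s) (left_proj p).symm).trans
        ((sq.lift_fst_assoc _ _ _ _).trans (elt_mpj a ha _ _ sZ.w.symm)))
  have hψ : ψ.left = sq.lift (elt a ha _ _ sZ.w.symm) (elt b hb _ _ sZ.w.symm) w := rfl
  have hl := bs_mkHom (X := ⟨I, X ⨿ Y⟩) h sZ ψ
  refine ⟨mkHom (X := ⟨I, X ⨿ Y⟩) h sZ ψ, ⟨?_, ?_⟩, ?_⟩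
  · rw [key _ _ hl a ha, elt_mkHom_univ (X := ⟨I, X ⨿ Y⟩), hψ]
    exact sq.lift_fst _ _ _
  · rw [key _ _ hl b hb, elt_mkHom_univ (X := ⟨I, X ⨿ Y⟩), hψ]
    exact sq.lift_snd _ _ _
  · rintro m ⟨h₁, h₂⟩
    have hm : bs m = h := by
      rw [← ha, ← h₁]
      exact (Category.id_comp _).symm
    refine hom_ext_univ hm hl sZ ?_
    rw [elt_mkHom_univ (X := ⟨I, X ⨿ Y⟩), hψ]
    refine sq.hom_ext ?_ ?_
    · rw [sq.lift_fst]
      exact (key _ m hm a ha).1 h₁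
    · rw [sq.lift_snd]
      exact (key _ m hm b hb).1 h₂

theorem IsComplement.exists_iso {X Y : Dill M} {C : Slice D X.base} {f : X ⟶ Y}
    {c : X ⟶ (⟨X.base, C⟩ : Dill M)} (H : IsComplement f c) {X' : Slice D X.base}
    {f' : (⟨X.base, X'⟩ : Dill M) ⟶ Y} {c' : (⟨X.base, X'⟩ : Dill M) ⟶ ⟨X.base, C⟩}
    (H' : IsComplement f' c') (e : bs f' = bs (X := X) f) :
    ∃ i : (⟨X.base, X'⟩ : Dill M) ≅ X, i.hom ≫ f = f' ∧ i.hom ≫ c = c' ∧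
      bs i.hom = 𝟙 X.base ∧ bs i.inv = 𝟙 X.base := by
  have w : bs f' = bs c' ≫ bs (X := X) f := by
    rw [H'.bs_eq, e]
    exact (Category.id_comp _).symm
  have w' : bs (X := X) f = bs (Y := ⟨X.base, C⟩) c ≫ bs (X := ⟨X.base, X'⟩) f' := by
    rw [H.bs_eq, e]
    exact (Category.id_comp _).symm
  obtain ⟨a, ha₁, ha₂, ha₃⟩ := H.exists_lift f' c' w
  obtain ⟨b, hb₁, hb₂, hb₃⟩ := H'.exists_lift f c w'
  refine ⟨⟨a, b, H'.hom_ext ?_ ?_, H.hom_ext ?_ ?_⟩, ha₁, ha₂, ha₃.trans H'.bs_eq,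
    hb₃.trans H.bs_eq⟩
  · rw [Category.assoc, hb₁, ha₁, Category.id_comp]
  · rw [Category.assoc, hb₂, ha₂, Category.id_comp]
  · rw [Category.assoc, ha₁, hb₁, Category.id_comp]
  · rw [Category.assoc, ha₂, hb₂, Category.id_comp]

/-- By additivity, a complemented map is also a coproduct. -/
theorem IsComplement.exists_biproduct (hM : ∀ I : B, IsAdditiveMonad (M.fibre I)) {X Y : Dill M}
    {C : Slice D X.base} {f : X ⟶ Y} {c : X ⟶ (⟨X.base, C⟩ : Dill M)} (H : IsComplement f c) :
    ∃ (i : (⟨X.base, (reindex D (bs f)).obj Y.fam⟩ : Dill M) ⟶ X)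
      (j : (⟨X.base, C⟩ : Dill M) ⟶ X), bs i = 𝟙 X.base ∧ bs j = 𝟙 X.base ∧
      i ≫ f = cart Y (bs f) ∧ IsZeroMap (i ≫ c) ∧ IsZeroMap (j ≫ f) ∧ j ≫ c = 𝟙 _ ∧
      ∀ ⦃Z : Dill M⦄ (a : (⟨X.base, (reindex D (bs f)).obj Y.fam⟩ : Dill M) ⟶ Z)
        (b : (⟨X.base, C⟩ : Dill M) ⟶ Z), bs a = bs b →
        ∃! l : X ⟶ Z, i ≫ l = a ∧ j ≫ l = b := by
  obtain ⟨p, q, hp, hq, H₀⟩ :=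
    exists_isComplement_coprod (M := M) ((reindex D (bs (X := X) f)).obj Y.fam) C
  have hp' : bs p = 𝟙 X.base := by rw [hp]; rfl
  have hb : bs (p ≫ cart Y (bs (X := X) f)) = bs (X := X) f := by
    rw [bs_comp, hp']
    exact Category.id_comp _
  -- Relative products with the same base map and complement are isomorphic, so it suffices to treat
  -- the coproduct family.
  obtain ⟨e, e₁, e₂, e₃, e₄⟩ := H.exists_iso (H₀.comp_cart hp') hb
  obtain ⟨i, j, h₁, h₂, h₃, h₄, hi, hj, U⟩ := exists_biproduct_coprod hM
    ((reindex D (bs (X := X) f)).obj Y.fam) C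
  rw [← hp] at h₁ h₃
  rw [← hq] at h₂ h₄
  refine ⟨i ≫ e.hom, j ≫ e.hom, ?_, ?_, ?_, ?_, ?_, ?_, fun Z a b w => ?_⟩
  · rw [bs_comp, hi, e₃]
    exact Category.id_comp _
  · rw [bs_comp, hj, e₃]
    exact Category.id_comp _
  · rw [Category.assoc, e₁, reassoc_of% h₁]
  · rw [Category.assoc, e₂]
    exact h₂
  · rw [Category.assoc, e₁, ← Category.assoc]
    exact h₃.comp _
  · rw [Category.assoc, e₂, h₄]
  · obtain ⟨l, ⟨l₁, l₂⟩, l₃⟩ := U a b w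
    refine ⟨e.inv ≫ l, ⟨?_, ?_⟩, ?_⟩
    · rw [Category.assoc, e.hom_inv_id_assoc, l₁]
    · rw [Category.assoc, e.hom_inv_id_assoc, l₂]
    · rintro m ⟨m₁, m₂⟩
      rw [Iso.eq_inv_comp]
      exact l₃ _ ⟨by rw [← m₁, Category.assoc], by rw [← m₂, Category.assoc]⟩

theorem fibre_hom_ext {I : B} {X Y : Slice D I} {α β : M.dillObj X ⟶ M.dillObj Y}
    (e : vh (M.rep α) = vh (M.rep β)) : α = β :=
  M.dill_ext (congrArg (fun k => k.left) (vh_injective e))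

/-- A product in the fibre is tested only by objects over the same base, a complement by all of
`Dill`. The gap is closed by comparing with the coproduct family, which satisfies the stronger
property; conversely the complement property restricts to the fibre through the cartesian lift. Of
the vertical component `F` only the factorization `hF` is used. -/
theorem isProductProjection_iff_of_eq {X Y : Dill M} (f : X ⟶ Y) (C : Slice D X.base)
    (F : M.dillObj X.fam ⟶ M.dillObj ((reindex D (bs f)).obj Y.fam))
    (hF : vh (M.rep F) ≫ cart Y (bs (X := X) f) = f) :
    IsProductProjection F (M.dillObj C) ↔
      ∃ c : X ⟶ (⟨X.base, C⟩ : Dill M), IsComplement f c := by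
  constructor
  · rintro ⟨g, ⟨hl⟩⟩
    obtain ⟨p, q, hp, hq, H⟩ :=
      exists_isComplement_coprod (M := M) ((reindex D (bs (X := X) f)).obj Y.fam) C
    have hp' : bs p = 𝟙 X.base := by rw [hp]; rfl
    obtain ⟨c, hc⟩ : ∃ c : X ⟶ (⟨X.base, C⟩ : Dill M), c = vh (M.rep g) := ⟨_, rfl⟩
    obtain ⟨v, hv⟩ : ∃ v : X ⟶ (⟨X.base, (reindex D (bs f)).obj Y.fam⟩ : Dill M),
      v = vh (M.rep (F)) := ⟨_, rfl⟩
    have hvf : v ≫ cart Y (bs (X := X) f) = f := by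
      rw [hv]
      exact hF
    have hcb : bs c = 𝟙 X.base := by rw [hc]; rfl
    have hvb : bs v = 𝟙 X.base := by rw [hv]; rfl
    obtain ⟨a, ha₁, ha₂, ha₃⟩ := H.exists_lift v c (by
      rw [hvb, hcb, hp']
      exact (Category.id_comp _).symm)
    obtain ⟨φ, hφ⟩ := exists_eq_vh a (ha₃.trans hcb)
    obtain ⟨β, hβ₁, hβ₂⟩ := BinaryFan.IsLimit.lift' hl
      (M.dillMk (coprod.inl ≫ M.unit ((reindex D (bs (X := X) f)).obj Y.fam ⨿ C)))
      (M.dillMk (coprod.inr ≫ M.unit ((reindex D (bs (X := X) f)).obj Y.fam ⨿ C)))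
    change β ≫ F = _ at hβ₁
    change β ≫ g = _ at hβ₂
    obtain ⟨b, hb⟩ : ∃ b : (⟨X.base, (reindex D (bs f)).obj Y.fam ⨿ C⟩ : Dill M) ⟶ X,
      b = vh (M.rep β) := ⟨_, rfl⟩
    have hb₁ : b ≫ v = p := by
      rw [hp, hb, hv]
      refine (vh_rep_comp _ _).symm.trans ?_
      rw [hβ₁]
      rfl
    have hb₂ : b ≫ c = q := by
      rw [hq, hb, hc]
      refine (vh_rep_comp _ _).symm.trans ?_
      rw [hβ₂]
      rfl
    have hba : b ≫ a = 𝟙 _ := H.hom_ext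
      (by rw [Category.assoc, ha₁, hb₁, Category.id_comp])
      (by rw [Category.assoc, ha₂, hb₂, Category.id_comp])
    -- Uniqueness for `hl` is available only in the fibre, so this equation is checked there and
    -- carried back to `Dill`.
    have hab : a ≫ b = 𝟙 _ := by
      have h₁ : M.dillMk φ ≫ β = 𝟙 _ := by
        have e₁ : vh (M.rep ((M.dillMk φ ≫ β) ≫ F)) = vh (M.rep (F)) := by
          rw [vh_rep_comp, vh_rep_comp, M.rep_dillMk, ← hφ, ← hb, ← hv]
          rw [Category.assoc, hb₁, ha₁]
        have e₂ : vh (M.rep ((M.dillMk φ ≫ β) ≫ g)) = vh (M.rep g) := by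
          rw [vh_rep_comp, vh_rep_comp, M.rep_dillMk, ← hφ, ← hb, ← hc]
          rw [Category.assoc, hb₂, ha₂]
        refine BinaryFan.IsLimit.hom_ext hl ?_ ?_
        · exact (fibre_hom_ext e₁).trans (Category.id_comp _).symm
        · exact (fibre_hom_ext e₂).trans (Category.id_comp _).symm
      have h₂ := vh_rep_comp (M.dillMk φ) β
      rw [h₁, M.rep_dillMk, ← hφ, ← hb] at h₂
      exact h₂.symm.trans (vh_unit _)
    refine ⟨c, ?_⟩
    have H' := H.comp_cart hp'
    have := H'.of_iso ⟨a, b, hab, hba⟩ (f' := f) (c' := c)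
      (by rw [← Category.assoc, ha₁, hvf]) ha₂ (ha₃.trans hcb)
    exact this
  · rintro ⟨c, H⟩
    obtain ⟨γ, hγ⟩ := exists_eq_vh c H.bs_eq
    obtain ⟨v, hv⟩ : ∃ v : X ⟶ (⟨X.base, (reindex D (bs f)).obj Y.fam⟩ : Dill M),
      v = vh (M.rep (F)) := ⟨_, rfl⟩
    have hvf : v ≫ cart Y (bs (X := X) f) = f := by
      rw [hv]
      exact hF
    have key (T : M.DillFibre X.base) (α : T ⟶ M.dillObj ((reindex D (bs (X := X) f)).obj Y.fam))
        (β : T ⟶ M.dillObj C) : ∃! l : T ⟶ M.dillObj X.fam, l ≫ F = α ∧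
          l ≫ M.dillMk γ = β := by
      rcases T with ⟨⟨P⟩⟩
      have comm (l : M.dillObj P ⟶ M.dillObj X.fam) : (l ≫ F = α ↔
          vh (M.rep l) ≫ f = vh (M.rep α) ≫ cart Y (bs (X := X) f)) := by
        have e : vh (M.rep (l ≫ F)) ≫ cart Y (bs (X := X) f) = vh (M.rep l) ≫ f := by
          rw [vh_rep_comp, ← hv, Category.assoc, hvf]
        rw [← e]
        refine ⟨fun h => by rw [h], fun h => fibre_hom_ext ((isCart_cart _ _).hom_ext rfl h)⟩
      have comm' (l : M.dillObj P ⟶ M.dillObj X.fam) : (l ≫ M.dillMk γ = β ↔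
          vh (M.rep l) ≫ c = vh (M.rep β)) := by
        have e : vh (M.rep (l ≫ M.dillMk γ)) = vh (M.rep l) ≫ c := by
          rw [vh_rep_comp, hγ]
          rfl
        rw [← e]
        exact ⟨fun h => by rw [h], fibre_hom_ext⟩
      obtain ⟨l, h₁, h₂, h₃⟩ := H.exists_lift (vh (M.rep α) ≫ cart Y (bs (X := X) f))
        (vh (M.rep β)) rfl
      obtain ⟨φ, rfl⟩ := exists_eq_vh l h₃
      refine ⟨M.dillMk φ, ⟨(comm _).2 h₁, (comm' _).2 h₂⟩, ?_⟩
      rintro m ⟨m₁, m₂⟩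
      exact fibre_hom_ext (H.hom_ext (((comm m).1 m₁).trans h₁.symm)
        (((comm' m).1 m₂).trans h₂.symm))
    exact ⟨M.dillMk γ, ⟨BinaryFan.isLimitMk (fun s => (key s.pt s.fst s.snd).choose)
      (fun s => (key s.pt s.fst s.snd).choose_spec.1.1)
      (fun s => (key s.pt s.fst s.snd).choose_spec.1.2)
      (fun s m h₁ h₂ => (key s.pt s.fst s.snd).choose_spec.2 m ⟨h₁, h₂⟩)⟩⟩

/-- Product projections of the fibres in terms of complements. -/
theorem isProductProjection_iff {X Y : Dill M} (f : X ⟶ Y) (C : Slice D X.base) :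
    IsProductProjection (Hom.vert f) (M.dillObj C) ↔
      ∃ c : X ⟶ (⟨X.base, C⟩ : Dill M), IsComplement f c :=
  isProductProjection_iff_of_eq f C (Hom.vert f) (vh_repr_comp_cart f)

end Dill

namespace Dill

variable {B : Type u} [Category.{v} B] {D : MorphismProperty B} {M : FibredMonad D}
variable [IsDisplayMapClass D]

/-! ### Classes of display maps of `Dill` -/

/-- The maps with base map in `S` and a complement in `Q`. -/
def disp (M : FibredMonad D) (S : MorphismProperty B) (Q : ∀ ⦃I : B⦄, Slice D I → Prop) :
    MorphismProperty (Dill M) := fun X _ f =>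
  S (bs f) ∧ ∃ C : Slice D X.base, Q C ∧ ∃ c : X ⟶ (⟨X.base, C⟩ : Dill M), IsComplement f c

theorem disp_mono {S S' : MorphismProperty B} {Q Q' : ∀ ⦃I : B⦄, Slice D I → Prop}
    (hS : S ≤ S') (hQ : ∀ ⦃I : B⦄ (X : Slice D I), Q X → Q' X) : disp M S Q ≤ disp M S' Q' := by
  rintro X Y f ⟨hf, C, hC, c, H⟩
  exact ⟨hS _ hf, C, hQ _ hC, c, H⟩

variable [HasFiniteSumTypes D] [HasSigmaTypes D]

theorem display_eq_disp : display M = disp M D (fun _ _ => True) := by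
  ext X Y f
  constructor
  · rintro ⟨hf, C, hC⟩
    rcases C with ⟨⟨C⟩⟩
    exact ⟨hf, C, trivial, (isProductProjection_iff f C).1 hC⟩
  · rintro ⟨hf, C, -, hC⟩
    exact ⟨hf, _, (isProductProjection_iff f C).2 hC⟩

theorem displayOf_eq_disp (S : MorphismProperty B) :
    displayOf M S = disp M S (fun _ X => S (proj X)) := by
  ext X Y f
  constructor
  · rintro ⟨hf, C, hC, h⟩
    exact ⟨hf, C, hC, (isProductProjection_iff f C).1 h⟩
  · rintro ⟨hf, C, hC, h⟩
    exact ⟨hf, C, hC, (isProductProjection_iff f C).2 h⟩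

/-- A class of families closed under finite sums and reindexing. -/
structure IsSumClass (Q : ∀ ⦃I : B⦄, Slice D I → Prop) : Prop where
  initial (I : B) : Q (⊥_ (Slice D I))
  coprod {I : B} {X Y : Slice D I} : Q X → Q Y → Q (X ⨿ Y)
  reindex {I J : B} (h : I ⟶ J) {X : Slice D J} : Q X → Q ((reindex D h).obj X)

variable {S : MorphismProperty B} {Q : ∀ ⦃I : B⦄, Slice D I → Prop}

/-- Base change of a map with a complement. -/
theorem IsComplement.exists_isPullback {X Y Z : Dill M} {C : Slice D X.base} {f : X ⟶ Y}
    {c : X ⟶ (⟨X.base, C⟩ : Dill M)} (H : IsComplement f c) (g : Z ⟶ Y) {P : B}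
    {a : P ⟶ X.base} {b : P ⟶ Z.base} (sq : IsPullback a b (bs f) (bs g)) :
    ∃ (X' : Slice D P) (α : (⟨P, X'⟩ : Dill M) ⟶ X) (f' : (⟨P, X'⟩ : Dill M) ⟶ Z)
      (c' : (⟨P, X'⟩ : Dill M) ⟶ ⟨P, (reindex D a).obj C⟩), bs α = a ∧ bs f' = b ∧
      IsPullback α f' f g ∧ IsComplement f' c' := by
  -- The pullback is the family `b^* Z + a^* C`; its map to `X` has components `f' ≫ g` and the
  -- cartesian map `a^* C ⟶ C` after `c'`.
  obtain ⟨f', c', hf', H'⟩ := exists_isComplement Z b ((reindex D a).obj C)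
  have hcb : bs (cart (⟨X.base, C⟩ : Dill M) a) = a := rfl
  have hb : bs (c' ≫ cart (⟨X.base, C⟩ : Dill M) a) = a := by
    rw [bs_comp, H'.bs_eq]
    exact Category.id_comp _
  obtain ⟨α, h₁, h₂, h₃⟩ := H.exists_lift (f' ≫ g) (c' ≫ cart (⟨X.base, C⟩ : Dill M) a) (by
    rw [hb, bs_comp, hf']
    exact sq.w.symm)
  have hα : bs α = a := h₃.trans hb
  refine ⟨_, α, f', c', hα, hf', ?_, H'⟩
  refine H'.isPullback H h₁ h₂ ?_ (isCart_cart _ _)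
  rw [hα, hf']
  exact sq

/-- Identities have the initial family as complement. An arbitrary pullback square of `Dill` lies
over one of `B`, by additivity, so its complement is the reindexed one. -/
theorem isDisplayMapClass_disp (hM : ∀ I : B, IsAdditiveMonad (M.fibre I)) (hQ : IsSumClass Q)
    [IsDisplayMapClass S] : IsDisplayMapClass (disp M S Q) where
  id_mem X := by
    obtain ⟨c, hc, -⟩ := existsUnique_to_zero X (𝟙 X.base)
    refine ⟨S.id_mem X.base, _, hQ.initial X.base, c, hc, fun Z a b e => ?_⟩
    refine ⟨a, ⟨Category.comp_id _, ?_⟩, fun m hm => by rw [← hm.1, Category.comp_id]⟩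
    refine (existsUnique_to_zero Z (bs a)).unique ?_ ?_
    · rw [bs_comp, hc]
      exact Category.comp_id _
    · exact ((Category.comp_id _).symm.trans e.symm)
  hasPullback {X Y Z f} g hf := by
    obtain ⟨hf, C, -, c, H⟩ := hf
    obtain ⟨P, a, b, sq, -⟩ := exists_isPullback_right hf (bs g)
    obtain ⟨_, _, _, _, -, -, h, -⟩ := H.exists_isPullback g sq
    exact h.hasPullback
  of_isPullback {X Y Y' Z β f α f'} sq hf := by
    obtain ⟨hf, C, hC, c, H⟩ := hf
    have sb := isPullback_bs hM sq
    obtain ⟨c', h₁, h₂⟩ := (isCart_cart (⟨Y.base, C⟩ : Dill M) (bs (Y := Y) α)).exists_lift (α ≫ c)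
      (𝟙 Y'.base) (by
        rw [bs_comp, H.bs_eq]
        exact (Category.id_comp _).trans (Category.comp_id _).symm)
    exact ⟨S.of_isPullback sb hf, _, hQ.reindex (bs α) hC, c',
      H.of_isPullback sq sb h₁ (isCart_cart _ _) rfl h₂⟩

/-- A map to `X` is a map to `Z` with components in `E` and `C`. After `E` is reindexed along `f` to
the base of `X`, the two components combine into one map to the coproduct. -/
theorem IsComplement.exists_comp {X Y Z : Dill M} {C : Slice D X.base} {E : Slice D Y.base}
    {f : X ⟶ Y} {c : X ⟶ (⟨X.base, C⟩ : Dill M)} {g : Y ⟶ Z} {e : Y ⟶ (⟨Y.base, E⟩ : Dill M)}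
    (H : IsComplement f c) (H' : IsComplement g e) :
    ∃ d : X ⟶ (⟨X.base, C ⨿ (reindex D (bs f)).obj E⟩ : Dill M), IsComplement (f ≫ g) d := by
  obtain ⟨p, q, hp, hq, H₀⟩ :=
    exists_isComplement_coprod (M := M) C ((reindex D (bs (X := X) f)).obj E)
  have hp' : bs p = 𝟙 X.base := by rw [hp]; rfl
  obtain ⟨γ, hγb, hγ⟩ : ∃ γ : (⟨X.base, (reindex D (bs (X := X) (Y := Y) f)).obj E⟩ : Dill M) ⟶
      ⟨Y.base, E⟩, bs γ = bs (X := X) (Y := Y) f ∧ IsCart γ := ⟨cart ⟨Y.base, E⟩ _, rfl, isCart_cart _ _⟩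
  obtain ⟨e', he', he⟩ := hγ.exists_lift (f ≫ e) (𝟙 X.base) (by
    rw [bs_comp, H'.bs_eq, hγb]
    exact (Category.id_comp _).trans (Category.comp_id _).symm)
  obtain ⟨d, hd₁, hd₂, hd₃⟩ := H₀.exists_lift c e' (by
    rw [H.bs_eq, he', hp']
    exact (Category.comp_id _).symm)
  refine ⟨d, hd₃.trans he', fun W a b w => ?_⟩
  obtain ⟨y, hy₁, hy₂, hy₃⟩ := H'.exists_lift a (b ≫ q ≫ γ) (by
    rw [w, bs_comp, bs_comp, bs_comp, H₀.bs_eq, Category.assoc, hγb, Category.assoc]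
    exact congrArg (fun t => bs b ≫ t) (Category.id_comp _).symm)
  obtain ⟨x, hx₁, hx₂, hx₃⟩ := H.exists_lift y (b ≫ p) (by
    rw [hy₃, bs_comp, bs_comp, bs_comp, H₀.bs_eq, hp', Category.assoc, hγb])
  refine ⟨x, ⟨by rw [reassoc_of% hx₁, hy₁], H₀.hom_ext ?_ (hγ.hom_ext ?_ ?_)⟩, ?_⟩
  · rw [Category.assoc, hd₁, hx₂]
  · rw [bs_comp, bs_comp, bs_comp, hx₃, hd₃, he', bs_comp, hp', H₀.bs_eq]
    exact congrArg (fun t => t ≫ 𝟙 X.base) ((Category.comp_id _).trans (Category.comp_id _))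
  · rw [Category.assoc, Category.assoc, reassoc_of% hd₂, he, reassoc_of% hx₁, hy₂, Category.assoc]
  · rintro m ⟨h₁, h₂⟩
    refine H.hom_ext (H'.hom_ext ?_ ?_) ?_
    · rw [Category.assoc, h₁, hx₁, hy₁]
    · rw [hx₁, hy₂, ← h₂, Category.assoc, Category.assoc, reassoc_of% hd₂, he]
    · rw [hx₂, ← h₂, Category.assoc, hd₁]

theorem hasSigmaTypes_disp (hQ : IsSumClass Q) [HasSigmaTypes S] : HasSigmaTypes (disp M S Q) where
  comp_mem {X Y Z} f g hf hg := by
    obtain ⟨hf, C, hC, c, H⟩ := hf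
    obtain ⟨hg, E, hE, e, H'⟩ := hg
    obtain ⟨d, hd⟩ := H.exists_comp H'
    exact ⟨S.comp_mem _ _ hf hg, _, hQ.coprod hC (hQ.reindex _ hE), d, hd⟩


/-- The zero object over `1` is terminal, and every `X` is its own complement over it. -/
theorem isWellRooted_disp (hD : IsWellRooted D) [IsDisplayMapClass (disp M D Q)]
    (hQ : ∀ ⦃I : B⦄ (X : Slice D I), Q X) : IsWellRooted (disp M D Q) := by
  obtain ⟨hT, hD⟩ := hD
  let T := zero M (⊤_ B)
  have hu (X : Dill M) : ∃! f : X ⟶ T, bs f = terminal.from X.base :=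
    existsUnique_to_zero X (terminal.from X.base)
  have key (X : Dill M) (f : X ⟶ T) : disp M D Q f := by
    have e : bs f = terminal.from X.base := terminal.hom_ext _ _
    refine ⟨?_, X.fam, hQ _, 𝟙 X, bs_id X, fun Z a b w => ?_⟩
    · rw [e]
      exact hD X.base
    · refine ⟨b, ⟨?_, Category.comp_id _⟩, fun m hm => by rw [← hm.2, Category.comp_id]⟩
      exact (hu Z).unique (terminal.hom_ext _ _) (terminal.hom_ext _ _)
  have t : IsTerminal T := IsTerminal.ofUniqueHom (fun X => (hu X).choose)
    (fun X m => (hu X).choose_spec.2 m (terminal.hom_ext _ _))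
  refine ⟨t.hasTerminal, fun X => ?_⟩
  have := t.hasTerminal
  have e : terminal.from X = t.from X ≫ (t.uniqueUpToIso terminalIsTerminal).hom :=
    terminal.hom_ext _ _
  rw [e]
  exact (MorphismProperty.cancel_right_of_respectsIso (disp M D Q) _ _).2 (key X _)

end Dill

namespace Dill

variable {B : Type u} [Category.{v} B] {D : MorphismProperty B} {M : FibredMonad D}
variable [IsDisplayMapClass D]

/-! ### Left maps of `Dill` -/

/-- The map `t` is represented by a map `h^* V ⟶ M (h^* Y)`, hence by one to `M Y` over `h`. It must
be extended along `h^* V ⟶ V`, which is a pullback of the left map `h` along a display map and so is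
left by `Π`-types; the extension is a lift against `M Y ⟶ Y.base`. -/
theorem exists_extension_cart (hpi : HasPiTypes D) {Y : Dill M} {J : B} {h : J ⟶ Y.base}
    (hh : LeftMap D h) {V : Slice D Y.base}
    (t : (⟨J, (reindex D h).obj Y.fam⟩ : Dill M) ⟶ ⟨Y.base, V⟩) (ht : bs t = h) :
    ∃ t' : Y ⟶ (⟨Y.base, V⟩ : Dill M), bs t' = 𝟙 Y.base ∧ cart Y h ≫ t' = t := by
  have sV := FibredMonad.isPullback_pr h V
  have sM := M.isPullback_map_pr h Y.fam
  have hp : LeftMap D (FibredMonad.pr h V) := hh.of_isPullback hpi V.prop sV.flip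
  obtain ⟨τ, hτ⟩ : ∃ τ, τ = elt t ht (proj _) (FibredMonad.pr h V) sV.w.symm := ⟨_, rfl⟩
  have hτ' : τ ≫ proj (M.obj ((reindex D h).obj Y.fam)) = proj ((reindex D h).obj V) := by
    rw [hτ]
    exact elt_mpj t ht _ _ _
  obtain ⟨φ₀, h₁, h₂⟩ := hp.exists_lift (M.obj Y.fam).prop
    (τ ≫ M.map h (FibredMonad.pr h Y.fam) (FibredMonad.isPullback_pr h Y.fam).w) (proj V) (by
      refine (Category.assoc _ _ _).trans ((congrArg (fun s => τ ≫ s) sM.w).trans ?_)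
      rw [← Category.assoc, hτ', sV.w])
  let φ : V ⟶ M.obj Y.fam := MorphismProperty.Over.homMk φ₀ h₁
  have hb : bs (cart Y h ≫ vh φ) = h := by
    rw [bs_comp, bs_vh]
    exact Category.comp_id _
  refine ⟨vh φ, bs_vh φ, hom_ext_univ hb ht sV ?_⟩
  rw [← hτ]
  have w₁ : (proj ((reindex D h).obj V) ≫ h) ≫ 𝟙 Y.base = FibredMonad.pr h V ≫ proj V := by
    rw [Category.comp_id, sV.w]
  refine (elt_comp (cart Y h) (bs_cart Y h) (vh φ) (bs_vh φ) hb _ _ _ w₁).trans ?_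
  refine sM.hom_ext ?_ ?_
  · have e := act_cartSq (X := ⟨J, (reindex D h).obj Y.fam⟩) h (FibredMonad.pr h Y.fam)
      (FibredMonad.isPullback_pr h Y.fam) (bs_cart Y h) (proj ((reindex D h).obj V))
      (elt (vh φ) (bs_vh φ) (proj ((reindex D h).obj V) ≫ h) (FibredMonad.pr h V) w₁)
      (elt_mpj _ _ _ _ _).symm
    have e' : elt (vh φ) (bs_vh φ) (proj ((reindex D h).obj V) ≫ h) (FibredMonad.pr h V) w₁ =
        FibredMonad.pr h V ≫ φ₀ := elt_vh φ _ _ _ _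
    exact e.trans (e'.trans h₂)
  · exact (act_mpj _ _ _ _ _).trans hτ'.symm

/-- Vertical maps extend along a cartesian map over a left map. -/
theorem IsCart.exists_extension (hpi : HasPiTypes D) {X Y : Dill M} {n : X ⟶ Y} (hn : IsCart n)
    (hl : LeftMap D (bs n)) {V : Slice D Y.base} (t : X ⟶ (⟨Y.base, V⟩ : Dill M))
    (ht : bs t = bs n) : ∃ t' : Y ⟶ (⟨Y.base, V⟩ : Dill M), bs t' = 𝟙 Y.base ∧ n ≫ t' = t := by
  obtain ⟨i, hi, hi'⟩ := hn.exists_iso (isCart_cart Y (bs n)) (Iso.refl _) (Category.id_comp _)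
  obtain ⟨t', h₁, h₂⟩ := exists_extension_cart hpi hl (i.inv ≫ t) (by
    have e : bs i.hom ≫ bs i.inv = 𝟙 _ := congrArg bs i.hom_inv_id
    rw [hi] at e
    rw [bs_comp, ht]
    exact (congrArg (fun s => s ≫ bs n) ((Category.id_comp _).symm.trans e)).trans
      (Category.id_comp _))
  refine ⟨t', h₁, ?_⟩
  rw [← hi', Category.assoc, h₂, Iso.hom_inv_id_assoc]

/-- The maps into a family over `A` which, on complements, are cartesian over a left map. -/
def IsAnodyne {X Y A : Dill M} (n : X ⟶ Y) (b : Y ⟶ A) : Prop :=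
  LeftMap D (bs n) ∧ ∃ (G : Slice D X.base) (C : Slice D Y.base)
    (x : X ⟶ (⟨X.base, G⟩ : Dill M)) (c : Y ⟶ (⟨Y.base, C⟩ : Dill M))
    (n₀ : (⟨X.base, G⟩ : Dill M) ⟶ ⟨Y.base, C⟩), IsComplement (n ≫ b) x ∧ bs c = 𝟙 Y.base ∧
      IsCart n₀ ∧ bs n₀ = bs (X := X) (Y := Y) n ∧ n ≫ c = x ≫ n₀

variable [HasFiniteSumTypes D] [HasSigmaTypes D]

/-- A lift into `E` consists of a lift of base maps and a component in the complement `V` of `e`.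
The first exists since the base of `n` is left, the second by extension along a cartesian map. -/
theorem IsAnodyne.leftMap (hpi : HasPiTypes D) {X Y A : Dill M} {n : X ⟶ Y} {b : Y ⟶ A}
    (H : IsAnodyne n b) : LeftMap (display M) n := by
  obtain ⟨hn, G, C, x, c, n₀, Hx, hc, hn₀, hn₀', w⟩ := H
  intro E e he s hs
  rw [display_eq_disp] at he
  obtain ⟨he, V, -, v, Hv⟩ := he
  obtain ⟨t₀, ht₀, ht₀'⟩ := hn (bs e) he (bs s) (congrArg bs hs)
  obtain ⟨κ, hκb, hκ⟩ : ∃ κ : (⟨Y.base, (reindex D t₀).obj V⟩ : Dill M) ⟶ ⟨E.base, V⟩,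
      bs κ = t₀ ∧ IsCart κ := ⟨cart ⟨E.base, V⟩ t₀, rfl, isCart_cart _ _⟩
  obtain ⟨σ, hσ, hσ'⟩ := hκ.exists_lift (s ≫ v) (bs (X := X) (Y := Y) n) (by
    rw [hκb, bs_comp, Hv.bs_eq]
    exact ht₀'.trans (Category.comp_id _).symm)
  -- Neither `n` nor `Y` need have a good form, but the map `y` from `Y` to the family `b^* A + C`
  -- makes `n ≫ y` cartesian, which is enough for the extension.
  obtain ⟨f, c', hf, Hf⟩ := exists_isComplement A (bs b) C
  obtain ⟨y, hy₁, hy₂, hy₃⟩ := Hf.exists_lift b c (by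
    rw [hc, hf]
    exact (Category.id_comp _).symm)
  have hyb : bs y = 𝟙 Y.base := hy₃.trans hc
  have hnyb : bs (n ≫ y) = bs n := by
    rw [bs_comp, hyb]
    exact Category.comp_id _
  have hny : IsCart (n ≫ y) := by
    intro Z g k hk
    rw [hnyb] at hk
    obtain ⟨l₀, hl₀, hl₀'⟩ := hn₀.exists_lift (g ≫ c') k (by
      rw [hn₀', bs_comp, Hf.bs_eq]
      exact hk.trans (Category.comp_id _).symm)
    obtain ⟨l, hl₁, hl₂, hl₃⟩ := Hx.exists_lift (g ≫ f) l₀ (by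
      rw [hl₀, bs_comp, bs_comp, hf, ← Category.assoc]
      exact congrArg (fun t => t ≫ bs b) hk.symm)
    refine ⟨l, ⟨hl₃.trans hl₀, Hf.hom_ext ?_ ?_⟩, ?_⟩
    · rw [Category.assoc, Category.assoc, hy₁, hl₁]
    · rw [Category.assoc, Category.assoc, hy₂, w, reassoc_of% hl₂, hl₀']
    · rintro m ⟨hm₁, hm₂⟩
      refine Hx.hom_ext ?_ (hn₀.hom_ext ?_ ?_)
      · rw [hl₁, ← hm₂, Category.assoc, Category.assoc, hy₁]
      · rw [bs_comp, bs_comp, hm₁, hl₃, hl₀]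
      · rw [hl₂, hl₀', ← hm₂, Category.assoc, Category.assoc, Category.assoc, hy₂, w]
  obtain ⟨τ, hτ, hτ'⟩ := hny.exists_extension hpi (by rw [hnyb]; exact hn) σ
    (hσ.trans hnyb.symm)
  have hb : bs (y ≫ τ ≫ κ) = t₀ := by
    rw [bs_comp, bs_comp, hyb, hτ, hκb]
    exact (Category.id_comp _).trans (Category.id_comp _)
  -- The `Y`-component is the identity, so `t` is a section of `e`; its `V`-component is the
  -- extension `τ` of that of `s`.
  obtain ⟨t, h₁, h₂, h₃⟩ := Hv.exists_lift (𝟙 Y) (y ≫ τ ≫ κ) (by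
    rw [hb]
    exact ht₀.symm)
  refine ⟨t, h₁, Hv.hom_ext ?_ ?_⟩
  · rw [Category.assoc, h₁, hs, Category.comp_id]
  · rw [Category.assoc, h₂, ← hσ', ← hτ']
    simp only [Category.assoc]

/-- On bases both squares are pullbacks by additivity, so stability of left maps in `B` applies. On
families all the data are reindexed, and the new map of complements is cartesian by cancellation. -/
theorem IsAnodyne.of_isPullback (hM : ∀ I : B, IsAdditiveMonad (M.fibre I))
    (hid : HasStableLeftClasses D) {X Y A X' Y' A' : Dill M} {n : X ⟶ Y} {b : Y ⟶ A}
    (H : IsAnodyne n b) {α : X' ⟶ X} {β : Y' ⟶ Y} {h : A' ⟶ A} {x' : X' ⟶ A'} {b' : Y' ⟶ A'}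
    (hx : D (bs (n ≫ b))) (hb : D (bs b)) (sx : IsPullback α x' (n ≫ b) h)
    (sy : IsPullback β b' b h) {n' : X' ⟶ Y'} (w₁ : n' ≫ b' = x') (w₂ : n' ≫ β = α ≫ n) :
    IsAnodyne n' b' := by
  obtain ⟨hn, G, C, x, c, n₀, Hx, hc, hn₀, hn₀', w⟩ := H
  have sxb := isPullback_bs hM sx
  have syb := isPullback_bs hM sy
  refine ⟨hid.leftMap (bs h) hx hb sxb syb hn rfl (congrArg bs w₁) (congrArg bs w₂), ?_⟩
  obtain ⟨γ, hγb, hγ⟩ : ∃ γ : (⟨X'.base, (reindex D (bs (X := X') (Y := X) α)).obj G⟩ : Dill M) ⟶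
      ⟨X.base, G⟩, bs γ = bs (X := X') (Y := X) α ∧ IsCart γ :=
    ⟨cart ⟨X.base, G⟩ _, rfl, isCart_cart _ _⟩
  obtain ⟨δ, hδb, hδ⟩ : ∃ δ : (⟨Y'.base, (reindex D (bs (X := Y') (Y := Y) β)).obj C⟩ : Dill M) ⟶
      ⟨Y.base, C⟩, bs δ = bs (X := Y') (Y := Y) β ∧ IsCart δ :=
    ⟨cart ⟨Y.base, C⟩ _, rfl, isCart_cart _ _⟩
  obtain ⟨y, hy, hy'⟩ := hγ.exists_lift (α ≫ x) (𝟙 X'.base) (by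
    rw [hγb, bs_comp, Hx.bs_eq]
    exact (Category.id_comp _).trans (Category.comp_id _).symm)
  obtain ⟨c', hc', hc''⟩ := hδ.exists_lift (β ≫ c) (𝟙 Y'.base) (by
    rw [hδb, bs_comp, hc]
    exact (Category.id_comp _).trans (Category.comp_id _).symm)
  obtain ⟨m₀, hm₀, hm₀'⟩ := hδ.exists_lift (γ ≫ n₀) (bs (X := X') (Y := Y') n') (by
    rw [hδb, bs_comp, hγb, hn₀']
    exact congrArg bs w₂)
  subst w₁
  refine ⟨_, _, y, c', m₀, Hx.of_isPullback sx sxb hy hγ hγb hy', hc', ?_, hm₀,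
    hδ.hom_ext ?_ ?_⟩
  · refine hδ.of_comp ?_
    rw [hm₀']
    exact hγ.comp hn₀
  · rw [bs_comp, bs_comp, hc', hm₀, hy]
    exact (Category.comp_id _).trans (Category.id_comp _).symm
  · rw [Category.assoc, Category.assoc, hc'', hm₀', reassoc_of% w₂, w, reassoc_of% hy']

/-- A factorization of a base map lifts to a factorization of a map of families. -/
theorem exists_isAnodyne {X Y A : Dill M} {x : X ⟶ A} {y : Y ⟶ A} {G : Slice D X.base}
    {g : X ⟶ (⟨X.base, G⟩ : Dill M)} (H : IsComplement x g) (hx : D (bs x)) {m : X ⟶ Y}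
    (w : m ≫ y = x) {R : B} {r : X.base ⟶ R} {p : R ⟶ Y.base} (hr : LeftMap D r)
    (e : r ≫ p = bs m) :
    ∃ (ρ : R ⟶ X.base) (Z : Slice D R) (n : X ⟶ ⟨R, Z⟩) (d : ⟨R, Z⟩ ⟶ Y)
      (c : (⟨R, Z⟩ : Dill M) ⟶ ⟨R, (reindex D ρ).obj G⟩), bs d = p ∧ n ≫ d = m ∧
      IsAnodyne n (d ≫ y) ∧ IsComplement d c := by
  -- Lifting the left map `r` against the display map `bs x` produces a retraction of `r`, along
  -- which `G` can be transported to `R`.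
  obtain ⟨ρ, hρ, hρ'⟩ := hr.exists_lift hx (𝟙 X.base) (p ≫ bs y) (by
    rw [reassoc_of% e, Category.id_comp, ← w]
    rfl)
  obtain ⟨d, c, hd, Hd⟩ := exists_isComplement Y p ((reindex D ρ).obj G)
  obtain ⟨γ, hγb, hγ⟩ : ∃ γ : (⟨R, (reindex D ρ).obj G⟩ : Dill M) ⟶
      ⟨X.base, G⟩, bs γ = ρ ∧ IsCart γ := ⟨cart ⟨X.base, G⟩ _, rfl, isCart_cart _ _⟩
  -- Since `r ≫ ρ = 𝟙`, the identity of `G` factors through `ρ^* G`; the factor `n₀` over `r` is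
  -- cartesian by cancellation.
  obtain ⟨n₀, hn₀, hn₀'⟩ := hγ.exists_lift (𝟙 _) r (by rw [hγb, hρ']; rfl)
  have hb : bs (g ≫ n₀) = r := by
    rw [bs_comp, H.bs_eq, hn₀]
    exact Category.id_comp _
  obtain ⟨n, hn₁, hn₂, hn₃⟩ := Hd.exists_lift m (g ≫ n₀) (by rw [hb, hd, e])
  refine ⟨ρ, _, n, d, c, hd, hn₁, ⟨?_, G, _, g, c, n₀, ?_, Hd.bs_eq, ?_, ?_, hn₂⟩, Hd⟩
  · rw [hn₃, hb]
    exact hr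
  · rw [reassoc_of% hn₁, w]
    exact H
  · refine hγ.of_comp ?_
    rw [hn₀']
    exact fun Z u k hk => ⟨u, ⟨hk.symm.trans (Category.comp_id _), Category.comp_id _⟩,
      fun m hm => by rw [← hm.2, Category.comp_id]⟩
  · rw [hn₀]
    exact (hn₃.trans hb).symm

theorem hasIdentityTypes_display (hM : ∀ I : B, IsAdditiveMonad (M.fibre I)) (hpi : HasPiTypes D)
    (hid : HasIdentityTypes D) [IsDisplayMapClass (display M)] [HasSigmaTypes (display M)] :
    HasIdentityTypes (display M) := by
  have key {J X Y : Dill M} {x : X ⟶ J} {y : Y ⟶ J} (hx : display M x) (hy : display M y)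
      (m : X ⟶ Y) (w : m ≫ y = x) : ∃ (R : Dill M) (n : X ⟶ R) (d : R ⟶ Y), display M d ∧
        n ≫ d = m ∧ IsAnodyne n (d ≫ y) := by
    rw [display_eq_disp] at hx hy ⊢
    obtain ⟨hx, G, -, g, H⟩ := hx
    obtain ⟨hy, -⟩ := hy
    obtain ⟨R, r, p, hr, hp, e⟩ := hid.exists_factorization hx hy (bs m) (congrArg bs w)
    obtain ⟨ρ, Z, n, d, c, hd, hnd, hn, Hd⟩ := exists_isAnodyne H hx w hr e
    exact ⟨_, n, d, ⟨by rw [hd]; exact hp, _, trivial, c, Hd⟩, hnd, hn⟩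
  refine ⟨hasStableLeftClasses_of_exists ?_, hasFactorization_of_exists ?_⟩
  · intro J X Y x y hx hy m w
    obtain ⟨R, n, d, hd, e, hn⟩ := key hx hy m w
    refine ⟨R, n, d, hd, e, fun {I X' R'} h {x' z' a b} sx sz n' w₁ w₂ => ?_⟩
    have e' : n ≫ d ≫ y = x := by rw [reassoc_of% e, w]
    subst e'
    exact (hn.of_isPullback hM hid.1 hx.1 ((display M).comp_mem _ _ hd hy).1 sx sz w₁
      w₂).leftMap hpi
  · intro I X Y x y hx hy m w
    obtain ⟨R, n, d, hd, e, hn⟩ := key hx hy m w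
    exact ⟨R, n, d, hn.leftMap hpi, hd, e⟩

end Dill

namespace Dill

variable {B : Type u} [Category.{v} B] {D : MorphismProperty B} {M : FibredMonad D}
variable [IsDisplayMapClass D]

/-! ### Representability of vertical data -/

theorem cartSq_comp_cartSq {X Y Z : Dill M} {h : X.base ⟶ Y.base} {k : X.el ⟶ Y.el}
    (sq : IsPullback k X.pj Y.pj h) {h' : Y.base ⟶ Z.base} {k' : Y.el ⟶ Z.el}
    (sq' : IsPullback k' Y.pj Z.pj h') :
    cartSq h k sq ≫ cartSq h' k' sq' = cartSq (h ≫ h') (k ≫ k') (sq.paste_horiz sq') := by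
  have s := sq.paste_horiz sq'
  have w : X.pj ≫ h = k ≫ Y.pj := sq.w.symm
  refine hom_ext_univ (h := h ≫ h') rfl rfl s ?_
  have e₁ := elt_comp_cartSq h' k' sq' (cartSq h k sq) (bs_cartSq h k sq) (l' := h ≫ h') rfl
    X.pj k (k ≫ k') rfl w s.w.symm
  refine e₁.trans ((elt_cartSq h k sq _ _ _ _ sq.w).trans
    (Eq.trans ?_ (elt_cartSq (h ≫ h') (k ≫ k') s _ _ _ _ s.w).symm))
  refine congrArg (fun t => t ≫ X.eta) (s.hom_ext ?_ ?_)
  · rw [s.lift_fst, sq.lift_fst_assoc]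
  · rw [s.lift_snd, sq.lift_snd]

/-- Generalised elements of `M (h^* Y)` are determined by their images in the base and in `M Y`. -/
theorem reindex_mel_hom_ext {J : B} {Y : Dill M} (h : J ⟶ Y.base) {W : B}
    {s t : W ⟶ (M.obj ((reindex D h).obj Y.fam)).left}
    (e : s ≫ proj (M.obj ((reindex D h).obj Y.fam)) = t ≫ proj (M.obj ((reindex D h).obj Y.fam)))
    (e' : s ≫ M.map h (FibredMonad.pr h Y.fam) (FibredMonad.isPullback_pr h Y.fam).w =
      t ≫ M.map h (FibredMonad.pr h Y.fam) (FibredMonad.isPullback_pr h Y.fam).w) : s = t :=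
  (M.isPullback_map_pr h Y.fam).hom_ext e' e

/-- Maps into `Q = Σ_q (r^* Z)` over a base map `k` correspond to maps to `Z` out of a
reindexing. -/
theorem exists_sigma {J I : B} {q : J ⟶ I} (Z : Dill M) (r : J ⟶ Z.base) (Q : Slice D I)
    {θ : Q.left ⟶ J} (hθ : θ ≫ q = proj Q) {pz : Q.left ⟶ Z.el} (sZ : IsPullback pz θ Z.pj r) :
    ∃ κ : (⟨J, (reindex D q).obj Q⟩ : Dill M) ⟶ Z, bs κ = r ∧
      ∀ (L : Dill M) (k : L.base ⟶ I) ⦃W : B⦄ (q' : W ⟶ L.base) (j : W ⟶ J),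
        IsPullback q' j k q → ∀ t : (⟨W, (reindex D q').obj L.fam⟩ : Dill M) ⟶ Z, bs t = j ≫ r →
          ∃! s : L ⟶ (⟨I, Q⟩ : Dill M), bs s = k ∧
            ∀ m : (⟨W, (reindex D q').obj L.fam⟩ : Dill M) ⟶ ⟨J, (reindex D q).obj Q⟩, bs m = j →
              m ≫ cart ⟨I, Q⟩ q = cart L q' ≫ s → m ≫ κ = t := by
  have hDθ : D θ := MorphismProperty.of_isPullback sZ Z.fam.prop
  have sQ := FibredMonad.isPullback_pr q Q
  -- The unit of `Σ_q ⊣ q^*` at `r^* Z`; followed by the unit of `M` it represents `κ`.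
  obtain ⟨δ, δ₁, δ₂⟩ : ∃ δ : Q.left ⟶ ((reindex D q).obj Q).left,
      δ ≫ FibredMonad.pr q Q = 𝟙 _ ∧ δ ≫ proj ((reindex D q).obj Q) = θ :=
    ⟨sQ.lift (𝟙 _) θ ((Category.id_comp _).trans hθ.symm), sQ.lift_fst _ _ _, sQ.lift_snd _ _ _⟩
  let V : Slice D J := MorphismProperty.Over.mk ⊤ θ hDθ
  let φ : V ⟶ M.obj ((reindex D q).obj Q) :=
    MorphismProperty.Over.homMk (δ ≫ (M.unit ((reindex D q).obj Q)).left)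
      ((Category.assoc _ _ _).trans
        ((congrArg (fun s => δ ≫ s) (left_proj (M.unit ((reindex D q).obj Q)))).trans δ₂))
  obtain ⟨κ, hκ⟩ : ∃ κ : (⟨J, (reindex D q).obj Q⟩ : Dill M) ⟶ Z,
    κ = mkHom (X := ⟨J, (reindex D q).obj Q⟩) r (V := V) sZ φ := ⟨_, rfl⟩
  have hκb : bs κ = r := by rw [hκ]; rfl
  have hκe {W : B} (a : W ⟶ J) (z : W ⟶ Z.el) (w : a ≫ r = z ≫ Z.pj) (y : W ⟶ Q.left)
      (hy₁ : y ≫ pz = z) (hy₂ : y ≫ θ = a) :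
      elt κ hκb a z w = (y ≫ δ) ≫ (M.unit ((reindex D q).obj Q)).left := by
    subst hκ
    refine (elt_mkHom (X := ⟨J, (reindex D q).obj Q⟩) r sZ φ hκb a z w w.symm).trans ?_
    have : sZ.lift z a w.symm = y :=
      sZ.hom_ext ((sZ.lift_fst _ _ _).trans hy₁.symm) ((sZ.lift_snd _ _ _).trans hy₂.symm)
    exact (congrArg (fun s => s ≫ φ.left) this).trans (Category.assoc _ _ _).symm
  refine ⟨κ, hκb, fun L k W q' j sq t ht => ?_⟩
  obtain ⟨T, pT, πT, sT⟩ : ∃ (T : B) (pT : T ⟶ Z.el) (πT : T ⟶ W),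
      IsPullback pT πT Z.pj (j ≫ r) := ⟨_, _, _, FibredMonad.isPullback_pr (j ≫ r) Z.fam⟩
  obtain ⟨v, v₁, v₂⟩ : ∃ v : T ⟶ Q.left, v ≫ pz = pT ∧ v ≫ θ = πT ≫ j :=
    ⟨sZ.lift pT (πT ≫ j) (by rw [sT.w, Category.assoc]), sZ.lift_fst _ _ _, sZ.lift_snd _ _ _⟩
  have sv : IsPullback v πT θ j := IsPullback.of_right (by rw [v₁]; exact sT) v₂ sZ
  -- Beck–Chevalley: the reindexing of `Σ_q (r^* Z)` along `k` is `Σ_{q'}` of `T`, the pullback of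
  -- `Z` to `W`.
  have sV : IsPullback v (πT ≫ q') (proj Q) k := by
    rw [← hθ]
    exact sv.paste_vert sq.flip
  obtain ⟨τ, hτ⟩ : ∃ τ, τ = elt t ht πT pT sT.w.symm := ⟨_, rfl⟩
  have hτ' : τ ≫ proj (M.obj ((reindex D q').obj L.fam)) = πT := by
    rw [hτ]
    exact elt_mpj t ht _ _ _
  have sL := M.isPullback_map_pr q' L.fam
  -- As `M` preserves pullbacks, the representative `T ⟶ M (q'^* L)` of `t` amounts to a map `T ⟶ M
  -- L` over `q'`, which is what a map `L ⟶ Q` over `k` requires.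
  obtain ⟨ψ₀, hψ₀⟩ : ∃ ψ₀ : T ⟶ (M.obj L.fam).left, ψ₀ = τ ≫ M.map q' (FibredMonad.pr q' L.fam)
      (FibredMonad.isPullback_pr q' L.fam).w := ⟨_, rfl⟩
  have hψ₀' : ψ₀ ≫ proj (M.obj L.fam) = πT ≫ q' := by
    rw [hψ₀, Category.assoc, sL.w, reassoc_of% hτ']
  have key (s : L ⟶ (⟨I, Q⟩ : Dill M)) (hs : bs s = k)
      (m : (⟨W, (reindex D q').obj L.fam⟩ : Dill M) ⟶ ⟨J, (reindex D q).obj Q⟩) (hm : bs m = j)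
      (w : m ≫ cart ⟨I, Q⟩ q = cart L q' ≫ s) :
      m ≫ κ = t ↔ elt s hs (πT ≫ q') v sV.w.symm = ψ₀ := by
    have hmκ : bs (m ≫ κ) = j ≫ r := by rw [bs_comp, hm, hκb]
    have wδ : πT ≫ j = (v ≫ δ) ≫ proj ((reindex D q).obj Q) := by rw [Category.assoc, δ₂, v₂]
    have w₁ : (πT ≫ j) ≫ r = pT ≫ Z.pj := by rw [Category.assoc, sT.w]
    have e₁ : elt (m ≫ κ) hmκ πT pT sT.w.symm = elt m hm πT (v ≫ δ) wδ := by
      have wη : πT ≫ j = ((v ≫ δ) ≫ (M.unit ((reindex D q).obj Q)).left) ≫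
          proj (M.obj ((reindex D q).obj Q)) := by
        rw [Category.assoc, left_proj, wδ]
      refine (elt_comp m hm κ hκb hmκ πT pT sT.w.symm w₁).trans ?_
      refine Eq.trans ?_ (act_eta m hm πT (v ≫ δ) wδ wη)
      exact act_congr rfl hm hm rfl (hκe _ _ w₁ v v₁ v₂) _ _
    have hmc : bs (m ≫ cart (⟨I, Q⟩ : Dill M) q) = j ≫ q := by rw [bs_comp, hm]; rfl
    have w₂ : πT ≫ j ≫ q = v ≫ proj Q := by rw [← hθ, ← Category.assoc v, v₂, Category.assoc]
    have e₂ : elt (m ≫ cart (⟨I, Q⟩ : Dill M) q) hmc πT v w₂ = elt m hm πT (v ≫ δ) wδ :=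
      elt_comp_cartSq (X := ⟨J, (reindex D q).obj Q⟩) (Y := ⟨I, Q⟩) q (FibredMonad.pr q Q) sQ m hm
        hmc πT (v ≫ δ) v ((Category.assoc _ _ _).trans ((congrArg (fun s => v ≫ s) δ₁).trans
          (Category.comp_id _))) wδ w₂
    have hcs : bs (cart L q' ≫ s) = j ≫ q := by rw [← w, hmc]
    have e₃ : elt (m ≫ cart (⟨I, Q⟩ : Dill M) q) hmc πT v w₂ =
        act (cart L q') (bs_cart L q') πT (elt s hs (πT ≫ q') v sV.w.symm)
          (elt_mpj _ _ _ _ _).symm :=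
      (elt_congr w hmc hcs rfl rfl w₂ w₂).trans (elt_comp (cart L q') (bs_cart L q') s hs hcs _ _ _ _)
    have e₄ : elt (m ≫ κ) hmκ πT pT sT.w.symm ≫ M.map q' (FibredMonad.pr q' L.fam)
        (FibredMonad.isPullback_pr q' L.fam).w = elt s hs (πT ≫ q') v sV.w.symm := by
      rw [e₁, ← e₂, e₃]
      exact act_cartSq (X := ⟨W, (reindex D q').obj L.fam⟩) q' _ _ _ _ _ _
    rw [← e₄, hψ₀]
    constructor
    · intro e
      rw [hτ]
      exact congrArg (fun s => s ≫ M.map q' (FibredMonad.pr q' L.fam) _)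
        (elt_congr e hmκ ht rfl rfl _ _)
    · intro e
      refine hom_ext_univ hmκ ht sT ?_
      rw [← hτ]
      exact reindex_mel_hom_ext q' ((elt_mpj (m ≫ κ) hmκ _ _ _).trans hτ'.symm) e
  let V' : Slice D L.base :=
    MorphismProperty.Over.mk ⊤ (πT ≫ q') (MorphismProperty.of_isPullback sV Q.prop)
  let ψ : V' ⟶ M.obj L.fam := MorphismProperty.Over.homMk ψ₀ hψ₀'
  refine ⟨mkHom (Y := ⟨I, Q⟩) k (V := V') sV ψ, ⟨rfl, fun m hm w => ?_⟩, ?_⟩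
  · exact (key _ (bs_mkHom (Y := ⟨I, Q⟩) k sV ψ) m hm w).2
      (elt_mkHom_univ (Y := ⟨I, Q⟩) k sV ψ _)
  · rintro s ⟨hs, hs'⟩
    obtain ⟨m, hm, hm'⟩ := (isCart_cart (⟨I, Q⟩ : Dill M) q).exists_lift (cart L q' ≫ s) j (by
      rw [bs_comp, hs]
      exact sq.w.symm)
    refine hom_ext_univ (Y := ⟨I, Q⟩) hs (bs_mkHom (Y := ⟨I, Q⟩) k sV ψ) sV ?_
    exact ((key s hs m hm hm').1 (hs' m hm hm')).trans
      (elt_mkHom_univ (Y := ⟨I, Q⟩) k sV ψ _).symm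

/-- `R` represents the maps into `Z₀` out of a reindexing of `X₀`. -/
def IsRepresenting {J K R : B} (g : K ⟶ J) (X : Slice D J) (Z : Slice D K) (ρ : R ⟶ K)
    (Θ : (⟨R, (reindex D (ρ ≫ g)).obj X⟩ : Dill M) ⟶ ⟨K, Z⟩) : Prop :=
  bs Θ = ρ ∧ ∀ ⦃W : B⦄ (h : W ⟶ J) (e : W ⟶ K), e ≫ g = h →
    ∀ t : (⟨W, (reindex D h).obj X⟩ : Dill M) ⟶ ⟨K, Z⟩, bs t = e →
      ∃! l : W ⟶ R, l ≫ ρ = e ∧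
        ∀ γ : (⟨W, (reindex D h).obj X⟩ : Dill M) ⟶ ⟨R, (reindex D (ρ ≫ g)).obj X⟩, bs γ = l →
          γ ≫ cart ⟨J, X⟩ (ρ ≫ g) = cart ⟨J, X⟩ h → γ ≫ Θ = t

theorem cartSq_congr {X Y : Dill M} {h h' : X.base ⟶ Y.base} (e : h = h') {k k' : X.el ⟶ Y.el}
    (e' : k = k') (sq : IsPullback k X.pj Y.pj h) (sq' : IsPullback k' X.pj Y.pj h') :
    cartSq h k sq = cartSq h' k' sq' := by
  subst e e'
  rfl

/-- A map `h^* X ⟶ Z` over `e` is represented by `e^* Z ⟶ M (h^* X)`, equivalently by a map `e^* Z ⟶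
M X` over `h`. These are elements of the `Π`-type along `Z` of `E`, the pullback of `M X` to `Z`. -/
theorem exists_isRepresenting_of_isPi {J K : B} (g : K ⟶ J) (X : Slice D J) (Z : Slice D K)
    {E : B} {u : E ⟶ (M.obj X).left} {e : E ⟶ Z.left}
    (sE : IsPullback u e (proj (M.obj X)) (proj Z ≫ g)) {R P : B} {ρ : R ⟶ K} {a : P ⟶ R}
    {b : P ⟶ Z.left} {ev : P ⟶ E} (H : IsPi (proj Z) e ρ a b ev) :
    ∃ Θ : (⟨R, (reindex D (ρ ≫ g)).obj X⟩ : Dill M) ⟶ ⟨K, Z⟩, IsRepresenting g X Z ρ Θ := by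
  have hDa : D a := MorphismProperty.of_isPullback H.sq.flip Z.prop
  have sX := FibredMonad.isPullback_pr (ρ ≫ g) X
  have sMX := M.isPullback_map_pr (ρ ≫ g) X
  have w₀ : (ev ≫ u) ≫ proj (M.obj X) = a ≫ ρ ≫ g := by
    rw [Category.assoc, sE.w, ← Category.assoc, H.w, ← Category.assoc, ← H.sq.w, Category.assoc]
  let V : Slice D R := MorphismProperty.Over.mk ⊤ a hDa
  let φ : V ⟶ M.obj ((reindex D (ρ ≫ g)).obj X) :=
    MorphismProperty.Over.homMk (sMX.lift (ev ≫ u) a w₀) (sMX.lift_snd _ _ _)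
  have hφ : φ.left ≫ M.map (ρ ≫ g) (FibredMonad.pr (ρ ≫ g) X) sX.w = ev ≫ u :=
    sMX.lift_fst _ _ _
  obtain ⟨Θ, hΘ⟩ : ∃ Θ : (⟨R, (reindex D (ρ ≫ g)).obj X⟩ : Dill M) ⟶ ⟨K, Z⟩,
    Θ = mkHom (X := ⟨R, (reindex D (ρ ≫ g)).obj X⟩) (Y := ⟨K, Z⟩) ρ (V := V) H.sq.flip φ :=
      ⟨_, rfl⟩
  have hΘb : bs Θ = ρ := by rw [hΘ]; rfl
  have hΘe {W : B} (c : W ⟶ R) (z : W ⟶ Z.left) (w : c ≫ ρ = z ≫ proj Z) (j : W ⟶ P)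
      (hj₁ : j ≫ a = c) (hj₂ : j ≫ b = z) : elt Θ hΘb c z w = j ≫ φ.left := by
    subst hΘ
    refine (elt_mkHom (X := ⟨R, (reindex D (ρ ≫ g)).obj X⟩) (Y := ⟨K, Z⟩) ρ (V := V) H.sq.flip φ
      hΘb c z w w.symm).trans ?_
    have : H.sq.flip.lift z c w.symm = j := H.sq.flip.hom_ext
      ((H.sq.flip.lift_fst _ _ _).trans hj₂.symm) ((H.sq.flip.lift_snd _ _ _).trans hj₁.symm)
    exact congrArg (fun s => s ≫ φ.left) this
  refine ⟨Θ, hΘb, fun W h e₀ he t ht => ?_⟩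
  obtain ⟨T, pT, πT, sT⟩ : ∃ (T : B) (pT : T ⟶ Z.left) (πT : T ⟶ W),
      IsPullback pT πT (proj Z) e₀ := ⟨_, _, _, FibredMonad.isPullback_pr e₀ Z⟩
  obtain ⟨τ, hτ⟩ : ∃ τ, τ = elt t ht πT pT sT.w.symm := ⟨_, rfl⟩
  have hτ' : τ ≫ proj (M.obj ((reindex D h).obj X)) = πT := by
    rw [hτ]
    exact elt_mpj t ht _ _ _
  have sL := M.isPullback_map_pr h X
  have wE : (τ ≫ M.map h (FibredMonad.pr h X) (FibredMonad.isPullback_pr h X).w) ≫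
      proj (M.obj X) = pT ≫ proj Z ≫ g := by
    rw [Category.assoc, sL.w, reassoc_of% hτ', ← he, ← Category.assoc, ← sT.w, Category.assoc]
  obtain ⟨e', he₁, he₂⟩ : ∃ e' : T ⟶ E, e' ≫ u =
      τ ≫ M.map h (FibredMonad.pr h X) (FibredMonad.isPullback_pr h X).w ∧ e' ≫ e = pT :=
    ⟨sE.lift _ _ wE, sE.lift_fst _ _ _, sE.lift_snd _ _ _⟩
  -- Both sides quantify over an object that exists uniquely: the cartesian comparison `γ₀` and the
  -- pullback comparison `j₀`. It is enough to compare the two equations for these.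
  have key (l : W ⟶ R) (hl : l ≫ ρ = e₀) :
      (∀ γ : (⟨W, (reindex D h).obj X⟩ : Dill M) ⟶ ⟨R, (reindex D (ρ ≫ g)).obj X⟩, bs γ = l →
        γ ≫ cart ⟨J, X⟩ (ρ ≫ g) = cart ⟨J, X⟩ h → γ ≫ Θ = t) ↔
      ∀ j : T ⟶ P, j ≫ a = πT ≫ l → j ≫ b = pT → j ≫ ev = e' := by
    obtain ⟨j₀, hj₁, hj₂⟩ : ∃ j : T ⟶ P, j ≫ a = πT ≫ l ∧ j ≫ b = pT :=
      ⟨H.sq.lift _ _ (by rw [Category.assoc, hl, sT.w]), H.sq.lift_fst _ _ _, H.sq.lift_snd _ _ _⟩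
    have sh := FibredMonad.isPullback_pr h X
    have hh : l ≫ ρ ≫ g = h := by rw [← Category.assoc, hl, he]
    obtain ⟨k, hk₁, hk₂⟩ : ∃ k : ((reindex D h).obj X).left ⟶ ((reindex D (ρ ≫ g)).obj X).left,
        k ≫ FibredMonad.pr (ρ ≫ g) X = FibredMonad.pr h X ∧
        k ≫ proj ((reindex D (ρ ≫ g)).obj X) = proj ((reindex D h).obj X) ≫ l :=
      ⟨sX.lift (FibredMonad.pr h X) (proj ((reindex D h).obj X) ≫ l)
        (by rw [sh.w, Category.assoc, hh]), sX.lift_fst _ _ _, sX.lift_snd _ _ _⟩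
    have sk : IsPullback k (proj ((reindex D h).obj X)) (proj ((reindex D (ρ ≫ g)).obj X)) l :=
      IsPullback.of_right (by rw [hk₁, hh]; exact sh) hk₂ sX
    obtain ⟨γ₀, hγ₀⟩ : ∃ γ₀ : (⟨W, (reindex D h).obj X⟩ : Dill M) ⟶
        ⟨R, (reindex D (ρ ≫ g)).obj X⟩, γ₀ = cartSq (X := ⟨W, (reindex D h).obj X⟩)
          (Y := ⟨R, (reindex D (ρ ≫ g)).obj X⟩) l k sk := ⟨_, rfl⟩
    have hγb : bs γ₀ = l := by rw [hγ₀]; rfl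
    have hγc : γ₀ ≫ cart ⟨J, X⟩ (ρ ≫ g) = cart ⟨J, X⟩ h := by
      rw [hγ₀]
      exact (cartSq_comp_cartSq (X := ⟨W, (reindex D h).obj X⟩)
        (Y := ⟨R, (reindex D (ρ ≫ g)).obj X⟩) (Z := ⟨J, X⟩) sk sX).trans
        (cartSq_congr hh hk₁ _ _)
    have hγΘ : bs (γ₀ ≫ Θ) = e₀ := by rw [bs_comp, hγb, hΘb, hl]
    have wl : (πT ≫ l) ≫ ρ = pT ≫ proj Z := by rw [Category.assoc, hl, sT.w]
    have e₁ : elt (γ₀ ≫ Θ) hγΘ πT pT sT.w.symm ≫ M.map h (FibredMonad.pr h X) sh.w =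
        j₀ ≫ ev ≫ u := by
      have e₂ : M.map h (FibredMonad.pr h X) sh.w =
          M.map l k sk.w ≫ M.map (ρ ≫ g) (FibredMonad.pr (ρ ≫ g) X) sX.w := by
        rw [← M.map_comp, M.map_congr hh.symm hk₁.symm]
      have e₃ := elt_comp γ₀ hγb Θ hΘb hγΘ πT pT sT.w.symm wl
      have e₄ : act γ₀ hγb πT (elt Θ hΘb (πT ≫ l) pT wl) (elt_mpj _ _ _ _ _).symm ≫
          M.map l k sk.w = elt Θ hΘb (πT ≫ l) pT wl := by
        subst hγ₀
        exact act_cartSq (X := ⟨W, (reindex D h).obj X⟩)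
          (Y := ⟨R, (reindex D (ρ ≫ g)).obj X⟩) l k sk _ _ _ _
      rw [e₂, ← Category.assoc, e₃, e₄, hΘe _ _ wl j₀ hj₁ hj₂]
      exact (Category.assoc _ _ _).trans (congrArg (fun s => j₀ ≫ s) hφ)
    have core : γ₀ ≫ Θ = t ↔ j₀ ≫ ev = e' := by
      constructor
      · intro c
        refine sE.hom_ext ?_ ?_
        · rw [Category.assoc, ← e₁, he₁, hτ]
          exact congrArg (fun s => s ≫ M.map h (FibredMonad.pr h X) _)
            (elt_congr c hγΘ ht rfl rfl _ _)
        · rw [Category.assoc, H.w, hj₂, he₂]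
      · intro c
        refine hom_ext_univ (Y := ⟨K, Z⟩) hγΘ ht sT ?_
        rw [← hτ]
        refine reindex_mel_hom_ext (Y := ⟨J, X⟩) h ((elt_mpj (γ₀ ≫ Θ) hγΘ _ _ _).trans hτ'.symm) ?_
        exact e₁.trans (by rw [← he₁, ← c, Category.assoc])
    constructor
    · intro c j h₁ h₂
      have : j = j₀ := H.sq.hom_ext (h₁.trans hj₁.symm) (h₂.trans hj₂.symm)
      rw [this]
      exact core.1 (c γ₀ hγb hγc)
    · intro c γ h₁ h₂
      have : γ = γ₀ := (isCart_cart _ _).hom_ext (h₁.trans hγb.symm) (h₂.trans hγc.symm)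
      rw [this]
      exact core.2 (c j₀ hj₁ hj₂)
  obtain ⟨l, ⟨hl, hl'⟩, hu⟩ := H.univ e₀ πT pT sT.flip e' he₂
  exact ⟨l, ⟨hl, (key l hl).2 hl'⟩, fun m hm => hu m ⟨hm.1, (key m hm.1).1 hm.2⟩⟩

/-- Maps into an initial family carry no data beyond the base map, so `K` itself represents them,
whatever `M` is. -/
theorem exists_isRepresenting_of_isInitial [HasFiniteSumTypes D] {J K : B} (g : K ⟶ J)
    (X : Slice D J) (Z : Slice D K) (hZ : Nonempty (IsInitial Z)) :
    ∃ Θ : (⟨K, (reindex D (𝟙 K ≫ g)).obj X⟩ : Dill M) ⟶ ⟨K, Z⟩,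
      IsRepresenting g X Z (𝟙 K) Θ := by
  obtain ⟨Θ, hΘ, -⟩ := existsUnique_to_isInitial
    (⟨K, (reindex D (𝟙 K ≫ g)).obj X⟩ : Dill M) hZ (𝟙 K)
  refine ⟨Θ, hΘ, fun W h e he t ht => ⟨e, ⟨Category.comp_id _, fun γ hγ _ => ?_⟩,
    fun l hl => (Category.comp_id _).symm.trans hl.1⟩⟩
  refine (existsUnique_to_isInitial _ hZ e).unique ?_ ht
  rw [bs_comp, hγ, hΘ]
  exact Category.comp_id _

end Dill

namespace Dill

variable {B : Type u} [Category.{v} B] {D : MorphismProperty B} {M : FibredMonad D}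
variable [IsDisplayMapClass D]

/-! ### `Π`-types of `Dill` -/

/-- The decomposition of a pullback `Q` of a map with complement `x`, as a product and as a
coproduct of a reindexing of `P` and a reindexing of the complement. -/
structure Splitting [HasFiniteSumTypes D] {X P Q : Dill M} {X₀ : Slice D X.base}
    (x : X ⟶ (⟨X.base, X₀⟩ : Dill M)) (a : Q ⟶ P) (b : Q ⟶ X) (q : Q.base ⟶ P.base)
    (r : Q.base ⟶ X.base) where
  /-- The complement of `a`. -/
  c : Q ⟶ (⟨Q.base, (reindex D r).obj X₀⟩ : Dill M)
  /-- The first inclusion. -/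
  i : (⟨Q.base, (reindex D q).obj P.fam⟩ : Dill M) ⟶ Q
  /-- The second inclusion. -/
  j : (⟨Q.base, (reindex D r).obj X₀⟩ : Dill M) ⟶ Q
  bs_a : bs a = q
  bs_b : bs b = r
  isComplement : IsComplement a c
  c_cart : c ≫ cart ⟨X.base, X₀⟩ r = b ≫ x
  bs_i : bs i = 𝟙 Q.base
  bs_j : bs j = 𝟙 Q.base
  i_a : i ≫ a = cart P q
  i_c : IsZeroMap (i ≫ c)
  j_a : IsZeroMap (j ≫ a)
  j_c : j ≫ c = 𝟙 _
  univ : ∀ ⦃Z : Dill M⦄ (s : (⟨Q.base, (reindex D q).obj P.fam⟩ : Dill M) ⟶ Z)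
    (t : (⟨Q.base, (reindex D r).obj X₀⟩ : Dill M) ⟶ Z), bs s = bs t →
    ∃! l : Q ⟶ Z, i ≫ l = s ∧ j ≫ l = t

variable [HasFiniteSumTypes D] [HasSigmaTypes D]

namespace Splitting

/-- The pullback of `f` has the reindexed complement, and by additivity a complemented map is a
biproduct. -/
theorem nonempty (hM : ∀ I : B, IsAdditiveMonad (M.fibre I)) {X Y P Q : Dill M}
    {X₀ : Slice D X.base} {x : X ⟶ (⟨X.base, X₀⟩ : Dill M)} {f : X ⟶ Y} (H : IsComplement f x)
    {a : Q ⟶ P} {b : Q ⟶ X} {p : P ⟶ Y} (sq : IsPullback a b p f) {q : Q.base ⟶ P.base}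
    {r : Q.base ⟶ X.base} (ha : bs a = q) (hb : bs b = r) : Nonempty (Splitting x a b q r) := by
  subst ha hb
  have sb := isPullback_bs hM sq
  obtain ⟨c, hc, hc'⟩ := (isCart_cart (⟨X.base, X₀⟩ : Dill M)
    (bs (X := Q) (Y := X) b)).exists_lift (b ≫ x) (𝟙 Q.base) (by
      rw [bs_comp, H.bs_eq]
      exact (Category.id_comp _).trans (Category.comp_id _).symm)
  have Hc := H.of_isPullback sq.flip sb.flip hc (isCart_cart (⟨X.base, X₀⟩ : Dill M)
    (bs (X := Q) (Y := X) b)) rfl hc'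
  obtain ⟨i, j, hi, hj, h₁, h₂, h₃, h₄, hu⟩ := Hc.exists_biproduct hM
  exact ⟨⟨c, i, j, rfl, rfl, Hc, hc', hi, hj, h₁, h₂, h₃, h₄, hu⟩⟩

variable {X P Q : Dill M} {X₀ : Slice D X.base} {x : X ⟶ (⟨X.base, X₀⟩ : Dill M)} {a : Q ⟶ P}
  {b : Q ⟶ X} {q : Q.base ⟶ P.base} {r : Q.base ⟶ X.base} (σ : Splitting x a b q r)

theorem hom_ext {Z : Dill M} {s t : Q ⟶ Z} (h₁ : σ.i ≫ s = σ.i ≫ t) (h₂ : σ.j ≫ s = σ.j ≫ t) :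
    s = t := by
  refine (σ.univ (σ.i ≫ s) (σ.j ≫ s) ?_).unique ⟨rfl, rfl⟩ ⟨h₁.symm, h₂.symm⟩
  rw [bs_comp, bs_comp, σ.bs_i, σ.bs_j]

variable {P' Q' : Dill M} {a' : Q' ⟶ P'} {b' : Q' ⟶ X} {q' : Q'.base ⟶ P'.base}
  {r' : Q'.base ⟶ X.base} (σ' : Splitting x a' b' q' r') {k : P' ⟶ P} {l : Q' ⟶ Q}

theorem c_comp (hb : l ≫ b = b')
    {η : (⟨Q'.base, (reindex D r').obj X₀⟩ : Dill M) ⟶ ⟨Q.base, (reindex D r).obj X₀⟩}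
    (hη : bs η = bs (X := Q') (Y := Q) l) (hη' : η ≫ cart ⟨X.base, X₀⟩ r = cart ⟨X.base, X₀⟩ r') :
    l ≫ σ.c = σ'.c ≫ η := by
  refine (isCart_cart (⟨X.base, X₀⟩ : Dill M) r).hom_ext ?_ ?_
  · rw [bs_comp, bs_comp, σ.isComplement.bs_eq, σ'.isComplement.bs_eq, hη]
    exact (Category.comp_id _).trans (Category.id_comp _).symm
  · rw [Category.assoc, σ.c_cart, reassoc_of% hb, Category.assoc, hη', σ'.c_cart]

theorem exists_map (σ : Splitting x a b q r) (σ' : Splitting x a' b' q' r') (hb : l ≫ b = b') :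
    ∃ η : (⟨Q'.base, (reindex D r').obj X₀⟩ : Dill M) ⟶ ⟨Q.base, (reindex D r).obj X₀⟩,
      bs η = bs (X := Q') (Y := Q) l ∧ η ≫ cart ⟨X.base, X₀⟩ r = cart ⟨X.base, X₀⟩ r' := by
  refine (isCart_cart (⟨X.base, X₀⟩ : Dill M) r).exists_lift _ _ ?_
  rw [bs_cart, bs_cart, ← σ.bs_b, ← σ'.bs_b, ← hb]
  rfl

/-- Naturality of the first inclusion, checked on product components: those along `a` agree by
cartesianness, and those along `c` are zero maps over the same base map. -/
theorem i_comp (σ : Splitting x a b q r) (σ' : Splitting x a' b' q' r') (hM : ∀ I : B, IsAdditiveMonad (M.fibre I)) (ha : l ≫ a = a' ≫ k)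
    (hb : l ≫ b = b')
    {m : (⟨Q'.base, (reindex D q').obj P'.fam⟩ : Dill M) ⟶ ⟨Q.base, (reindex D q).obj P.fam⟩}
    (hm : bs m = bs (X := Q') (Y := Q) l) (hm' : m ≫ cart P q = cart P' q' ≫ k) :
    σ'.i ≫ l = m ≫ σ.i := by
  obtain ⟨η, hη, hη'⟩ := σ.exists_map σ' hb
  refine σ.isComplement.hom_ext ?_ ?_
  · rw [Category.assoc, ha, ← Category.assoc, σ'.i_a, Category.assoc, σ.i_a, hm']
  · refine IsZeroMap.ext hM ?_ ?_ ?_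
    · rw [Category.assoc, σ.c_comp σ' hb hη hη', ← Category.assoc]
      exact σ'.i_c.comp _
    · rw [Category.assoc]
      exact σ.i_c.comp_left _
    · rw [bs_comp, bs_comp, bs_comp, bs_comp, σ.bs_i, σ'.bs_i, hm]
      exact congrArg (fun t => t ≫ bs σ.c)
        ((Category.id_comp (bs (X := Q') (Y := Q) l)).trans (Category.comp_id _).symm)

/-- As for the first inclusion, with the roles exchanged: the components along `a` vanish and those
along `c` agree. -/
theorem j_comp (σ : Splitting x a b q r) (σ' : Splitting x a' b' q' r') (hM : ∀ I : B, IsAdditiveMonad (M.fibre I)) (ha : l ≫ a = a' ≫ k)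
    (hb : l ≫ b = b')
    {η : (⟨Q'.base, (reindex D r').obj X₀⟩ : Dill M) ⟶ ⟨Q.base, (reindex D r).obj X₀⟩}
    (hη : bs η = bs (X := Q') (Y := Q) l) (hη' : η ≫ cart ⟨X.base, X₀⟩ r = cart ⟨X.base, X₀⟩ r') :
    σ'.j ≫ l = η ≫ σ.j := by
  refine σ.isComplement.hom_ext (IsZeroMap.ext hM ?_ ?_ ?_) ?_
  · rw [Category.assoc, ha, ← Category.assoc]
    exact σ'.j_a.comp _
  · rw [Category.assoc]
    exact σ.j_a.comp_left _
  · rw [bs_comp, bs_comp, bs_comp, bs_comp, σ.bs_j, σ'.bs_j, hη]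
    exact congrArg (fun t => t ≫ bs a)
      ((Category.id_comp (bs (X := Q') (Y := Q) l)).trans (Category.comp_id _).symm)
  · rw [Category.assoc, σ.c_comp σ' hb hη hη', ← Category.assoc, σ'.j_c, Category.assoc, σ.j_c,
      Category.id_comp, Category.comp_id]

end Splitting

/-- `Π`-types of `Dill`, built from a representing map and a `Π`-type of the base. -/
theorem exists_isPi_of_isRepresenting (hM : ∀ I : B, IsAdditiveMonad (M.fibre I))
    {X Y Z : Dill M} {f : X ⟶ Y} {g : Z ⟶ X} {X₀ : Slice D X.base} {Z₀ : Slice D Z.base}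
    {x : X ⟶ (⟨X.base, X₀⟩ : Dill M)} {z : Z ⟶ (⟨Z.base, Z₀⟩ : Dill M)} (Hf : IsComplement f x)
    (Hg : IsComplement g z) {R : B} {ρ : R ⟶ Z.base}
    {Θ : (⟨R, (reindex D (ρ ≫ bs g)).obj X₀⟩ : Dill M) ⟶ ⟨Z.base, Z₀⟩}
    (hR : IsRepresenting (bs g) X₀ Z₀ ρ Θ) {P₀ Q₀ : B} {p₀ : P₀ ⟶ Y.base} {q : Q₀ ⟶ P₀}
    {b₀ : Q₀ ⟶ X.base} {ev₀ : Q₀ ⟶ R} (H₀ : IsPi (bs f) (ρ ≫ bs g) p₀ q b₀ ev₀)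
    (F : Slice D P₀) {θ : F.left ⟶ Q₀} (hθ : θ ≫ q = proj F) {pz : F.left ⟶ Z₀.left}
    (sZ : IsPullback pz θ (proj Z₀) (ev₀ ≫ ρ)) :
    ∃ (P : Slice D P₀) (p : (⟨P₀, P⟩ : Dill M) ⟶ Y) (c : (⟨P₀, P⟩ : Dill M) ⟶ ⟨P₀, F⟩)
      (Q : Dill M) (a : Q ⟶ ⟨P₀, P⟩) (b : Q ⟶ X) (ev : Q ⟶ Z), bs p = p₀ ∧ IsComplement p c ∧
        IsPi f g p a b ev := by
  obtain ⟨P, p, π, hp, Hp⟩ : ∃ (P : Slice D P₀) (p : (⟨P₀, P⟩ : Dill M) ⟶ Y)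
    (c : (⟨P₀, P⟩ : Dill M) ⟶ ⟨P₀, F⟩), bs p = p₀ ∧ IsComplement p c :=
      ⟨_, exists_isComplement Y p₀ F⟩
  subst hp
  obtain ⟨X', b, a, -, hb, ha, sq, -⟩ := Hf.exists_isPullback p H₀.sq.flip
  obtain ⟨σ⟩ := Splitting.nonempty hM Hf sq.flip ha hb
  -- The evaluation into `Z₀` is assembled on the two summands of the pullback: `κ` after the
  -- reindexed projection `μ` to `F`, and `Θ` after the cartesian map `ε` over `ev₀`.
  obtain ⟨κ, hκ, hκ'⟩ := exists_sigma (⟨Z.base, Z₀⟩ : Dill M) (ev₀ ≫ ρ) F hθ sZ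
  obtain ⟨μ, hμ, hμ'⟩ := (isCart_cart (⟨P₀, F⟩ : Dill M) q).exists_lift
    (cart ⟨P₀, P⟩ q ≫ π) (𝟙 Q₀) (by
      rw [bs_comp, Hp.bs_eq]
      exact (Category.id_comp _).trans (Category.comp_id _).symm)
  obtain ⟨ε, hε, hε'⟩ := (isCart_cart (⟨X.base, X₀⟩ : Dill M)
    (ρ ≫ bs (X := Z) (Y := X) g)).exists_lift
    (cart ⟨X.base, X₀⟩ b₀) ev₀ H₀.w
  have hμκ : bs (μ ≫ κ) = ev₀ ≫ ρ := by
    rw [bs_comp, hμ, hκ]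
    exact Category.id_comp _
  have hεΘ : bs (ε ≫ Θ) = ev₀ ≫ ρ := by rw [bs_comp, hε, hR.1]
  obtain ⟨ζ, ⟨hζ₁, hζ₂⟩, -⟩ := σ.univ (μ ≫ κ) (ε ≫ Θ) (hμκ.trans hεΘ.symm)
  have hζ : bs ζ = ev₀ ≫ ρ := by
    rw [← hμκ, ← hζ₁, bs_comp, σ.bs_i]
    exact (Category.id_comp _).symm
  obtain ⟨ev, hev₁, hev₂, hev₃⟩ := Hg.exists_lift b ζ (by
    rw [hζ, hb, Category.assoc]
    exact H₀.w.symm)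
  have hev : bs ev = ev₀ ≫ ρ := hev₃.trans hζ
  refine ⟨P, p, π, _, a, b, ev, rfl, Hp, sq.flip, hev₁, ?_⟩
  intro L Q' l a' b' sq' e he
  have sb := isPullback_bs hM sq'
  obtain ⟨σ'⟩ := Splitting.nonempty hM Hf sq' rfl rfl
  have he₀ : bs e ≫ bs g = bs b' := congrArg bs he
  -- Evaluating to `e` splits into three conditions: on base maps, on the summand coming from `L`,
  -- and on the summand coming from `X₀`. They are governed by `B`, by `κ` and by `Θ` respectively.
  have key (k : L ⟶ (⟨P₀, P⟩ : Dill M)) (j : Q' ⟶ _) (hj₁ : j ≫ a = a' ≫ k)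
      (hj₂ : j ≫ b = b') : j ≫ ev = e ↔ bs (X := Q') (Y := ⟨Q₀, X'⟩) j ≫ ev₀ ≫ ρ = bs e ∧
        (∀ m : (⟨Q'.base, (reindex D (bs a')).obj L.fam⟩ : Dill M) ⟶ ⟨Q₀, (reindex D q).obj F⟩,
          bs m = bs (X := Q') (Y := ⟨Q₀, X'⟩) j → m ≫ cart ⟨P₀, F⟩ q = cart L (bs a') ≫ k ≫ π →
            m ≫ κ = σ'.i ≫ e ≫ z) ∧
        (∀ γ : (⟨Q'.base, (reindex D (bs b')).obj X₀⟩ : Dill M) ⟶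
            ⟨R, (reindex D (ρ ≫ bs g)).obj X₀⟩, bs γ = bs (X := Q') (Y := ⟨Q₀, X'⟩) j ≫ ev₀ →
          γ ≫ cart ⟨X.base, X₀⟩ (ρ ≫ bs (X := Z) (Y := X) g) = cart ⟨X.base, X₀⟩ (bs (X := Q') (Y := X) b') →
            γ ≫ Θ = σ'.j ≫ e ≫ z) := by
    obtain ⟨m, hm, hm'⟩ := (isCart_cart (⟨P₀, P⟩ : Dill M) q).exists_lift
      (cart L (bs a') ≫ k) (bs (X := Q') (Y := ⟨Q₀, X'⟩) j) (by
        have := congrArg bs hj₁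
        rw [bs_comp, ha] at this
        exact this)
    obtain ⟨η, hη, hη'⟩ := σ.exists_map σ' hj₂
    have hi := σ.i_comp σ' hM hj₁ hj₂ hm hm'
    have hj := σ.j_comp σ' hM hj₁ hj₂ hη hη'
    have e₁ : σ'.i ≫ j ≫ ζ = (m ≫ μ) ≫ κ := by
      rw [reassoc_of% hi, hζ₁, Category.assoc]
    have e₂ : σ'.j ≫ j ≫ ζ = (η ≫ ε) ≫ Θ := by
      rw [reassoc_of% hj, hζ₂, Category.assoc]
    have hmμ : bs (m ≫ μ) = bs (X := Q') (Y := ⟨Q₀, X'⟩) j := by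
      rw [bs_comp, hm, hμ]
      exact Category.comp_id _
    have hmμ' : (m ≫ μ) ≫ cart ⟨P₀, F⟩ q = cart L (bs a') ≫ k ≫ π := by
      rw [Category.assoc, hμ', reassoc_of% hm']
    have hηε : bs (η ≫ ε) = bs (X := Q') (Y := ⟨Q₀, X'⟩) j ≫ ev₀ := by rw [bs_comp, hη, hε]
    have hηε' : (η ≫ ε) ≫ cart ⟨X.base, X₀⟩ (ρ ≫ bs (X := Z) (Y := X) g) = cart ⟨X.base, X₀⟩ (bs (X := Q') (Y := X) b') := by
      rw [Category.assoc, hε', hη']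
    constructor
    · rintro rfl
      refine ⟨by rw [bs_comp, hev], fun m' h₁ h₂ => ?_, fun γ h₁ h₂ => ?_⟩
      · rw [Category.assoc, hev₂, e₁]
        congr 1
        exact (isCart_cart _ _).hom_ext (h₁.trans hmμ.symm) (h₂.trans hmμ'.symm)
      · rw [Category.assoc, hev₂, e₂]
        congr 1
        exact (isCart_cart _ _).hom_ext (h₁.trans hηε.symm) (h₂.trans hηε'.symm)
    · rintro ⟨-, h₂, h₃⟩
      refine Hg.hom_ext ?_ (σ'.hom_ext ?_ ?_)
      · rw [Category.assoc, hev₁, hj₂, he]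
      · rw [Category.assoc, hev₂, e₁, h₂ _ hmμ hmμ']
      · rw [Category.assoc, hev₂, e₂, h₃ _ hηε hηε']
  have bs_ez : bs (e ≫ z) = bs e := by
    rw [bs_comp, Hg.bs_eq]
    exact Category.comp_id _
  have hi' : bs (σ'.i ≫ e ≫ z) = bs e := by
    rw [bs_comp, σ'.bs_i, bs_ez]
    exact Category.id_comp _
  have hj' : bs (σ'.j ≫ e ≫ z) = bs e := by
    rw [bs_comp, σ'.bs_j, bs_ez]
    exact Category.id_comp _
  -- The base map of `e` and its component on the `X₀`-summand are encoded together by a map to `R`,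
  -- whose transpose in `B` is the base map `k₀` of the required map.
  obtain ⟨e₁, ⟨he₁, he₁'⟩, he₁u⟩ := hR.2 (bs (X := Q') (Y := X) b') (bs e) he₀ _ hj'
  obtain ⟨k₀, ⟨hk₁, hk₂⟩, hku⟩ := H₀.univ (bs l) (bs a') (bs b') sb e₁ (by
    rw [← Category.assoc, he₁, he₀])
  obtain ⟨j₀, hj₁, hj₂⟩ : ∃ j : Q'.base ⟶ Q₀, j ≫ q = bs (X := Q') (Y := L) a' ≫ k₀ ∧
      j ≫ b₀ = bs (X := Q') (Y := X) b' :=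
    ⟨H₀.sq.lift _ _ (by rw [Category.assoc, hk₁, sb.w]), H₀.sq.lift_fst _ _ _,
      H₀.sq.lift_snd _ _ _⟩
  have hj₃ : j₀ ≫ ev₀ = e₁ := hk₂ j₀ hj₁ hj₂
  have sq₀ : IsPullback (bs a') j₀ k₀ q :=
    (IsPullback.of_right (by rw [hj₂, hk₁]; exact sb.flip) hj₁ H₀.sq.flip).flip
  have hj₄ : j₀ ≫ ev₀ ≫ ρ = bs e := by rw [← Category.assoc, hj₃, he₁]
  -- The component on the `L`-summand is encoded by a map to the complement `F`.
  obtain ⟨s, ⟨hs, hs'⟩, hsu⟩ := hκ' L k₀ (bs (X := Q') (Y := L) a') j₀ sq₀ (σ'.i ≫ e ≫ z)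
    (hi'.trans hj₄.symm)
  obtain ⟨k, h₁, h₂, h₃⟩ := Hp.exists_lift l s (by
    rw [hs]
    exact hk₁.symm)
  have hk : bs k = k₀ := h₃.trans hs
  have hjb {k : L ⟶ (⟨P₀, P⟩ : Dill M)} (hk : bs k = k₀) {j : Q' ⟶ _} (h₁ : j ≫ a = a' ≫ k)
      (h₂ : j ≫ b = b') : bs (X := Q') (Y := ⟨Q₀, X'⟩) j = j₀ := by
    refine H₀.sq.hom_ext ?_ ?_
    · rw [hj₁, ← ha, ← hk]
      exact congrArg bs h₁
    · rw [hj₂, ← hb]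
      exact congrArg bs h₂
  refine ⟨k, ⟨h₁, fun j w₁ w₂ => ?_⟩, ?_⟩
  · have hj := hjb hk w₁ w₂
    rw [key k j w₁ w₂, hj, h₂, hj₃]
    exact ⟨hj₄, hs', he₁'⟩
  · rintro k' ⟨h₄, h₅⟩
    obtain ⟨j, w₂, w₁⟩ : ∃ j : Q' ⟶ _, j ≫ b = b' ∧ j ≫ a = a' ≫ k' :=
      ⟨sq.lift b' (a' ≫ k') (by rw [Category.assoc, h₄, sq'.w]), sq.lift_fst _ _ _,
        sq.lift_snd _ _ _⟩
    obtain ⟨c₁, c₂, c₃⟩ := (key k' j w₁ w₂).1 (h₅ j w₁ w₂)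
    have hje : bs (X := Q') (Y := ⟨Q₀, X'⟩) j ≫ ev₀ = e₁ := he₁u _ ⟨by rw [Category.assoc, c₁], c₃⟩
    have hk' : bs k' = k₀ := by
      refine hku _ ⟨congrArg bs h₄, fun j' v₁ v₂ => ?_⟩
      rw [← hje]
      congr 1
      refine H₀.sq.hom_ext ?_ ?_
      · rw [v₁, ← ha]
        exact (congrArg bs w₁).symm
      · rw [v₂, ← hb]
        exact (congrArg bs w₂).symm
    have hj := hjb hk' w₁ w₂
    refine Hp.hom_ext (h₄.trans h₁.symm) ?_
    rw [h₂]
    refine hsu _ ⟨?_, fun m hm hm' => c₂ m (hm.trans hj.symm) hm'⟩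
    rw [bs_comp, Hp.bs_eq, hk']
    exact Category.comp_id _

end Dill

/-! ### Small families are closed under finite sums of `D/I`. -/

section FiniteSums

variable {B : Type u} [Category.{v} B] {D : MorphismProperty B} [IsDisplayMapClass D]
variable {U : Universe D}

theorem respectsIso_small_proj {I : B} {X Y : Slice D I} (e : X ≅ Y) (hX : U.small (proj X)) :
    U.small (proj Y) := by
  have h₁ : e.inv.left ≫ e.hom.left = 𝟙 Y.left := congrArg (fun t => t.left) e.inv_hom_id
  have h₂ : e.hom.left ≫ e.inv.left = 𝟙 X.left := congrArg (fun t => t.left) e.hom_inv_id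
  let i : Y.left ≅ X.left := ⟨e.inv.left, e.hom.left, h₁, h₂⟩
  have : IsPullback e.inv.left (proj Y) (proj X) (𝟙 I) :=
    IsPullback.of_horiz_isIso (fst := i.hom) ⟨left_proj_id e.inv⟩
  exact U.small.of_isPullback this hX

variable [HasFiniteSumTypes D]

/-- The inclusion preserves the initial object of the small slice, and smallness is invariant under
isomorphism over `I`; binary sums are treated in the same way. -/
theorem Universe.ClosedUnderFiniteSums.small_initial (H : U.ClosedUnderFiniteSums) (I : B) :
    U.small (proj (⊥_ (Slice D I))) := by
  obtain ⟨_, _⟩ := H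
  have t : IsInitial ((U.inclusion I).obj (⊥_ (Slice U.small I))) :=
    IsInitial.isInitialObj (U.inclusion I) _ initialIsInitial
  exact respectsIso_small_proj (t.uniqueUpToIso initialIsInitial) (⊥_ (Slice U.small I)).prop

theorem Universe.ClosedUnderFiniteSums.small_coprod (H : U.ClosedUnderFiniteSums) {I : B}
    {X Y : Slice D I} (hX : U.small (proj X)) (hY : U.small (proj Y)) :
    U.small (proj (X ⨿ Y)) := by
  obtain ⟨_, _⟩ := H
  let X' : Slice U.small I := MorphismProperty.Over.mk ⊤ (proj X) hX
  let Y' : Slice U.small I := MorphismProperty.Over.mk ⊤ (proj Y) hY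
  have t := isColimitOfHasBinaryCoproductOfPreservesColimit (U.inclusion I) X' Y'
  exact respectsIso_small_proj (t.coconePointUniqueUpToIso (colimit.isColimit (pair X Y))) (X' ⨿ Y').prop

end FiniteSums

namespace Dill

variable {B : Type u} [Category.{v} B] {D : MorphismProperty B} {M : FibredMonad D}
variable [IsDisplayMapClass D] [HasFiniteSumTypes D] [HasSigmaTypes D]

/-! ### `Π`-types for classes of display maps of `Dill` -/

/-- The conditions on `S` and `Q` that give `Π`-types for `disp M S Q`. -/
structure IsPiClass (M : FibredMonad D) (S : MorphismProperty B)
    (Q : ∀ ⦃I : B⦄, Slice D I → Prop) : Prop where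
  sigma {I J : B} {q : J ⟶ I} (hq : S q) (hq' : D q) {V : Slice D J} (hV : Q V) :
    Q (MorphismProperty.Over.mk ⊤ (proj V ≫ q) (D.comp_mem _ _ V.prop hq') : Slice D I)
  representing {J K : B} {g : K ⟶ J} (hg : S g) {X : Slice D J} (hX : Q X) {Z : Slice D K}
    (hZ : Q Z) : ∃ (R : B) (ρ : R ⟶ K)
      (Θ : (⟨R, (reindex D (ρ ≫ g)).obj X⟩ : Dill M) ⟶ ⟨K, Z⟩), S ρ ∧ IsRepresenting g X Z ρ Θ

/-- The base of the `Π`-type uses `Π`-types of `S` applied to the composite of the representing map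
with the base of `g`; its complement is `Σ_q` of a reindexing of `Z₀`, hence in `Q`. -/
theorem exists_isPi_disp (hM : ∀ I : B, IsAdditiveMonad (M.fibre I)) {S : MorphismProperty B}
    {Q : ∀ ⦃I : B⦄, Slice D I → Prop} (hQ : IsSumClass Q) (hPi : IsPiClass M S Q)
    [IsDisplayMapClass S] [HasSigmaTypes S] (hS : S ≤ D) (hpi : HasPiTypes S) ⦃X Y Z : Dill M⦄
    (f : Y ⟶ X) (g : Z ⟶ Y) (hf : disp M S Q f) (hg : disp M S Q g) :
    ∃ (P T : Dill M) (p : P ⟶ X) (a : T ⟶ P) (b : T ⟶ Y) (ev : T ⟶ Z), disp M S Q p ∧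
      IsPi f g p a b ev := by
  obtain ⟨hf, X₀, hX₀, x, Hf⟩ := hf
  obtain ⟨hg, Z₀, hZ₀, z, Hg⟩ := hg
  obtain ⟨R, ρ, Θ, hρ, hR⟩ := hPi.representing hg hX₀ hZ₀
  obtain ⟨P₀, Q₀, p₀, q, b₀, ev₀, hp₀, H₀⟩ := hpi.exists_isPi hf (S.comp_mem _ _ hρ hg)
  have hq : S q := S.of_isPullback H₀.sq.flip hf
  obtain ⟨P, p, c, T, a, b, ev, hp, Hp, H⟩ := exists_isPi_of_isRepresenting hM Hf Hg hR H₀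
    (MorphismProperty.Over.mk ⊤ (proj ((reindex D (ev₀ ≫ ρ)).obj Z₀) ≫ q)
      (D.comp_mem _ _ ((reindex D (ev₀ ≫ ρ)).obj Z₀).prop (hS _ hq))) rfl
    (FibredMonad.isPullback_pr (ev₀ ≫ ρ) Z₀)
  refine ⟨_, T, p, a, b, ev, ⟨?_, _, hPi.sigma hq (hS _ hq) (hQ.reindex _ hZ₀), c, Hp⟩, H⟩
  rw [hp]
  exact hp₀

theorem exists_isRepresenting_of_hasPiTypes {S : MorphismProperty B} [IsDisplayMapClass S]
    (hpi : HasPiTypes S) {J K : B} {g : K ⟶ J} {X : Slice D J} (hX : S (proj (M.obj X)))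
    {Z : Slice D K} (hZ : S (proj Z)) : ∃ (R : B) (ρ : R ⟶ K)
      (Θ : (⟨R, (reindex D (ρ ≫ g)).obj X⟩ : Dill M) ⟶ ⟨K, Z⟩),
        S ρ ∧ IsRepresenting g X Z ρ Θ := by
  obtain ⟨E, u, e, sE, he⟩ := exists_isPullback_right hX (proj Z ≫ g)
  obtain ⟨R, P, ρ, a, b, ev, hρ, H⟩ := hpi.exists_isPi hZ he
  obtain ⟨Θ, hΘ⟩ := exists_isRepresenting_of_isPi g X Z sE H
  exact ⟨R, ρ, Θ, hρ, hΘ⟩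

theorem isSumClass_true : IsSumClass (D := D) (fun _ _ => True) :=
  ⟨fun _ => trivial, fun _ _ => trivial, fun _ _ _ => trivial⟩

theorem isPiClass_true (hpi : HasPiTypes D) : IsPiClass M D (fun _ _ => True) where
  sigma _ _ _ _ := trivial
  representing {_ _ _} _ {X} _ {Z} _ := exists_isRepresenting_of_hasPiTypes hpi (M.obj X).prop Z.prop

theorem hasPiTypes_display (hM : ∀ I : B, IsAdditiveMonad (M.fibre I)) (hpi : HasPiTypes D)
    [IsDisplayMapClass (display M)] : HasPiTypes (display M) := by
  refine HasPiTypes.of_exists_isPi ?_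
  rw [display_eq_disp]
  exact exists_isPi_disp hM isSumClass_true (isPiClass_true hpi) le_rfl hpi

theorem isSumClass_small {U : Universe D} (H : U.ClosedUnderFiniteSums) :
    IsSumClass (D := D) (fun _ X => U.small (proj X)) where
  initial := H.small_initial
  coprod := H.small_coprod
  reindex {_ _} h {X} hX := U.small.of_isPullback (FibredMonad.isPullback_pr h X) hX

/-- The representing object is a `Π`-type of `M X` along a small map; this is where `M` has to
preserve smallness. -/
theorem isPiClass_small {U : Universe D} (hsigma : U.ClosedUnderSigma) (hpi : U.ClosedUnderPi)
    (hU : ∀ (I : B) (X : Slice D I), U.small (proj X) → U.small (proj (M.obj X))) :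
    IsPiClass M U.small (fun _ X => U.small (proj X)) where
  sigma hq _ _ hV :=
    have : HasSigmaTypes U.small := hsigma
    U.small.comp_mem _ _ hV hq
  representing _ _ hX _ hZ := exists_isRepresenting_of_hasPiTypes hpi (hU _ _ hX) hZ

theorem isSumClass_isInitial : IsSumClass (D := D) (fun _ X => Nonempty (IsInitial X)) where
  initial _ := ⟨initialIsInitial⟩
  coprod := fun ⟨hX⟩ ⟨hY⟩ => ⟨IsInitial.ofUniqueHom (fun Z => coprod.desc (hX.to Z) (hY.to Z))
    fun _ _ => coprod.hom_ext (hX.hom_ext _ _) (hY.hom_ext _ _)⟩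
  reindex h _ := fun ⟨hX⟩ =>
    have := HasFiniteSumTypes.preserves (D := D) h
    ⟨IsInitial.isInitialObj (reindex D h) _ hX⟩

/-- `Σ_q` is left adjoint to `q^*` and so preserves initial families; the representing map may be
taken to be an identity. -/
theorem isPiClass_isInitial (S : MorphismProperty B) [S.ContainsIdentities] :
    IsPiClass M S (fun _ X => Nonempty (IsInitial X)) where
  sigma {I J q} _ hq {V} := fun ⟨t⟩ => by
    have w (X : Slice D I) : ((t.to ((reindex D q).obj X)).left ≫ FibredMonad.pr q X) ≫ proj X =
        proj V ≫ q := by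
      rw [Category.assoc, (FibredMonad.isPullback_pr q X).w, ← Category.assoc, left_proj]
    refine ⟨IsInitial.ofUniqueHom (fun X => MorphismProperty.Over.homMk
      ((t.to ((reindex D q).obj X)).left ≫ FibredMonad.pr q X) (w X)) fun X m => ?_⟩
    have sX := FibredMonad.isPullback_pr q X
    let φ : V ⟶ (reindex D q).obj X := MorphismProperty.Over.homMk
      (sX.lift m.left (proj V) (left_proj m)) (sX.lift_snd _ _ _)
    have hφ : φ.left ≫ FibredMonad.pr q X = m.left := sX.lift_fst _ _ _
    have e : φ = t.to _ := t.hom_ext _ _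
    refine MorphismProperty.Over.Hom.ext ?_
    rw [← hφ, e]
    rfl
  representing {_ K g} _ {X} _ {Z} hZ := by
    obtain ⟨Θ, hΘ⟩ := exists_isRepresenting_of_isInitial (M := M) g X Z hZ
    exact ⟨K, 𝟙 K, Θ, S.id_mem K, hΘ⟩

/-! ### Universes of `Dill` -/

/-- Over a zero object a complemented map is given by its base map and its complement alone. So the
map with data `w` and `E` is generic as soon as every base map in `S` with a family in `Q` on its
domain is a pullback of `w` and `E`. -/
theorem smallMaps_eq_disp (hM : ∀ I : B, IsAdditiveMonad (M.fibre I)) {S : MorphismProperty B}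
    [IsDisplayMapClass S] {Q : ∀ ⦃I : B⦄, Slice D I → Prop} (hQ : IsSumClass Q) {T V : B}
    {w : T ⟶ V} (hw : S w) {E : Slice D T} (hE : Q E)
    (H : ∀ ⦃A I : B⦄ (f : A ⟶ I) (C : Slice D A), S f → Q C → ∃ (t : A ⟶ T) (s : I ⟶ V)
      (γ : (⟨A, C⟩ : Dill M) ⟶ ⟨T, E⟩), IsPullback t f w s ∧ bs γ = t ∧ IsCart γ) :
    ∃ (X : Dill M) (u : X ⟶ zero M V), disp M S Q u ∧ smallMaps u = disp M S Q := by
  obtain ⟨u, c, hu, Hu⟩ := exists_isComplement (zero M V) w E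
  have hu' : disp M S Q u := ⟨by rw [hu]; exact hw, E, hE, c, Hu⟩
  have := isDisplayMapClass_disp hM hQ (S := S)
  refine ⟨_, u, hu', ?_⟩
  ext X Y f
  constructor
  · rintro ⟨t, s, sq⟩
    exact (disp M S Q).of_isPullback sq hu'
  · rintro ⟨hf, C, hC, e, He⟩
    obtain ⟨t, s, γ, sq, hγ, hγ'⟩ := H (bs f) C hf hC
    obtain ⟨β, hβ, -⟩ := existsUnique_to_zero Y s
    have hb : bs (e ≫ γ) = t := by
      rw [bs_comp, He.bs_eq, hγ]
      exact Category.id_comp _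
    obtain ⟨α, h₁, h₂, h₃⟩ := Hu.exists_lift (f ≫ β) (e ≫ γ) (by
      rw [hb, hu, bs_comp, hβ]
      exact sq.w.symm)
    refine ⟨α, β, He.isPullback Hu h₁ h₂ ?_ hγ'⟩
    rw [h₃, hb, hu, hβ]
    exact sq

theorem exists_universe_of_smallMaps_eq (hM : ∀ I : B, IsAdditiveMonad (M.fibre I))
    {S : MorphismProperty B} [IsDisplayMapClass S] {Q : ∀ ⦃I : B⦄, Slice D I → Prop}
    (hQ : IsSumClass Q) (hS : S ≤ D) {X Y : Dill M} {u : X ⟶ Y} (hu : disp M S Q u)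
    (h : smallMaps u = disp M S Q) :
    ∃ W : Universe (display M), W.small = disp M S Q := by
  have : IsDisplayMapClass (smallMaps u) := by
    rw [h]
    exact isDisplayMapClass_disp hM hQ
  refine ⟨⟨X, Y, u, ?_, this⟩, h⟩
  rw [display_eq_disp]
  exact disp_mono hS (fun _ _ _ => trivial) _ hu

theorem closedUnderPi_of_small_eq (hM : ∀ I : B, IsAdditiveMonad (M.fibre I)) {U : Universe D}
    (hsigma : U.ClosedUnderSigma) (hpi : U.ClosedUnderPi) {Q : ∀ ⦃I : B⦄, Slice D I → Prop}
    (hQ : IsSumClass Q) (hPi : IsPiClass M U.small Q) {W : Universe (display M)}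
    (hW : W.small = disp M U.small Q) : W.ClosedUnderPi := by
  have : HasSigmaTypes U.small := hsigma
  refine HasPiTypes.of_exists_isPi ?_
  rw [hW]
  exact exists_isPi_disp hM hQ hPi U.small_le hpi

theorem closedUnderSigma_of_small_eq {U : Universe D} (hsigma : U.ClosedUnderSigma)
    {Q : ∀ ⦃I : B⦄, Slice D I → Prop} (hQ : IsSumClass Q) {W : Universe (display M)}
    (hW : W.small = disp M U.small Q) : W.ClosedUnderSigma := by
  have : HasSigmaTypes U.small := hsigma
  have h := hasSigmaTypes_disp (M := M) (S := U.small) hQ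
  rw [← hW] at h
  exact h

/-- The factorization for the whole model stays small: its second factor has a small base map and
complement `ρ^* G`, a reindexing of a family in `Q`. Its first factor is left against all display
maps. -/
theorem closedUnderIdentity_of_small_eq (hpi : HasPiTypes D) {U : Universe D}
    (hid : U.ClosedUnderIdentity) [IsDisplayMapClass (display M)] [HasSigmaTypes (display M)]
    {Q : ∀ ⦃I : B⦄, Slice D I → Prop} (hQ : IsSumClass Q) {W : Universe (display M)}
    (hW : W.small = disp M U.small Q) (hW' : W.ClosedUnderSigma) : W.ClosedUnderIdentity := by
  refine Universe.closedUnderIdentity_of_exists hW' ?_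
  rw [hW]
  intro A X Y x y hx hy m w
  obtain ⟨hx, G, hG, g, H⟩ := hx
  obtain ⟨hy, -⟩ := hy
  obtain ⟨R, r, p, hr, hp, e⟩ := hid.exists_factorization hx hy (bs m) (congrArg bs w)
  obtain ⟨ρ, Z, n, d, c, hd, hnd, hn, Hd⟩ := exists_isAnodyne H (U.small_le _ hx) w hr e
  exact ⟨_, n, d, hn.leftMap hpi, ⟨by rw [hd]; exact hp, _, hQ.reindex ρ hG, c, Hd⟩, hnd⟩

/-- The universe of the maps which are small on bases and cartesian. -/
theorem exists_universe_isInitial (hM : ∀ I : B, IsAdditiveMonad (M.fibre I)) (U : Universe D) :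
    ∃ W : Universe (display M), W.small = disp M U.small (fun _ X => Nonempty (IsInitial X)) := by
  obtain ⟨X, u, hu, h⟩ := smallMaps_eq_disp hM isSumClass_isInitial (S := U.small) (w := U.u)
    ⟨𝟙 _, 𝟙 _, IsPullback.of_horiz_isIso ⟨by simp⟩⟩ (E := ⊥_ _) ⟨initialIsInitial⟩ (by
      rintro A I f C ⟨t, s, sq⟩ hC
      -- Between initial families every map is cartesian, as maps into either family are determined
      -- by their base maps.
      obtain ⟨γ, hγ, -⟩ := existsUnique_to_zero (⟨A, C⟩ : Dill M) t
      refine ⟨t, s, γ, sq, hγ, fun Z g k hk => ?_⟩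
      obtain ⟨l, hl, hl'⟩ := existsUnique_to_isInitial Z hC k
      refine ⟨l, ⟨hl, (existsUnique_to_zero Z (bs g)).unique ?_ rfl⟩, fun m hm => hl' m hm.1⟩
      rw [bs_comp, hl]
      exact hk)
  exact exists_universe_of_smallMaps_eq hM isSumClass_isInitial U.small_le hu h

/-- The universe of the maps which are small on bases and have a small complement. -/
theorem exists_universe_small (hM : ∀ I : B, IsAdditiveMonad (M.fibre I)) (hroot : IsWellRooted D)
    (hpi : HasPiTypes D) {U : Universe D} (H : U.ClosedUnderFiniteSums) :
    ∃ W : Universe (display M), W.small = disp M U.small (fun _ X => U.small (proj X)) := by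
  obtain ⟨_, hroot⟩ := hroot
  -- `E` is `U.base × U.tot` over `U.tot`. Its `Π`-type `V` along `u` classifies a small map
  -- together with a family of codes indexed by its fibres.
  obtain ⟨E, e₁, e₂, sE, hE⟩ := exists_isPullback_right (hroot U.base) (terminal.from U.tot)
  obtain ⟨V, T, p, a, b, ev, hp, HV⟩ := hpi.exists_isPi U.mem hE
  have ha : U.small a := ⟨b, p, HV.sq.flip⟩
  -- The generic small family on `T`: decode the code obtained by evaluation.
  obtain ⟨F, k, f, sF, hf⟩ := exists_isPullback_right U.mem (ev ≫ e₁)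
  obtain ⟨X, u, hu, h⟩ := smallMaps_eq_disp hM (isSumClass_small H) (S := U.small) (w := a) ha
    (E := MorphismProperty.Over.mk ⊤ f hf) ⟨k, _, sF⟩ (by
      rintro A I g C ⟨t, s, sq⟩ ⟨t', s', sq'⟩
      obtain ⟨e, h₁, h₂⟩ : ∃ e : A ⟶ E, e ≫ e₁ = s' ∧ e ≫ e₂ = t :=
        ⟨sE.lift s' t (terminal.hom_ext _ _), sE.lift_fst _ _ _, sE.lift_snd _ _ _⟩
      -- The classifying map is the transpose of the code `s'` of the family `C`, over the code `s`
      -- of `g`.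
      obtain ⟨χ, ⟨hχ, hχ'⟩, -⟩ := HV.univ s g t sq.flip e h₂
      obtain ⟨j, j₁, j₂⟩ : ∃ j : A ⟶ T, j ≫ a = g ≫ χ ∧ j ≫ b = t :=
        ⟨HV.sq.lift _ _ (by rw [Category.assoc, hχ, sq.w]), HV.sq.lift_fst _ _ _,
          HV.sq.lift_snd _ _ _⟩
      have j₃ : j ≫ ev = e := hχ' j j₁ j₂
      have sj : IsPullback j g a χ :=
        IsPullback.of_right (by rw [j₂, hχ]; exact sq) j₁ HV.sq.flip
      have hs' : j ≫ ev ≫ e₁ = s' := by rw [← Category.assoc, j₃, h₁]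
      obtain ⟨l, l₁, l₂⟩ : ∃ l : C.left ⟶ F, l ≫ k = t' ∧ l ≫ f = proj C ≫ j :=
        ⟨sF.lift t' (proj C ≫ j) (by rw [Category.assoc, hs', sq'.w]), sF.lift_fst _ _ _,
          sF.lift_snd _ _ _⟩
      have sl : IsPullback l (proj C) f j :=
        IsPullback.of_right (by rw [l₁, hs']; exact sq') l₂ sF
      exact ⟨j, χ, cartSq (X := ⟨A, C⟩) (Y := ⟨T, MorphismProperty.Over.mk ⊤ f hf⟩) j l sl, sj,
        rfl, isCart_cartSq _ _ _⟩)
  exact exists_universe_of_smallMaps_eq hM (isSumClass_small H) U.small_le hu h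

end Dill

end DillerNahm

/-! ### Assembly of the model and its two universes. -/

theorem mainTheorem2 {B : Type u} [Category.{v} B] (D : MorphismProperty B)
    [DillerNahm.IsDisplayMapClass D] (hroot : DillerNahm.IsWellRooted D)
    [DillerNahm.HasSigmaTypes D] (hpi : DillerNahm.HasPiTypes D)
    (hid : DillerNahm.HasIdentityTypes D) [DillerNahm.HasFiniteSumTypes D]
    (M : DillerNahm.FibredMonad D) (hM : ∀ I : B, DillerNahm.IsAdditiveMonad (M.fibre I)) :
    ∃ _ : DillerNahm.IsDisplayMapClass (DillerNahm.Dill.display M),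
      DillerNahm.IsWellRooted (DillerNahm.Dill.display M) ∧
      DillerNahm.HasSigmaTypes (DillerNahm.Dill.display M) ∧
      DillerNahm.HasPiTypes (DillerNahm.Dill.display M) ∧
      DillerNahm.HasIdentityTypes (DillerNahm.Dill.display M) ∧
      ∀ U : DillerNahm.Universe D, U.ClosedUnderSigma → U.ClosedUnderPi →
        U.ClosedUnderIdentity → U.ClosedUnderFiniteSums →
        -- there is a universe closed under the three type formers,
        (∃ W : DillerNahm.Universe (DillerNahm.Dill.display M),
          W.ClosedUnderSigma ∧ W.ClosedUnderPi ∧ W.ClosedUnderIdentity) ∧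
        -- and the maps of `G` that are built from `u`-small maps are the small maps of a universe,
        -- which is closed under `Π`-types if `M` preserves `u`-small maps.
        ∃ W : DillerNahm.Universe (DillerNahm.Dill.display M),
          W.small = DillerNahm.Dill.displayOf M U.small ∧
          W.ClosedUnderSigma ∧ W.ClosedUnderIdentity ∧
          ((∀ (I : B) (X : DillerNahm.Slice D I), U.small (DillerNahm.proj X) →
            U.small (DillerNahm.proj (M.obj X))) → W.ClosedUnderPi) := by
  open DillerNahm DillerNahm.Dill in
  have hdisp : IsDisplayMapClass (disp M D (fun _ _ => True)) :=
    isDisplayMapClass_disp hM isSumClass_true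
  have hdisplay : IsDisplayMapClass (display M) := by
    rw [display_eq_disp]
    exact hdisp
  have hsigma : HasSigmaTypes (display M) := by
    rw [display_eq_disp]
    exact hasSigmaTypes_disp isSumClass_true
  refine ⟨hdisplay, ?_, hsigma, hasPiTypes_display hM hpi, hasIdentityTypes_display hM hpi hid, ?_⟩
  · rw [display_eq_disp]
    exact isWellRooted_disp hroot fun _ _ => trivial
  intro U hUs hUp hUi hUf
  constructor
  · obtain ⟨W, hW⟩ := exists_universe_isInitial hM U
    have hWs := closedUnderSigma_of_small_eq hUs isSumClass_isInitial hW
    exact ⟨W, hWs, closedUnderPi_of_small_eq hM hUs hUp isSumClass_isInitial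
      (isPiClass_isInitial U.small) hW,
      closedUnderIdentity_of_small_eq hpi hUi isSumClass_isInitial hW hWs⟩
  · obtain ⟨W, hW⟩ := exists_universe_small hM hroot hpi hUf
    have hWs := closedUnderSigma_of_small_eq hUs (isSumClass_small hUf) hW
    refine ⟨W, hW.trans (displayOf_eq_disp U.small).symm, hWs,
      closedUnderIdentity_of_small_eq hpi hUi (isSumClass_small hUf) hW hWs, fun hU => ?_⟩
    exact closedUnderPi_of_small_eq hM hUs hUp (isSumClass_small hUf)
      (isPiClass_small hUs hUp hU) hW
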